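/- **Setting.** A (reward-free) Ex-BMDP with horizon $H\ge 1$ has, for each time $h\in[H]$, a finite set $\mathcal S^*_h$ of controllable latent states, an exogenous space $\mathcal E_h$ and an observation space $\mathcal X_h$ (arbitrary measurable spaces); an action set $\mathcal A$; $\mathcal S_1^*=\{s_1^*\}$; deterministic dynamics $s^*_{h+1}=T_{h+1}(s^*_h,a_h)$; an exogenous Markov chain $e_1\sim P_1^e$, $e_{h+1}\sim\mathcal T^e_{h+1}(e_h)$, with marginals $P^e_h$; and emissions $x_h\sim\mathcal Q_h(s^*_h,e_h)$ such that, for suitable functions $\phi^*_h,\phi^e_h$, almost surely $\phi_h^*(x_h)=s_h^*$ and $\phi_h^e(x_h)=e_h$. Write $s^*_h\to s^*_{h+1}$ if $s^*_{h+1}=T_{h+1}(s^*_h,a)$ for some $a\in\mathcal A$. *Data.* Two datasets $\tau_A,\tau_B$ consist of $|\tau_A|$ and $|\tau_B|$ observation trajectories $x_{1:H}$ (no actions). The controllable latent trajectories of all episodes have an arbitrary joint law on dynamically feasible trajectories; given them, the exogenous trajectories of all episodes are i.i.d. copies of the exogenous chain, and the observations are emitted independently by $\mathcal Q$. Let $D_A(s,s')$,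 $D_B(s,s')$ be the numbers of trajectories in $\tau_A$, $\tau_B$ with $\phi_h^*(x_h)=s$, $\phi_{h+1}^*(x_{h+1})=s'$; let $D=D_A+D_B$; let $D(s)$ be the number of trajectories in both datasets with $\phi^*_h(x_h)=s$; and let $\pi_A(s'|s)=D_A(s,s')/\sum_{t}D_A(s,t)$, and likewise $\pi_B$. Let $\alpha,\eta,\nu>0$ be known numbers such that, almost surely, for all $h<H$ and all $s\to s'$: 1. $D(s,s')/(|\tau_A|+|\tau_B|)\ge\nu$; 2. for every other $s''\ne s'$ with $s\to s''$, either $e^{\alpha}\frac{\pi_B(s''|s)}{\pi_B(s'|s)}\le\frac{\pi_A(s''|s)}{\pi_A(s'|s)}$ or $e^{\alpha}\frac{\pi_A(s''|s)}{\pi_A(s'|s)}\le\frac{\pi_B(s''|s)}{\pi_B(s'|s)}$; 3. $D_A(s,s')/D(s,s')\ge\eta$ and $D_B(s,s')/D(s,s')\ge\eta$. Let $\nu':=\min_{h\in[H],\,s\in\mathcal S_h^*}D(s)/(|\tau_A|+|\tau_B|)$ (not known to the algorithm), and assume $\nu'>0$ almost surely. *Hypothesis classes.* $\Phi_h$ is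 a finite set of measurable functions $\mathcal X_h\to\{0,\dots,N_s-1\}$, where $|\mathcal S_h^*|\le N_s$, that contains $\ell\circ\phi_h^*$ for every bijective labelling $\ell:\mathcal S_h^*\to\{0,\dots,|\mathcal S_h^*|-1\}$. $\mathcal G_h$ is a finite set of measurable functions $\mathcal X_h\to\{0,1\}$ with $|\mathcal G_h|\le|\Phi_h|$ such that for any ordered pair $s\neq s'$ in $\mathcal S^*_h$ some $g\in\mathcal G_h$ is almost surely $1$ on observations of $s$ and $0$ on observations of $s'$. Let $|\Phi|:=\max_h|\Phi_h|$. **Algorithm CRAFT** (input $\tau_A,\tau_B,\alpha,\eta,\nu,\Phi,\mathcal G,N_s$). Replace $\alpha$ by $\min(1,\alpha)$. Let $\xi=\alpha/4$, $n=\lceil 8\ln(\eta^{-1}-1)/\alpha\rceil$ (and $n=0$ if this is negative) and $\Xi=\{j\xi-n\xi/2: 0\le j\le n\}$. Let $\mathcal S_1$ consist of one state, to which all episodes are assigned, and let $\phi_1'\equiv 0$. For $h=1,\dots,H-1$: - Let $f_h$ minimise $\sum_{\tau_A}\ln(1+e^{-f(x_h,x_{h+1})})+\sum_{\tau_B}\ln(1+e^{f(x_h,x_{h+1})})$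 over all $f(x,x')=c(\phi(x),\phi'(x'))$ with $\phi\in\Phi_h$, $\phi'\in\Phi_{h+1}$ and a table $c$ with values in $\Xi$. Let $\mathcal S_{h+1}=\emptyset$ and $q=\frac{h\nu}{8H}$. - For each $s\in\mathcal S_h$, scan $j=0,1,\dots,n$. Let $B_j$ be the set of episodes assigned to $s$ for which $f_h$ has value $j\xi-n\xi/2$. If $|B_j|<q(|\tau_A|+|\tau_B|)$, go on to $j+1$. Otherwise let $j'$ be the least index with $j<j'\le n$ and $|B_{j'}|<q(|\tau_A|+|\tau_B|)$ (or $j'=n$ if there is none), form the cluster $\bigcup_{k=\max(0,j-1)}^{j'}B_k$, and go on to $j'+2$. Each cluster is merged into the first state of $\mathcal S_{h+1}$ that arose from earlier predecessors, has not yet been merged with a cluster of $s$, and for which the least loss $\min_{g\in\mathcal G_{h+1}}\big[\text{mean of }1-g(x_{h+1})\text{ over the cluster}+\text{mean of }g(x_{h+1})\text{ over the state}\big]$ exceeds $1/2$; if there is no such state, the cluster becomes a new state, added to $\mathcal S_{h+1}$ after all clusters of $s$ have been treated. States are labelled $0,1,2,\dots$ in order of creation. - Let $\phi_{h+1}'$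 minimise over $\phi\in\Phi_{h+1}$ the sum, over $s\in\mathcal S_{h+1}$, of the fraction of the episodes assigned to $s$ with $\phi(x_{h+1})\ne s$. Return $\phi_1',\dots,\phi_H'$. Ties in the minimisations may be resolved arbitrarily. **Theorem.** Put $\bar\alpha=\min(1,\alpha)$ and $$g=\frac{H^2\left(\ln(|\Phi|/\delta)+N_s^2\right)}{\nu\,\eta^2\,\bar\alpha^4}\cdot\max\left(\frac1{\nu^2},\frac1{\epsilon_0^2\nu'^2}\right).$$ There are a function $f$ of $\left(H,|\Phi|,N_s,\frac1\delta,\frac1{\epsilon_0},\frac1\nu,\frac1{\nu'},\frac1\eta,\frac1\alpha\right)$ alone (in particular independent of the sizes of the exogenous and observation spaces) and absolute constants $C,k$ such that $f\le C\,g\,\log^k g$ whenever $H,|\Phi|,N_s\ge1$, $0<\delta\le1$, $\epsilon_0>0$, $0<\nu,\nu'\le1$, $0<\eta\le\frac12$ and $\alpha>0$, and the following holds in the setting above, for all $\delta,\epsilon_0>0$. If almost surely $D(s,s')\ge f\left(H,|\Phi|,N_s,\frac1\delta,\frac1{\epsilon_0},\frac1\nu,\frac1{\nu'},\frac1\eta,\frac1\alpha\right)$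 for all $h<H$ and all $s\to s'$, then, with probability at least $1-\delta$, CRAFT has a run on the data, and for the inferred states $\mathcal S_h$ and encoders $\phi_h'$ of every such run there are bijections $\sigma_h:\mathcal S_h\to\mathcal S_h^*$ with $$\forall h\in[H],\ \forall s^*\in\mathcal S_h^*:\quad \Pr_{e\sim P_h^e,\ x\sim\mathcal Q_h(s^*,e)}\left(\phi_h'(x)=\sigma_h^{-1}(\phi_h^*(x))\right)\ge 1-\epsilon_0 .$$ -/

import Mathlib

open MeasureTheory ProbabilityTheory

noncomputable section

namespace CRAFT

/-- The law of a Markov chain `(e_0, …, e_N)` on the spaces `E 0, …, E N`, with initial law `P` and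
transition kernels `K h`. -/
def chainLaw : ∀ {N : ℕ} {E : Fin (N + 1) → Type*} [∀ h, MeasurableSpace (E h)]
    (_ : Measure (E 0)) (_ : ∀ h : Fin N, Kernel (E h.castSucc) (E h.succ)),
    Measure (∀ h, E h)
  | 0, E, _, P, _ => P.map fun e => Fin.cons (α := E) e fun i => i.elim0
  | _ + 1, E, _, P, K => P.bind fun e =>
      (chainLaw (E := fun h => E h.succ) (K 0 e) fun h => K h.succ).map
        fun t => Fin.cons (α := E) e t

/-- A reward-free Ex-BMDP with horizon `H = N + 1` and deterministic controllable latent dynamics.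
Time steps are numbered `0, …, N`. -/
structure ExBMDP (N : ℕ) (A : Type*) (S E X : Fin (N + 1) → Type*)
    [∀ h, MeasurableSpace (E h)] [∀ h, MeasurableSpace (X h)] where
  /-- the controllable latent state in which every episode starts -/
  init : S 0
  init_unique : ∀ s, s = init
  /-- deterministic controllable dynamics -/
  trans : ∀ h : Fin N, S h.castSucc → A → S h.succ
  /-- exogenous noise: a Markov chain that does not depend on the actions -/
  exoInit : Measure (E 0)
  exoInit_prob : IsProbabilityMeasure exoInit
  exoTrans : ∀ h : Fin N, Kernel (E h.castSucc) (E h.succ)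
  exoTrans_markov : ∀ h, IsMarkovKernel (exoTrans h)
  /-- emission: the law of the observation, given both latent factors -/
  emit : ∀ h, S h → Kernel (E h) (X h)
  emit_markov : ∀ h s, IsMarkovKernel (emit h s)
  /-- the ground-truth encoder of the controllable latent state -/
  enc : ∀ h, X h → S h
  /-- the ground-truth encoder of the exogenous state -/
  exoEnc : ∀ h, X h → E h
  enc_measurable : ∀ h s, MeasurableSet {x | enc h x = s}
  /-- the block assumption -/
  block : ∀ h s e, ∀ᵐ x ∂(emit h s e), enc h x = s ∧ exoEnc h x = e

namespace ExBMDP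

variable {N : ℕ} {A : Type*} {S E X : Fin (N + 1) → Type*}
  [∀ h, MeasurableSpace (E h)] [∀ h, MeasurableSpace (X h)]

/-- `s` can transition to `s'`. -/
def CanTransition (M : ExBMDP N A S E X) (h : Fin N) (s : S h.castSucc) (s' : S h.succ) : Prop :=
  ∃ a, s' = M.trans h s a

/-- A controllable latent trajectory that some action sequence produces. -/
def Feasible (M : ExBMDP N A S E X) (z : ∀ h, S h) : Prop :=
  z 0 = M.init ∧ ∀ h : Fin N, M.CanTransition h (z h.castSucc) (z h.succ)

/-- The law of the exogenous trajectory. -/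
def exoLaw (M : ExBMDP N A S E X) : Measure (∀ h, E h) :=
  chainLaw M.exoInit M.exoTrans

/-- The law of the exogenous state at time `h`. -/
def exoMarginal (M : ExBMDP N A S E X) (h : Fin (N + 1)) : Measure (E h) :=
  M.exoLaw.map fun e => e h

/-- The law of an observation of the latent state `s` at time `h`. -/
def obsMarginal (M : ExBMDP N A S E X) (h : Fin (N + 1)) (s : S h) : Measure (X h) :=
  (M.exoMarginal h).bind fun e => M.emit h s e

/-- The law of an observation trajectory with controllable latent trajectory `z`: draw the exogenous
trajectory from its Markov chain, then emit the observations independently. -/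
def obsLaw (M : ExBMDP N A S E X) (z : ∀ h, S h) : Measure (∀ h, X h) :=
  M.exoLaw.bind fun e => Measure.pi fun h => M.emit h (z h) (e h)

/-- The joint law of the two datasets when the controllable latent trajectories of all episodes of
both datasets have the (arbitrary) joint law `Λ` and the noise is independent of them. Episodes are
indexed by `Fin nA ⊕ Fin nB`: agent `A` collected those on the left, agent `B` those on the right. -/
def dataLaw (M : ExBMDP N A S E X) [∀ h, Fintype (S h)] {nA nB : ℕ}
    (Λ : PMF (Fin nA ⊕ Fin nB → ∀ h, S h)) : Measure (Fin nA ⊕ Fin nB → ∀ h, X h) :=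
  ∑ z, Λ z • Measure.pi fun i => M.obsLaw (z i)

end ExBMDP

/-! ### Empirical quantities and assumptions on the realised datasets -/

section Assumptions

variable {N : ℕ} {A : Type*} {S E X : Fin (N + 1) → Type*}
  [∀ h, MeasurableSpace (E h)] [∀ h, MeasurableSpace (X h)] {nA nB : ℕ}

open Classical in
/-- The number of episodes of agent `A` with latent pair `(s, s')` at times `(h, h + 1)`. -/
def countA (M : ExBMDP N A S E X) (τ : Fin nA ⊕ Fin nB → ∀ h, X h) (h : Fin N)
    (s : S h.castSucc) (s' : S h.succ) : ℕ :=
  (Finset.univ.filter fun i : Fin nA =>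
    M.enc h.castSucc (τ (Sum.inl i) h.castSucc) = s ∧ M.enc h.succ (τ (Sum.inl i) h.succ) = s').card

open Classical in
/-- The number of episodes of agent `B` with latent pair `(s, s')` at times `(h, h + 1)`. -/
def countB (M : ExBMDP N A S E X) (τ : Fin nA ⊕ Fin nB → ∀ h, X h) (h : Fin N)
    (s : S h.castSucc) (s' : S h.succ) : ℕ :=
  (Finset.univ.filter fun i : Fin nB =>
    M.enc h.castSucc (τ (Sum.inr i) h.castSucc) = s ∧ M.enc h.succ (τ (Sum.inr i) h.succ) = s').card

/-- The number of episodes of either agent with latent pair `(s, s')` at times `(h, h + 1)`. -/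
def countPair (M : ExBMDP N A S E X) (τ : Fin nA ⊕ Fin nB → ∀ h, X h) (h : Fin N)
    (s : S h.castSucc) (s' : S h.succ) : ℕ :=
  countA M τ h s s' + countB M τ h s s'

open Classical in
/-- The number of episodes of either agent with latent state `s` at time `h`. -/
def countState (M : ExBMDP N A S E X) (τ : Fin nA ⊕ Fin nB → ∀ h, X h) (h : Fin (N + 1))
    (s : S h) : ℕ :=
  (Finset.univ.filter fun i : Fin nA ⊕ Fin nB => M.enc h (τ i h) = s).card

variable [∀ h, Fintype (S h)]

/-- The empirical policy of agent `A`. -/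
def empA (M : ExBMDP N A S E X) (τ : Fin nA ⊕ Fin nB → ∀ h, X h) (h : Fin N)
    (s : S h.castSucc) (s' : S h.succ) : ℝ :=
  countA M τ h s s' / ∑ t, (countA M τ h s t : ℝ)

/-- The empirical policy of agent `B`. -/
def empB (M : ExBMDP N A S E X) (τ : Fin nA ⊕ Fin nB → ∀ h, X h) (h : Fin N)
    (s : S h.castSucc) (s' : S h.succ) : ℝ :=
  countB M τ h s s' / ∑ t, (countB M τ h s t : ℝ)

/-- Every possible latent transition makes up at least a `ν`-fraction of the data. -/
def PairCoverage (M : ExBMDP N A S E X) (τ : Fin nA ⊕ Fin nB → ∀ h, X h) (ν : ℝ) : Prop :=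
  ∀ (h : Fin N) (s : S h.castSucc) (s' : S h.succ), M.CanTransition h s s' →
    ν ≤ (countPair M τ h s s' : ℝ) / ((nA : ℝ) + nB)

/-- At every latent state, the relative likelihoods of any two distinct successors differ between
the two agents by a factor of at least `exp α`. -/
def PolicySeparation (M : ExBMDP N A S E X) (τ : Fin nA ⊕ Fin nB → ∀ h, X h) (α : ℝ) : Prop :=
  ∀ (h : Fin N) (s : S h.castSucc) (t t' : S h.succ), M.CanTransition h s t →
    M.CanTransition h s t' → t ≠ t' →
      Real.exp α * (empB M τ h s t' / empB M τ h s t) ≤ empA M τ h s t' / empA M τ h s t ∨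
      Real.exp α * (empA M τ h s t' / empA M τ h s t) ≤ empB M τ h s t' / empB M τ h s t

/-- Each agent contributes at least an `η`-share of the data of every possible latent transition. -/
def AgentShare (M : ExBMDP N A S E X) (τ : Fin nA ⊕ Fin nB → ∀ h, X h) (η : ℝ) : Prop :=
  ∀ (h : Fin N) (s : S h.castSucc) (s' : S h.succ), M.CanTransition h s s' →
    η ≤ (countA M τ h s s' : ℝ) / countPair M τ h s s' ∧
    η ≤ (countB M τ h s s' : ℝ) / countPair M τ h s s'

/-- The minimum coverage ratio of a single latent state, over all times. -/
def minStateCoverage (M : ExBMDP N A S E X) (τ : Fin nA ⊕ Fin nB → ∀ h, X h) : ℝ :=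
  ⨅ p : (Σ h, S h), (countState M τ p.1 p.2 : ℝ) / ((nA : ℝ) + nB)

/-- Realizability of the encoder classes `Φ h` (functions into `Ns` labels) and of the classes `G h`
of binary classifiers. The encoder class contains the ground-truth encoder under every bijective
labelling of the `k` latent states at time `h` by `0, …, k - 1`, and any ordered pair of distinct
latent states is perfectly distinguished by some binary classifier. -/
structure Realizable (M : ExBMDP N A S E X) (Ns : ℕ)
    (Φ : ∀ h, Finset (X h → Fin Ns)) (G : ∀ h, Finset (X h → Bool)) : Prop where
  card_le : ∀ h, Fintype.card (S h) ≤ Ns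
  enc_mem : ∀ h (lab : S h → Fin Ns), Function.Injective lab →
    (∀ s, (lab s : ℕ) < Fintype.card (S h)) → (fun x => lab (M.enc h x)) ∈ Φ h
  separates : ∀ h (s s' : S h), s ≠ s' → ∃ g ∈ G h, ∀ e,
    (∀ᵐ x ∂(M.emit h s e), g x = true) ∧ (∀ᵐ x ∂(M.emit h s' e), g x = false)
  card_G_le : ∀ h, (G h).card ≤ (Φ h).card
  measurable_enc : ∀ h, ∀ φ ∈ Φ h, Measurable φ
  measurable_classifier : ∀ h, ∀ g ∈ G h, Measurable g

end Assumptions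

/-! ### The algorithm -/

section Algorithm

variable {N : ℕ} {X : Fin (N + 1) → Type*} {nA nB : ℕ}

/-- The spacing `ξ` of the grid `Ξ` of admissible log-odds values (`α` is first cut off at `1`). -/
def gridStep (α : ℝ) : ℝ := min 1 α / 4

/-- The number `n_Ξ`; the grid `Ξ` has `n_Ξ + 1` points. -/
def gridSize (α η : ℝ) : ℕ := ⌈8 * Real.log (η⁻¹ - 1) / min 1 α⌉₊

/-- The point of the grid `Ξ` with index `j`. -/
def gridValue (α η : ℝ) (j : ℕ) : ℝ :=
  j * gridStep α - gridSize α η * gridStep α / 2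

/-- A log-odds predictor: a pair of encoders, followed by a table with entries in the grid, which are
represented by their indices `0, …, n`. -/
structure Predictor (Ns n : ℕ) (Y Y' : Type*) where
  left : Y → Fin Ns
  right : Y' → Fin Ns
  table : Fin Ns → Fin Ns → Fin (n + 1)

/-- The index of the grid point that the predictor assigns to a pair of observations. -/
def Predictor.index {Ns n : ℕ} {Y Y' : Type*} (f : Predictor Ns n Y Y') (y : Y) (y' : Y') : ℕ :=
  f.table (f.left y) (f.right y')

/-- The logistic loss of a log-odds predictor for the agent's identity. -/
def oddsLoss (α η : ℝ) {Ns : ℕ} (τ : Fin nA ⊕ Fin nB → ∀ h, X h) (h : Fin N)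
    (f : Predictor Ns (gridSize α η) (X h.castSucc) (X h.succ)) : ℝ :=
  (∑ i : Fin nA, Real.log (1 + Real.exp
    (-gridValue α η (f.index (τ (Sum.inl i) h.castSucc) (τ (Sum.inl i) h.succ))))) +
  ∑ i : Fin nB, Real.log (1 + Real.exp
    (gridValue α η (f.index (τ (Sum.inr i) h.castSucc) (τ (Sum.inr i) h.succ))))

/-- `f` minimises the logistic loss over the predictors whose encoders lie in the encoder classes. -/
def IsBestPredictor (α η : ℝ) {Ns : ℕ} (Φ : ∀ h, Finset (X h → Fin Ns))
    (τ : Fin nA ⊕ Fin nB → ∀ h, X h) (h : Fin N)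
    (f : Predictor Ns (gridSize α η) (X h.castSucc) (X h.succ)) : Prop :=
  f.left ∈ Φ h.castSucc ∧ f.right ∈ Φ h.succ ∧
  ∀ f' : Predictor Ns (gridSize α η) (X h.castSucc) (X h.succ),
    f'.left ∈ Φ h.castSucc → f'.right ∈ Φ h.succ → oddsLoss α η τ h f ≤ oddsLoss α η τ h f'

open Classical in
/-- The least `k` with `j < k ≤ n` that is not big, or `n` if there is none. -/
def blockEnd (big : ℕ → Prop) (n j : ℕ) : ℕ :=
  if ∃ k, j < k ∧ k ≤ n ∧ ¬ big k then sInf {k | j < k ∧ k ≤ n ∧ ¬ big k} else n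

theorem le_blockEnd (big : ℕ → Prop) {n j : ℕ} (h : j ≤ n) : j ≤ blockEnd big n j := by
  unfold blockEnd
  split_ifs with hk
  · exact (Nat.sInf_mem (s := {k | j < k ∧ k ≤ n ∧ ¬ big k}) hk).1.le
  · exact h

open Classical in
/-- The scan of the grid indices from `j` to `n`: it lists the pairs `(j, j')` of a big index `j` and
its block end `j'`, continuing at `j' + 2` after a block and at `j + 1` otherwise. -/
def scan (big : ℕ → Prop) (n j : ℕ) : List (ℕ × ℕ) :=
  if hj : j ≤ n then
    if big j then (j, blockEnd big n j) :: scan big n (blockEnd big n j + 2)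
    else scan big n (j + 1)
  else []
termination_by n + 1 - j
decreasing_by
  · have := le_blockEnd big hj
    omega
  · omega

open Classical in
/-- The clusters among the episodes `D`, all of which have the same inferred latent state at time
`h`. An index is big if at least `q * (nA + nB)` of these episodes are mapped to it by the predictor;
the cluster of a block `(j, j')` consists of those with index between `max 0 (j - 1)` and `j'`. -/
def clusters {Ns n : ℕ} (q : ℝ) (τ : Fin nA ⊕ Fin nB → ∀ h, X h) (h : Fin N)
    (f : Predictor Ns n (X h.castSucc) (X h.succ)) (D : Finset (Fin nA ⊕ Fin nB)) :
    List (Finset (Fin nA ⊕ Fin nB)) :=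
  (scan (fun j => q * ((nA : ℝ) + nB) ≤
      ((D.filter fun i => f.index (τ i h.castSucc) (τ i h.succ) = j).card : ℝ)) n 0).map
    fun b => D.filter fun i => b.1 - 1 ≤ f.index (τ i h.castSucc) (τ i h.succ) ∧
      f.index (τ i h.castSucc) (τ i h.succ) ≤ b.2

/-- The loss of the classifier `g` for distinguishing the time-`h` observations of the episodes `I`
(label `1`) from those of the episodes `J` (label `0`). -/
def classifierLoss (τ : Fin nA ⊕ Fin nB → ∀ h, X h) (h : Fin (N + 1)) (g : X h → Bool)
    (I J : Finset (Fin nA ⊕ Fin nB)) : ℝ :=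
  (1 / (I.card : ℝ)) * ∑ i ∈ I, (if g (τ i h) then 0 else 1) +
  (1 / (J.card : ℝ)) * ∑ i ∈ J, (if g (τ i h) then 1 else 0)

/-- The minimal classifier loss over the class `G` is greater than `1/2`. -/
def Indistinguishable (τ : Fin nA ⊕ Fin nB → ∀ h, X h) (h : Fin (N + 1))
    (G : Finset (X h → Bool)) (I J : Finset (Fin nA ⊕ Fin nB)) : Prop :=
  ∀ g ∈ G, 1 / 2 < classifierLoss τ h g I J

open Classical in
/-- Add the episodes `D` to the first inferred state that is not yet marked as merged and that is the
`same` as `D`, and mark it; return `none` if there is no such state. -/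
def mergeInto {I : Type*} (same : Finset I → Finset I → Prop) (D : Finset I) :
    List (Finset I × Bool) → Option (List (Finset I × Bool))
  | [] => none
  | (K, b) :: l =>
      if b = false ∧ same D K then some ((K ∪ D, true) :: l)
      else (mergeInto same D l).map fun l' => (K, b) :: l'

/-- Merge one cluster into an old state, or make it a new state. -/
def placeCluster {I : Type*} (same : Finset I → Finset I → Prop)
    (r : List (Finset I × Bool) × List (Finset I)) (D : Finset I) :
    List (Finset I × Bool) × List (Finset I) :=
  match mergeInto same D r.1 with
  | some l => (l, r.2)
  | none => (r.1, r.2 ++ [D])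

/-- Place all clusters that succeed one inferred predecessor state: no old state is merged twice, and
the new states are added after all clusters have been placed. -/
def placeAll {I : Type*} (same : Finset I → Finset I → Prop) (Snext : List (Finset I))
    (C : List (Finset I)) : List (Finset I) :=
  let r := C.foldl (placeCluster same) (Snext.map fun K => (K, false), [])
  r.1.map Prod.fst ++ r.2

/-- The inferred states at time `h + 1`, from those at time `h`. The inferred states at one time form
a list, whose entry with position `k` is the set of the episodes assigned to the state with label `k`.
In the threshold, `h + 1` and `N + 1` are the time step, counted from `1`, and the horizon. -/
def nextStates {Ns n : ℕ} (ν : ℝ) (G : ∀ h, Finset (X h → Bool))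
    (τ : Fin nA ⊕ Fin nB → ∀ h, X h) (h : Fin N)
    (f : Predictor Ns n (X h.castSucc) (X h.succ)) (St : List (Finset (Fin nA ⊕ Fin nB))) :
    List (Finset (Fin nA ⊕ Fin nB)) :=
  St.foldl (fun Snext D => placeAll (Indistinguishable τ h.succ (G h.succ)) Snext
    (clusters (((h : ℝ) + 1) * ν / (8 * ((N : ℝ) + 1))) τ h f D)) []

/-- The loss of an encoder at time `h`: the sum over the inferred states of its error rate. -/
def encoderLoss {Ns : ℕ} (τ : Fin nA ⊕ Fin nB → ∀ h, X h) (h : Fin (N + 1))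
    (St : List (Finset (Fin nA ⊕ Fin nB))) (φ : X h → Fin Ns) : ℝ :=
  ∑ k : Fin St.length, (1 / ((St.get k).card : ℝ)) *
    ∑ i ∈ St.get k, (if (φ (τ i h) : ℕ) = k then 0 else 1)

/-- `St` and `φ'` are the inferred states and the returned encoders of a run of CRAFT on the dataset
`τ`. A run may resolve the ties in the two empirical risk minimisations in any way. -/
def IsRun (α η ν : ℝ) {Ns : ℕ} (Φ : ∀ h, Finset (X h → Fin Ns)) (G : ∀ h, Finset (X h → Bool))
    (τ : Fin nA ⊕ Fin nB → ∀ h, X h)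
    (St : Fin (N + 1) → List (Finset (Fin nA ⊕ Fin nB))) (φ' : ∀ h, X h → ℕ) : Prop :=
  St 0 = [Finset.univ] ∧ (φ' 0 = fun _ => 0) ∧
  ∀ h : Fin N,
    (∃ f, IsBestPredictor α η Φ τ h f ∧ St h.succ = nextStates ν G τ h f (St h.castSucc)) ∧
    ∃ φ ∈ Φ h.succ, (∀ ψ ∈ Φ h.succ,
        encoderLoss τ h.succ (St h.succ) φ ≤ encoderLoss τ h.succ (St h.succ) ψ) ∧
      φ' h.succ = fun x => (φ x : ℕ)

end Algorithm

/-- Up to a bijection between inferred and true latent states, the encoder `φ'` has accuracy at least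
`1 - ε` on every latent state at time `h`. -/
def Accurate {N : ℕ} {A : Type*} {S E X : Fin (N + 1) → Type*}
    [∀ h, MeasurableSpace (E h)] [∀ h, MeasurableSpace (X h)] (M : ExBMDP N A S E X)
    (ε : ℝ) (h : Fin (N + 1)) (numStates : ℕ) (φ' : X h → ℕ) : Prop :=
  ∃ σ : Fin numStates ≃ S h, ∀ s : S h,
    1 - ε ≤ (M.obsMarginal h s).real {x | φ' x = (σ.symm (M.enc h x) : ℕ)}

/-- The rate in the sample-complexity bound, without logarithmic factors. -/
def rate (H cardΦ Ns : ℕ) (δ ε ν ν' η α : ℝ) : ℝ :=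
  (H : ℝ) ^ 2 * (Real.log (cardΦ / δ) + (Ns : ℝ) ^ 2) / (ν * η ^ 2 * α ^ 4) *
    max (1 / ν ^ 2) (1 / (ε ^ 2 * ν' ^ 2))

end CRAFT

end

/-!
Each time step of CRAFT is correct up to a small set of exceptional episodes, and these sets are so
small that they may accumulate over the horizon.

Fix the latent trajectories of all episodes. The assumptions on the data depend on nothing else, and
given them the episodes are independent. The law of the two observations `(x_h, x_{h+1})` of an
episode depends only on its latent pair `(s, s')` (`ExBMDP.obsLaw_map_pair`), so it is the same for
both agents: the observations tell nothing about the agent beyond the latent pair. Hence, pointwise in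
the observations, the expected logistic loss of a predictor on the episodes of one pair is that of a
constant guess, which is minimised at the log-odds `log (D_A(s, s') / D_B(s, s'))`. The logistic loss
is strongly convex, so a value that is not one of the two grid points next to the log-odds costs at
least `lossGap` per episode (`exists_best_gridIndex`). The true encoders followed by the best table
belong to the class. Hoeffding's inequality for independent, not identically distributed episodes
(`hoeffding_pi`) therefore shows that the empirically best predictor takes other values, that is,
deviates, on few episodes only (`card_deviants_tail`).

By the separation of the two policies, the log-odds of two successors of one state are at least four
grid points apart (`transIndex_separated`). So the scan of the grid finds one block for each successor,
with no confusion between them outside the exceptional episodes (`exists_scan_eq_map`,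
`exists_clusters_eq_map`). The observation at time `h + 1` depends on the latent state at that time
only, so a classifier has about the same mean on the clusters with the same successor, whatever their
predecessors, and the loss is close to `1` for all classifiers; for different successors some
classifier has a loss close to `0`. The threshold `1 / 2` thus merges exactly the clusters with a
common successor (`indistinguishable_iff`, `exists_placeAll_eq_map`). Hence the inferred states track
the latent states (`Tracks`, `Tracks.next`) outside the union of the sets of deviating episodes, which
by the choice of `devBudget` stays small against every latent state. The encoder that is empirically
best for the inferred states is compared with the true encoder and is accurate by uniform convergence
over the encoder class (`Tracks.accurate`).

A union bound over predictors, classifiers and encoders (`not_typicalData_le`) yields the confidence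
`1 - δ` for the number of episodes `sampleBound`, which is the rate times a cubic logarithmic factor:
one logarithm comes from the grid size in the union bound, and two from the range of the loss. The
bound is uniform in the latent trajectories, so it holds for their arbitrary joint law
(`dataLaw_le_of_forall_pi_le`).
-/

namespace CRAFT

/-! ### Laws of the exogenous chain and of the observations -/

theorem measurable_finCons {n : ℕ} {E : Fin (n + 1) → Type*} [∀ h, MeasurableSpace (E h)] :
    Measurable fun p : E 0 × (∀ i : Fin n, E i.succ) => (Fin.cons p.1 p.2 : ∀ h, E h) := by
  refine measurable_pi_iff.2 fun i => ?_
  refine Fin.cases ?_ (fun j => ?_) i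
  · simpa using measurable_fst
  · simpa [Function.comp_def] using (measurable_pi_apply j).comp measurable_snd

/-- Prepending the initial state to the law of the rest of the chain is measurable in the initial
state. -/
theorem measurable_map_cons {n : ℕ} {E : Fin (n + 1) → Type*} [∀ h, MeasurableSpace (E h)]
    {ρ : E 0 → Measure (∀ i : Fin n, E i.succ)} (hρ : Measurable ρ)
    (hp : ∀ e, IsProbabilityMeasure (ρ e)) :
    Measurable fun e => (ρ e).map fun t => (Fin.cons e t : ∀ h, E h) := by
  let κ : Kernel (E 0) (∀ i : Fin n, E i.succ) := ⟨ρ, hρ⟩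
  have : IsMarkovKernel κ := ⟨hp⟩
  refine Measure.measurable_of_measurable_coe _ fun s hs => ?_
  have hc : ∀ e : E 0, Measurable fun t : (∀ i : Fin n, E i.succ) => (Fin.cons e t : ∀ h, E h) :=
    fun e => measurable_finCons.comp measurable_prodMk_left
  simp_rw [fun e => Measure.map_apply (μ := ρ e) (hc e) hs]
  exact Kernel.measurable_kernel_prodMk_left (κ := κ) (measurable_finCons hs)

theorem chainLaw_spec : ∀ {n : ℕ} {E : Fin (n + 1) → Type*} [∀ h, MeasurableSpace (E h)]
    (K : ∀ h : Fin n, Kernel (E h.castSucc) (E h.succ)) (_ : ∀ h, IsMarkovKernel (K h)),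
    Measurable (fun P : Measure (E 0) => chainLaw P K) ∧
      ∀ P : Measure (E 0), IsProbabilityMeasure P → IsProbabilityMeasure (chainLaw P K)
  | 0, E, _, K, _ => by
    have hm : Measurable fun e : E 0 => (Fin.cons e fun i => i.elim0 : ∀ h, E h) :=
      measurable_finCons.comp measurable_prodMk_right
    refine ⟨?_, fun P hP => ?_⟩
    · simpa only [chainLaw] using Measure.measurable_map _ hm
    · simpa only [chainLaw] using Measure.isProbabilityMeasure_map hm.aemeasurable
  | n + 1, E, _, K, hK => by
    obtain ⟨hm, hp⟩ := chainLaw_spec (n := n) (E := fun h => E h.succ) (fun h => K h.succ)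
      fun h => hK h.succ
    have hp' : ∀ e, IsProbabilityMeasure
        (chainLaw (E := fun h => E h.succ) (K 0 e) fun h => K h.succ) :=
      fun e => hp _ ((hK 0).isProbabilityMeasure e)
    have hρ := measurable_map_cons (E := E) (hm.comp (K 0).measurable) hp'
    refine ⟨?_, fun P hP => ?_⟩
    · simp only [chainLaw]
      exact Measure.measurable_bind' hρ
    · simp only [chainLaw]
      refine isProbabilityMeasure_bind hρ.aemeasurable (.of_forall fun e => ?_)
      have := hp' e
      exact Measure.isProbabilityMeasure_map
        (measurable_finCons.comp measurable_prodMk_left).aemeasurable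

namespace ExBMDP

variable {N : ℕ} {A : Type*} {S E X : Fin (N + 1) → Type*}
  [∀ h, MeasurableSpace (E h)] [∀ h, MeasurableSpace (X h)]

instance (M : ExBMDP N A S E X) (h : Fin (N + 1)) (s : S h) : IsMarkovKernel (M.emit h s) :=
  M.emit_markov h s

instance (M : ExBMDP N A S E X) : IsProbabilityMeasure M.exoLaw :=
  (chainLaw_spec M.exoTrans M.exoTrans_markov).2 _ M.exoInit_prob

instance (M : ExBMDP N A S E X) (h : Fin (N + 1)) : IsProbabilityMeasure (M.exoMarginal h) :=
  Measure.isProbabilityMeasure_map (measurable_pi_apply h).aemeasurable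

instance (M : ExBMDP N A S E X) (h : Fin (N + 1)) (s : S h) :
    IsProbabilityMeasure (M.obsMarginal h s) :=
  isProbabilityMeasure_bind (M.emit h s).measurable.aemeasurable
    (.of_forall fun _ => inferInstance)

theorem measurable_pi_emit (M : ExBMDP N A S E X) (z : ∀ h, S h) :
    Measurable fun e : (∀ h, E h) => Measure.pi fun h => M.emit h (z h) (e h) := by
  refine Measurable.measure_of_isPiSystem_of_isProbabilityMeasure generateFrom_pi.symm
    isPiSystem_pi ?_
  rintro _ ⟨t, ht, rfl⟩
  simp only [Measure.pi_pi]
  refine Finset.measurable_prod _ fun h _ => ?_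
  exact (Kernel.measurable_coe _ (ht h (Set.mem_univ h))).comp (measurable_pi_apply h)

instance (M : ExBMDP N A S E X) (z : ∀ h, S h) : IsProbabilityMeasure (M.obsLaw z) :=
  isProbabilityMeasure_bind (M.measurable_pi_emit z).aemeasurable
    (.of_forall fun _ => inferInstance)

theorem obsLaw_univ_pi (M : ExBMDP N A S E X) (z : ∀ h, S h) {t : ∀ h, Set (X h)}
    (ht : ∀ h, MeasurableSet (t h)) :
    M.obsLaw z (Set.univ.pi t) = ∫⁻ e, ∏ h, M.emit h (z h) (e h) (t h) ∂M.exoLaw := by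
  rw [obsLaw, Measure.bind_apply (MeasurableSet.univ_pi ht) (M.measurable_pi_emit z).aemeasurable]
  simp only [Measure.pi_pi]

theorem obsLaw_map_eval (M : ExBMDP N A S E X) (z : ∀ h, S h) (h : Fin (N + 1)) :
    (M.obsLaw z).map (fun x => x h) = M.obsMarginal h (z h) := by
  ext t ht
  rw [Measure.map_apply (measurable_pi_apply h) ht]
  have : (fun x : (∀ h, X h) => x h) ⁻¹' t
      = Set.univ.pi (Function.update (fun _ => Set.univ) h t) := by
    rw [Set.univ_pi_update_univ]
  rw [this, obsLaw_univ_pi, obsMarginal,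
    Measure.bind_apply ht (M.emit h (z h)).measurable.aemeasurable, exoMarginal,
    lintegral_map (Kernel.measurable_coe _ ht) (measurable_pi_apply h)]
  · refine lintegral_congr fun e => ?_
    rw [Finset.prod_eq_single h]
    · simp
    · intro k _ hk; simp [hk]
    · simp
  · intro k
    by_cases hk : k = h
    · subst hk; simpa using ht
    · simp [hk]

/-- The joint law of two observations of an episode depends only on the two latent states. -/
theorem obsLaw_map_pair (M : ExBMDP N A S E X) {z z' : ∀ h, S h} {h k : Fin (N + 1)}
    (hh : z h = z' h) (hk : z k = z' k) :
    (M.obsLaw z).map (fun x => (x h, x k)) = (M.obsLaw z').map (fun x => (x h, x k)) := by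
  have hm : Measurable fun x : (∀ h, X h) => (x h, x k) :=
    (measurable_pi_apply h).prodMk (measurable_pi_apply k)
  have := Measure.isProbabilityMeasure_map (μ := M.obsLaw z) hm.aemeasurable
  refine Measure.ext_prod fun {s t} hs ht => ?_
  rw [Measure.map_apply hm (hs.prod ht), Measure.map_apply hm (hs.prod ht)]
  let u : ∀ j, Set (X j) := fun j => Function.update (fun _ => Set.univ) h s j ∩
    Function.update (fun _ => Set.univ) k t j
  have hu : (fun x : (∀ h, X h) => (x h, x k)) ⁻¹' s ×ˢ t = Set.univ.pi u := by
    rw [Set.pi_inter_distrib, Set.univ_pi_update_univ, Set.univ_pi_update_univ]; rfl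
  have hum : ∀ j, MeasurableSet (u j) := by
    intro j
    refine MeasurableSet.inter ?_ ?_
    · by_cases hj : j = h
      · subst hj; simpa using hs
      · simp [hj]
    · by_cases hj : j = k
      · subst hj; simpa using ht
      · simp [hj]
  rw [hu, obsLaw_univ_pi M z hum, obsLaw_univ_pi M z' hum]
  refine lintegral_congr fun e => Finset.prod_congr rfl fun j _ => ?_
  by_cases hj : j = h
  · subst hj; rw [hh]
  · by_cases hj' : j = k
    · subst hj'; rw [hk]
    · have : u j = Set.univ := by simp [u, hj, hj']
      simp [this]

theorem ae_obsMarginal_of_emit (M : ExBMDP N A S E X) (h : Fin (N + 1)) (s : S h)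
    {p : X h → Prop} (hp : MeasurableSet {x | p x}) (hae : ∀ e, ∀ᵐ x ∂(M.emit h s e), p x) :
    ∀ᵐ x ∂(M.obsMarginal h s), p x := by
  change M.obsMarginal h s {x | p x}ᶜ = 0
  rw [obsMarginal, Measure.bind_apply hp.compl (M.emit h s).measurable.aemeasurable]
  simp_rw [show ∀ e, M.emit h s e {x | p x}ᶜ = 0 from fun e => ae_iff.1 (hae e)]
  simp

theorem ae_obsMarginal_enc (M : ExBMDP N A S E X) (h : Fin (N + 1)) (s : S h) :
    ∀ᵐ x ∂(M.obsMarginal h s), M.enc h x = s :=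
  M.ae_obsMarginal_of_emit h s (M.enc_measurable h s) fun e => (M.block h s e).mono fun _ hx => hx.1

/-- A property of observations that holds almost surely at the latent state of an episode holds
almost surely in the data. -/
theorem ae_pi_obsLaw {ι : Type*} [Fintype ι] (M : ExBMDP N A S E X) (z : ι → ∀ h, S h) (i : ι)
    (h : Fin (N + 1)) {p : X h → Prop} (hp : ∀ᵐ x ∂(M.obsMarginal h (z i h)), p x) :
    ∀ᵐ τ ∂(Measure.pi fun i => M.obsLaw (z i)), p (τ i h) := by
  rw [← M.obsLaw_map_eval (z i) h] at hp
  exact (Measure.quasiMeasurePreserving_eval (fun i => M.obsLaw (z i)) i).ae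
    (ae_of_ae_map (measurable_pi_apply h).aemeasurable hp)

theorem ae_pi_obsLaw_enc {ι : Type*} [Fintype ι] (M : ExBMDP N A S E X) (z : ι → ∀ h, S h) :
    ∀ᵐ τ ∂(Measure.pi fun i => M.obsLaw (z i)), ∀ i h, M.enc h (τ i h) = z i h :=
  ae_all_iff.2 fun i => ae_all_iff.2 fun h => M.ae_pi_obsLaw z i h (M.ae_obsMarginal_enc h _)

end ExBMDP

/-! ### Concentration for independent, not identically distributed episodes -/

/-- **Hoeffding's inequality** for the lower tail of a sum over part of the coordinates of a product
space, when the expectation of the sum is nonnegative. -/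
theorem hoeffding_pi {ι : Type*} [Fintype ι] {Ω : ι → Type*} [∀ i, MeasurableSpace (Ω i)]
    {μ : ∀ i, Measure (Ω i)} [∀ i, IsProbabilityMeasure (μ i)] {Y : ∀ i, Ω i → ℝ}
    (hY : ∀ i, Measurable (Y i)) {a b : ℝ} (hab : a ≤ b) (s : Finset ι)
    (hb : ∀ i, ∀ᵐ ω ∂μ i, Y i ω ∈ Set.Icc a b) (hmean : 0 ≤ ∑ i ∈ s, ∫ ω, Y i ω ∂μ i)
    {t : ℝ} (ht : 0 ≤ t) :
    (Measure.pi μ).real {ω | ∑ i ∈ s, Y i (ω i) ≤ -t} ≤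
      Real.exp (-(2 * t ^ 2 / (s.card * (b - a) ^ 2))) := by
  have hind : iIndepFun (fun i (ω : ∀ i, Ω i) => (∫ x, Y i x ∂μ i) - Y i (ω i)) (Measure.pi μ) :=
    iIndepFun_pi (X := fun i x => (∫ x, Y i x ∂μ i) - Y i x)
      fun i => ((hY i).const_sub _).aemeasurable
  have hsub : ∀ i ∈ s, HasSubgaussianMGF
      (fun ω : (∀ i, Ω i) => (∫ x, Y i x ∂μ i) - Y i (ω i)) ((‖b - a‖₊ / 2) ^ 2)
      (Measure.pi μ) := by
    intro i _
    have h1 := (hasSubgaussianMGF_of_mem_Icc (hY i).aemeasurable (hb i)).neg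
    have h2 := (measurePreserving_eval μ i).map_eq
    have h3 : HasSubgaussianMGF (fun x => (∫ x, Y i x ∂μ i) - Y i x) ((‖b - a‖₊ / 2) ^ 2)
        ((Measure.pi μ).map (Function.eval i)) := by
      rw [h2]
      convert! h1 using 1
      ext x; simp
    exact HasSubgaussianMGF.of_map (Y := Function.eval i)
      (X := fun x => (∫ x, Y i x ∂μ i) - Y i x) (measurable_pi_apply i).aemeasurable h3
  have key := HasSubgaussianMGF.measure_sum_ge_le_of_iIndepFun hind hsub ht
  refine (measureReal_mono ?_).trans (key.trans ?_)
  · intro ω hω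
    simp only [Set.mem_ofPred_eq, Finset.sum_sub_distrib] at hω ⊢
    linarith
  · refine Real.exp_le_exp.2 (le_of_eq ?_)
    have : ‖b - a‖ = b - a := by
      rw [Real.norm_eq_abs, abs_of_nonneg (by linarith)]
    push_cast
    rw [Finset.sum_const, nsmul_eq_mul, this]
    by_cases h0 : (s.card : ℝ) * (b - a) ^ 2 = 0
    · have h1 : 2 * ((s.card : ℝ) * ((b - a) / 2) ^ 2) = 0 := by linear_combination h0 / 2
      rw [h0, h1]; simp
    · rw [← neg_div, div_eq_div_iff (by intro h; apply h0; linear_combination 2 * h) h0]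
      ring

/-! ### The scan of the grid -/

section Scan

variable {big : ℕ → Prop} {n j : ℕ}

theorem blockEnd_le : blockEnd big n j ≤ n := by
  unfold blockEnd
  split_ifs with hk
  · exact (Nat.sInf_mem (s := {k | j < k ∧ k ≤ n ∧ ¬ big k}) hk).2.1
  · exact le_rfl

theorem blockEnd_le_of_not_big {k : ℕ} (h1 : j < k) (h2 : k ≤ n) (h3 : ¬ big k) :
    blockEnd big n j ≤ k := by
  unfold blockEnd
  rw [if_pos ⟨k, h1, h2, h3⟩]
  exact Nat.sInf_le ⟨h1, h2, h3⟩

theorem lt_blockEnd (h : j < n) : j < blockEnd big n j := by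
  unfold blockEnd
  split_ifs with hk
  · exact (Nat.sInf_mem (s := {k | j < k ∧ k ≤ n ∧ ¬ big k}) hk).1
  · exact h

/-- If big indices occur only at the positions `m t` and `m t + 1` of points `t` that are four steps
apart, and at least one of these two indices is big for every `t`, then the scan finds exactly one
block for each `t`: the block covers both positions of `t`, and the blocks, each extended by one
step to the left, are disjoint. -/
theorem exists_scan_eq_map {T : Type*} [Finite T] {m : T → ℕ}
    (hmn : ∀ t, m t ≤ n) (hsep : ∀ t t', t ≠ t' → m t + 4 ≤ m t' ∨ m t' + 4 ≤ m t)
    (hsmall : ∀ k, k ≤ n → big k → ∃ t, k = m t ∨ k = m t + 1)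
    (hbig : ∀ t, big (m t) ∨ m t + 1 ≤ n ∧ big (m t + 1)) :
    ∃ (ts : List T) (blk : T → ℕ × ℕ), ts.Nodup ∧ (∀ t, t ∈ ts) ∧
      scan big n 0 = ts.map blk ∧
      (∀ t, (blk t).1 - 1 ≤ m t ∧ m t ≤ (blk t).2 ∧ (m t + 1 ≤ n → m t + 1 ≤ (blk t).2)) ∧
      ∀ t t', t ≠ t' → (blk t).2 < (blk t').1 - 1 ∨ (blk t').2 < (blk t).1 - 1 := by
  classical
  -- For a scan that starts at `j`, the points still to be found are those with `j ≤ m t + 1`. A point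
  -- with `m t + 1 = j` is passed over halfway; its first index must not have been big.
  suffices H : ∀ (d j : ℕ), n + 1 - j ≤ d → (∀ t, m t + 1 = j → ¬ big (m t)) →
      ∃ (ts : List T) (blk : T → ℕ × ℕ), ts.Nodup ∧ (∀ t, t ∈ ts ↔ j ≤ m t + 1) ∧
        scan big n j = ts.map blk ∧
        (∀ t ∈ ts, j ≤ (blk t).1 ∧ (blk t).1 - 1 ≤ m t ∧ m t ≤ (blk t).2 ∧
          (m t + 1 ≤ n → m t + 1 ≤ (blk t).2)) ∧
        ∀ t ∈ ts, ∀ t' ∈ ts, t ≠ t' →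
          (blk t).2 < (blk t').1 - 1 ∨ (blk t').2 < (blk t).1 - 1 by
    obtain ⟨ts, blk, h1, h2, h3, h4, h5⟩ := H (n + 1) 0 (by omega) (by intro t ht; omega)
    have h2' : ∀ t, t ∈ ts := fun t => (h2 t).2 (Nat.zero_le _)
    exact ⟨ts, blk, h1, h2', h3, fun t => (h4 t (h2' t)).2,
      fun t t' => h5 t (h2' t) t' (h2' t')⟩
  intro d
  induction d with
  | zero =>
    intro j hd hj
    refine ⟨[], fun _ => (0, 0), List.nodup_nil, fun t => ?_, ?_, by simp, by simp⟩
    · simp only [List.not_mem_nil, false_iff]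
      intro h
      have := hmn t
      have h1 := hj t (by omega)
      rcases hbig t with h2 | h2
      · exact h1 h2
      · omega
    · rw [scan, dif_neg (by omega)]; rfl
  | succ d ih =>
    intro j hd hj
    by_cases hjn : j ≤ n
    swap
    · refine ⟨[], fun _ => (0, 0), List.nodup_nil, fun t => ?_, ?_, by simp, by simp⟩
      · simp only [List.not_mem_nil, false_iff]
        intro h
        have := hmn t
        have h1 := hj t (by omega)
        rcases hbig t with h2 | h2
        · exact h1 h2
        · omega
      · rw [scan, dif_neg hjn]; rfl
    by_cases hb : big j
    swap
    · obtain ⟨ts, blk, h1, h2, h3, h4, h5⟩ := ih (j + 1) (by omega) (by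
        intro t ht
        have : m t = j := by omega
        rwa [this])
      refine ⟨ts, blk, h1, fun t => ?_, ?_, fun t ht => ?_, h5⟩
      · rw [h2]
        refine ⟨fun h => by omega, fun h => ?_⟩
        by_contra hlt
        have hjt : m t + 1 = j := by omega
        rcases hbig t with h6 | h6
        · exact hj t hjt h6
        · rw [hjt] at h6; exact hb h6.2
      · rw [scan, dif_pos hjn, if_neg hb, h3]
      · have := h4 t ht
        refine ⟨by omega, this.2⟩
    obtain ⟨t, ht⟩ := hsmall j hjn hb
    set e := blockEnd big n j with he
    have e1 : j ≤ e := le_blockEnd big hjn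
    have e2 : e ≤ n := blockEnd_le
    have e3 : m t + 1 ≤ n → m t + 1 ≤ e := by
      intro h
      rcases ht with ht | ht
      · have : j < e := lt_blockEnd (by omega)
        omega
      · omega
    have e4 : e ≤ m t + 2 := by
      by_cases h : m t + 2 ≤ n
      · refine blockEnd_le_of_not_big (by omega) h fun hb' => ?_
        obtain ⟨t', ht'⟩ := hsmall _ h hb'
        rcases eq_or_ne t t' with rfl | hne
        · omega
        · have := hsep t t' hne; omega
      · omega
    obtain ⟨ts, blk, h1, h2, h3, h4, h5⟩ := ih (e + 2) (by omega) (by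
      intro t' ht'
      exfalso
      rcases eq_or_ne t t' with rfl | hne
      · have := hmn t; omega
      · have := hsep t t' hne; have := hmn t'; omega)
    have hmt := hmn t
    have htts : t ∉ ts := by rw [h2]; omega
    refine ⟨t :: ts, Function.update blk t (j, e), List.nodup_cons.2 ⟨htts, h1⟩, fun t' => ?_, ?_,
      fun t' ht' => ?_, fun a ha b hb hab => ?_⟩
    · rw [List.mem_cons, h2]
      rcases eq_or_ne t t' with rfl | hne
      · simp; omega
      · have := hsep t t' hne
        simp only [hne.symm, false_or]
        omega
    · rw [scan, dif_pos hjn, if_pos hb, ← he, h3, List.map_cons, Function.update_self]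
      congr 1
      refine List.map_congr_left fun a ha => ?_
      rw [Function.update_of_ne]
      rintro rfl; exact htts ha
    · rcases List.mem_cons.1 ht' with rfl | h
      · simp only [Function.update_self]; omega
      · rw [Function.update_of_ne (by rintro rfl; exact htts h)]
        have := h4 t' h
        omega
    · rcases List.mem_cons.1 ha with rfl | ha'
      · have hb' := (List.mem_cons.1 hb).resolve_left hab.symm
        rw [Function.update_self, Function.update_of_ne hab.symm]
        have := h4 b hb'
        simp only; omega
      · rw [Function.update_of_ne (by rintro rfl; exact htts ha')]
        rcases List.mem_cons.1 hb with rfl | hb'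
        · rw [Function.update_self]
          have := h4 a ha'
          simp only; omega
        · rw [Function.update_of_ne (by rintro rfl; exact htts hb')]
          exact h5 a ha' b hb' hab

end Scan

/-! ### Merging clusters into inferred states -/

section Merge

variable {I L : Type*} {same : Finset I → Finset I → Prop} {D : Finset I}

theorem mergeInto_eq_none {l : List (Finset I × Bool)}
    (h : ∀ p ∈ l, ¬ (p.2 = false ∧ same D p.1)) : mergeInto same D l = none := by
  induction l with
  | nil => rfl
  | cons p l ih =>
    obtain ⟨K, b⟩ := p
    rw [mergeInto, if_neg (h (K, b) List.mem_cons_self),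
      ih fun p hp => h p (List.mem_cons_of_mem _ hp)]
    rfl

open Classical in
theorem mergeInto_map {ls : List L} (hnd : ls.Nodup) {K : L → Finset I} {b : L → Bool} {t : L}
    (ht : t ∈ ls) (hsame : ∀ l ∈ ls, (b l = false ∧ same D (K l)) ↔ l = t) :
    mergeInto same D (ls.map fun l => (K l, b l)) =
      some (ls.map fun l => (if l = t then K l ∪ D else K l, if l = t then true else b l)) := by
  induction ls with
  | nil => simp at ht
  | cons a ls ih =>
    rw [List.map_cons, mergeInto]
    have hnd' := List.nodup_cons.1 hnd
    by_cases hat : a = t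
    · rw [if_pos ((hsame a List.mem_cons_self).2 hat), List.map_cons, if_pos hat, if_pos hat]
      congr 2
      refine List.map_congr_left fun l hl => ?_
      have : l ≠ t := by rintro rfl; exact hnd'.1 (hat ▸ hl)
      simp [this]
    · rw [if_neg (mt (hsame a List.mem_cons_self).1 hat),
        ih hnd'.2 ((List.mem_cons.1 ht).resolve_left (Ne.symm hat))
          fun l hl => hsame l (List.mem_cons_of_mem _ hl)]
      simp [hat]

open Classical in
/-- If the test `same` identifies exactly the states with the label of the cluster, then placing the
clusters of one predecessor adds each cluster to the state with its label. States and clusters are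
presented as families indexed by their labels. -/
theorem exists_placeAll_eq_map {ls ts : List L} (hls : ls.Nodup) (hts : ts.Nodup) {K C : L → Finset I}
    (hsame : ∀ t ∈ ts, ∀ l ∈ ls, same (C t) (K l) ↔ l = t) :
    ∃ K' : L → Finset I,
      placeAll same (ls.map K) (ts.map C) = (ls ++ ts.filter (· ∉ ls)).map K' ∧
      ∀ l i, i ∈ K' l ↔ (l ∈ ls ∧ i ∈ K l) ∨ (l ∈ ts ∧ i ∈ C l) := by
  have key : ∀ us : List L, us <+: ts →
      (us.map C).foldl (placeCluster same) ((ls.map K).map fun K => (K, false), []) =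
        (ls.map fun l => (if l ∈ us then K l ∪ C l else K l, decide (l ∈ us)),
          (us.filter (· ∉ ls)).map C) := by
    intro us
    induction us using List.reverseRecOn with
    | nil => intro _; simp
    | append_singleton us t ih =>
      intro hpre
      have hnd : (us ++ [t]).Nodup := hts.sublist hpre.sublist
      have htus : t ∉ us := by
        intro h
        exact (List.nodup_append.1 hnd).2.2 t h t (by simp) rfl
      have htts : t ∈ ts := hpre.subset (by simp)
      have hs : ∀ l ∈ ls, (decide (l ∈ us) = false ∧
          same (C t) (if l ∈ us then K l ∪ C l else K l)) ↔ l = t := by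
        intro l hl
        by_cases hlu : l ∈ us
        · have : l ≠ t := by rintro rfl; exact htus hlu
          simp [hlu, this]
        · simp [hlu, hsame t htts l hl]
      rw [List.map_append, List.foldl_append, ih ((List.prefix_append _ _).trans hpre)]
      simp only [List.map_cons, List.map_nil, List.foldl_cons, List.foldl_nil, placeCluster]
      by_cases htl : t ∈ ls
      · rw [mergeInto_map hls htl hs]
        simp only [List.filter_append, Prod.mk.injEq]
        refine ⟨List.map_congr_left fun l _ => ?_, by simp [htl]⟩
        by_cases hlt : l = t
        · subst hlt; simp [htus]
        · simp [hlt]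
      · rw [mergeInto_eq_none]
        · simp only [List.filter_append, Prod.mk.injEq]
          refine ⟨List.map_congr_left fun l hl => ?_, by simp [htl]⟩
          have : l ≠ t := by rintro rfl; exact htl hl
          simp [this]
        · intro p hp
          obtain ⟨l, hl, rfl⟩ := List.mem_map.1 hp
          rw [hs l hl]
          rintro rfl; exact htl hl
  refine ⟨fun l => (if l ∈ ls then K l else ∅) ∪ if l ∈ ts then C l else ∅, ?_, fun l i => by
    by_cases h1 : l ∈ ls <;> by_cases h2 : l ∈ ts <;> simp [h1, h2]⟩
  rw [placeAll, key ts (List.prefix_refl ts)]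
  simp only [List.map_append, List.map_map]
  congr 1
  · refine List.map_congr_left fun l hl => ?_
    by_cases h : l ∈ ts <;> simp [h, hl]
  · refine List.map_congr_left fun l hl => ?_
    rw [List.mem_filter] at hl
    have h2 : l ∉ ls := by simpa using hl.2
    simp [h2, hl.1]

end Merge

/-! ### The logistic loss on the grid -/

theorem hasDerivAt_log_one_add_exp (x : ℝ) :
    HasDerivAt (fun x => Real.log (1 + Real.exp x)) (Real.exp x / (1 + Real.exp x)) x :=
  ((Real.hasDerivAt_exp x).const_add 1).log (by positivity)

theorem hasDerivAt_exp_div_one_add_exp (x : ℝ) :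
    HasDerivAt (fun x => Real.exp x / (1 + Real.exp x)) (Real.exp x / (1 + Real.exp x) ^ 2) x := by
  have := (Real.hasDerivAt_exp x).div ((Real.hasDerivAt_exp x).const_add 1)
    (by positivity : 1 + Real.exp x ≠ 0)
  convert! this using 1
  ring

theorem log_one_add_exp_neg (v : ℝ) :
    Real.log (1 + Real.exp (-v)) = Real.log (1 + Real.exp v) - v := by
  have h : 1 + Real.exp (-v) = (1 + Real.exp v) / Real.exp v := by
    rw [Real.exp_neg]; field_simp; ring
  rw [h, Real.log_div (by positivity) (by positivity), Real.log_exp]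

theorem exp_div_sq_lower {B x : ℝ} (h : |x| ≤ B) :
    Real.exp (-B) / 4 ≤ Real.exp x / (1 + Real.exp x) ^ 2 := by
  have h1 := Real.exp_le_exp.2 (abs_le.1 h).1
  have h2 := Real.exp_le_exp.2 (abs_le.1 h).2
  have hB : Real.exp (-B) * Real.exp B = 1 := by rw [← Real.exp_add]; simp
  have hB1 : 1 ≤ Real.exp B := Real.one_le_exp ((abs_nonneg x).trans h)
  have hp := Real.exp_pos (-B)
  rw [div_le_div_iff₀ (by norm_num) (by positivity)]
  set y := Real.exp x
  set b := Real.exp (-B)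
  set c := Real.exp B
  have h3 : b * y ≤ 1 := by nlinarith
  have h4 : b ≤ 1 := by nlinarith
  nlinarith [mul_le_mul_of_nonneg_right h3 (hp.le.trans h1)]

/-- The softplus function is strongly convex on `[-B, B]`, with a constant of the order
`exp (-B)`; this is the case of a point to the right of the base point. -/
theorem softplus_strong_right {B a v : ℝ} (ha : -B ≤ a) (hav : a ≤ v) (hv : v ≤ B) :
    Real.log (1 + Real.exp a) + Real.exp a / (1 + Real.exp a) * (v - a)
      + Real.exp (-B) / 8 * (v - a) ^ 2 ≤ Real.log (1 + Real.exp v) := by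
  set κ := Real.exp (-B) / 4
  have hF : MonotoneOn (fun x => Real.exp x / (1 + Real.exp x) - κ * x) (Set.Icc (-B) B) := by
    have hd : ∀ x, HasDerivAt (fun x => Real.exp x / (1 + Real.exp x) - κ * x)
        (Real.exp x / (1 + Real.exp x) ^ 2 - κ) x := fun x => by
      convert! (hasDerivAt_exp_div_one_add_exp x).sub ((hasDerivAt_id x).const_mul κ) using 1
      simp
    refine monotoneOn_of_deriv_nonneg (convex_Icc _ _)
      (fun x _ => (hd x).continuousAt.continuousWithinAt)
      (fun x _ => (hd x).differentiableAt.differentiableWithinAt) fun x hx => ?_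
    rw [(hd x).deriv]
    rw [interior_Icc] at hx
    exact sub_nonneg.2 (exp_div_sq_lower (abs_le.2 ⟨hx.1.le, hx.2.le⟩))
  have hG : MonotoneOn (fun x => Real.log (1 + Real.exp x) -
      Real.exp a / (1 + Real.exp a) * (x - a) - κ / 2 * (x - a) ^ 2) (Set.Icc a B) := by
    have hd : ∀ x, HasDerivAt (fun x => Real.log (1 + Real.exp x) -
        Real.exp a / (1 + Real.exp a) * (x - a) - κ / 2 * (x - a) ^ 2)
        (Real.exp x / (1 + Real.exp x) - Real.exp a / (1 + Real.exp a) - κ * (x - a)) x :=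
      fun x => by
      have h1 := (hasDerivAt_id x).sub_const a
      have h2 := ((hasDerivAt_log_one_add_exp x).sub
        (h1.const_mul (Real.exp a / (1 + Real.exp a)))).sub ((h1.pow 2).const_mul (κ / 2))
      convert! h2 using 1
      simp; ring
    refine monotoneOn_of_deriv_nonneg (convex_Icc _ _)
      (fun x _ => (hd x).continuousAt.continuousWithinAt)
      (fun x _ => (hd x).differentiableAt.differentiableWithinAt) fun x hx => ?_
    rw [(hd x).deriv]
    rw [interior_Icc] at hx
    have := hF ⟨ha, hav.trans hv⟩ ⟨ha.trans hx.1.le, hx.2.le⟩ hx.1.le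
    simp only at this
    linarith
  have := hG ⟨le_rfl, hav.trans hv⟩ ⟨hav, hv⟩ hav
  simp only [sub_self, mul_zero] at this
  have hk : κ / 2 = Real.exp (-B) / 8 := by ring
  rw [hk] at this
  nlinarith

/-- The total logistic loss of the log-odds value `v` on `a` positive and `b` negative examples. -/
noncomputable def pairLoss (a b v : ℝ) : ℝ :=
  a * Real.log (1 + Real.exp (-v)) + b * Real.log (1 + Real.exp v)

theorem pairLoss_neg (a b v : ℝ) : pairLoss b a (-v) = pairLoss a b v := by
  simp [pairLoss, add_comm]

/-- To the right of the log-odds, the logistic loss is increasing and strongly convex. -/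
theorem pairLoss_gap_right {a b B u v : ℝ} (ha : 0 < a) (hb : 0 < b) (hu : -B ≤ u) (huv : u ≤ v)
    (hv : v ≤ B) (hL : Real.log (a / b) ≤ u) :
    pairLoss a b u + (a + b) * (Real.exp (-B) / 8 * (v - u) ^ 2) ≤ pairLoss a b v := by
  have h := softplus_strong_right hu huv hv
  have hexp : a / b ≤ Real.exp u := by
    rw [← Real.exp_log (div_pos ha hb)]; exact Real.exp_le_exp.2 hL
  have hs : a ≤ (a + b) * (Real.exp u / (1 + Real.exp u)) := by
    rw [mul_div_assoc', le_div_iff₀ (by positivity)]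
    rw [div_le_iff₀ hb] at hexp
    nlinarith
  simp only [pairLoss, log_one_add_exp_neg]
  have h1 := mul_le_mul_of_nonneg_left h (add_pos ha hb).le
  have h2 := mul_le_mul_of_nonneg_right hs (sub_nonneg.2 huv)
  nlinarith

theorem pairLoss_gap_left {a b B u v : ℝ} (ha : 0 < a) (hb : 0 < b) (hu : u ≤ B) (huv : v ≤ u)
    (hv : -B ≤ v) (hL : u ≤ Real.log (a / b)) :
    pairLoss a b u + (a + b) * (Real.exp (-B) / 8 * (v - u) ^ 2) ≤ pairLoss a b v := by
  have hL' : Real.log (b / a) ≤ -u := by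
    rw [← inv_div, Real.log_inv]; linarith
  have := pairLoss_gap_right (B := B) (u := -u) (v := -v) hb ha (by linarith) (by linarith)
    (by linarith) hL'
  rw [pairLoss_neg, pairLoss_neg] at this
  convert! this using 1
  ring

section Grid

variable {α η : ℝ}

theorem gridStep_pos (hα : 0 < α) : 0 < gridStep α := by
  unfold gridStep; positivity

/-- The half-width of the grid. -/
noncomputable def gridBound (α η : ℝ) : ℝ := gridSize α η * gridStep α / 2

theorem gridValue_eq (j : ℕ) : gridValue α η j = j * gridStep α - gridBound α η := rfl

theorem log_le_gridBound (hα : 0 < α) : Real.log (η⁻¹ - 1) ≤ gridBound α η := by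
  have h := Nat.le_ceil (8 * Real.log (η⁻¹ - 1) / min 1 α)
  have hm : 0 < min 1 α := by positivity
  rw [div_le_iff₀ hm] at h
  unfold gridBound gridStep gridSize
  linarith

theorem log_odds_nonneg (hη : 0 < η) (hη2 : η ≤ 1 / 2) : 0 ≤ Real.log (η⁻¹ - 1) := by
  apply Real.log_nonneg
  have : (2 : ℝ) ≤ η⁻¹ := by rw [le_inv_comm₀ (by norm_num) hη]; linarith
  linarith

theorem gridBound_le (hα : 0 < α) (hη : 0 < η) (hη2 : η ≤ 1 / 2) :
    gridBound α η ≤ Real.log (η⁻¹ - 1) + 1 / 8 := by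
  have hm : 0 < min 1 α := by positivity
  have h := Nat.ceil_lt_add_one (a := 8 * Real.log (η⁻¹ - 1) / min 1 α)
    (div_nonneg (by linarith [log_odds_nonneg hη hη2]) hm.le)
  have h' := mul_lt_mul_of_pos_right h hm
  rw [add_mul, div_mul_cancel₀ _ hm.ne'] at h'
  have := min_le_left 1 α
  unfold gridBound gridStep gridSize
  linarith

theorem gridBound_nonneg (hα : 0 < α) : 0 ≤ gridBound α η := by
  have := gridStep_pos hα
  unfold gridBound; positivity

theorem exp_neg_gridBound (hα : 0 < α) (hη : 0 < η) (hη2 : η ≤ 1 / 2) :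
    η / 2 ≤ Real.exp (-gridBound α η) := by
  have h1 : Real.exp (-(Real.log (η⁻¹ - 1) + 1 / 8)) ≤ Real.exp (-gridBound α η) :=
    Real.exp_le_exp.2 (neg_le_neg (gridBound_le hα hη hη2))
  refine le_trans ?_ h1
  have h3 : (2 : ℝ) ≤ η⁻¹ := by rw [le_inv_comm₀ (by norm_num) hη]; linarith
  rw [neg_add, Real.exp_add, Real.exp_neg, Real.exp_log (by linarith)]
  have h2 := Real.add_one_le_exp (-(1 / 8) : ℝ)
  have h4 : η ≤ (η⁻¹ - 1)⁻¹ := by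
    rw [le_inv_comm₀ hη (by linarith)]; linarith
  nlinarith

theorem abs_gridValue_le (hα : 0 < α) {j : ℕ} (hj : j ≤ gridSize α η) :
    |gridValue α η j| ≤ gridBound α η := by
  have h := gridStep_pos hα
  have h1 : (j : ℝ) * gridStep α ≤ gridSize α η * gridStep α := by gcongr
  have h2 : (0 : ℝ) ≤ j * gridStep α := by positivity
  rw [gridValue_eq, abs_le]
  unfold gridBound
  constructor <;> linarith

/-- The index of the last grid point that is at most the log-odds of `a` positive and `b` negative
examples. If the log-odds are the last point of the grid, then the next index is off the grid. -/
noncomputable def gridIndex (α η a b : ℝ) : ℕ :=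
  ⌊(Real.log (a / b) + gridBound α η) / gridStep α⌋₊

theorem gridIndex_le (hα : 0 < α) {a b : ℝ} (h : Real.log (a / b) ≤ gridBound α η) :
    gridIndex α η a b ≤ gridSize α η := by
  have hs := gridStep_pos hα
  refine Nat.floor_le_of_le ?_
  rw [div_le_iff₀ hs]
  have : (gridSize α η : ℝ) * gridStep α = 2 * gridBound α η := by unfold gridBound; ring
  linarith

theorem gridValue_gridIndex_le (hα : 0 < α) {a b : ℝ} (h : -gridBound α η ≤ Real.log (a / b)) :
    gridValue α η (gridIndex α η a b) ≤ Real.log (a / b) := by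
  have hs := gridStep_pos hα
  have := Nat.floor_le (a := (Real.log (a / b) + gridBound α η) / gridStep α)
    (div_nonneg (by linarith) hs.le)
  rw [le_div_iff₀ hs] at this
  rw [gridValue_eq, gridIndex]
  linarith

theorem le_gridValue_gridIndex_succ (hα : 0 < α) {a b : ℝ} :
    Real.log (a / b) ≤ gridValue α η (gridIndex α η a b + 1) := by
  have hs := gridStep_pos hα
  have := Nat.lt_floor_add_one (a := (Real.log (a / b) + gridBound α η) / gridStep α)
  rw [div_lt_iff₀ hs] at this
  rw [gridValue_eq, gridIndex]
  push_cast
  linarith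

/-- Log-odds that differ by `α` lie at least four grid points apart. -/
theorem gridIndex_add_four_le (hα : 0 < α) {a b a' b' : ℝ}
    (h : -gridBound α η ≤ Real.log (a / b))
    (hsep : α + Real.log (a / b) ≤ Real.log (a' / b')) :
    gridIndex α η a b + 4 ≤ gridIndex α η a' b' := by
  have hs := gridStep_pos hα
  unfold gridIndex
  rw [← Nat.floor_add_ofNat (div_nonneg (by linarith) hs.le)]
  refine Nat.floor_le_floor ?_
  rw [div_add' _ _ _ hs.ne']
  refine (div_le_div_iff_of_pos_right hs).2 ?_
  have : gridStep α * 4 = min 1 α := by unfold gridStep; ring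
  have := min_le_right 1 α
  linarith

/-- A lower bound for the amount by which the mean logistic loss at a grid point that is not next to
the log-odds exceeds the optimum over the grid. It is the strong convexity constant `η / 16` of the
loss on the grid times the squared grid spacing. -/
noncomputable def lossGap (α η : ℝ) : ℝ := η * min 1 α ^ 2 / 256

theorem abs_log_odds_le (hη : 0 < η) {a b : ℝ} (ha : 0 < a) (hb : 0 < b)
    (h1 : η ≤ a / (a + b)) (h2 : η ≤ b / (a + b)) :
    |Real.log (a / b)| ≤ Real.log (η⁻¹ - 1) := by
  rw [le_div_iff₀ (by positivity)] at h1 h2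
  have key : ∀ x y : ℝ, 0 < x → 0 < y → η * (x + y) ≤ y →
      Real.log (x / y) ≤ Real.log (η⁻¹ - 1) := by
    intro x y hx hy h
    refine Real.log_le_log (by positivity) ?_
    rw [div_le_iff₀ hy]
    have h3 : η⁻¹ * (η * (x + y)) ≤ η⁻¹ * y := by gcongr
    rw [inv_mul_cancel_left₀ hη.ne'] at h3
    linarith
  rw [abs_le]
  refine ⟨?_, key a b ha hb h2⟩
  have := key b a hb ha (by linarith)
  rw [← inv_div, Real.log_inv] at this
  linarith

/-- The better one, `c`, of the two grid points next to the log-odds minimises the logistic loss over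
the grid, and the mean loss of every grid point other than these two is larger by at least
`lossGap`. -/
theorem exists_best_gridIndex (hα : 0 < α) (hη : 0 < η) {a b : ℝ} (ha : 0 < a) (hb : 0 < b)
    (h1 : η ≤ a / (a + b)) (h2 : η ≤ b / (a + b)) :
    ∃ c ≤ gridSize α η, ∀ j ≤ gridSize α η,
      pairLoss a b (gridValue α η c) + (a + b) *
        (if j = gridIndex α η a b ∨ j = gridIndex α η a b + 1 then 0 else lossGap α η)
        ≤ pairLoss a b (gridValue α η j) := by
  have hη2 : η ≤ 1 / 2 := by
    have : a / (a + b) + b / (a + b) = 1 := by field_simp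
    linarith
  have hs := gridStep_pos hα
  have hL := (abs_log_odds_le hη ha hb h1 h2).trans (log_le_gridBound hα)
  obtain ⟨hL1, hL2⟩ := abs_le.1 hL
  set m := gridIndex α η a b
  have hm : m ≤ gridSize α η := gridIndex_le hα hL2
  have hm1 : gridValue α η m ≤ Real.log (a / b) := gridValue_gridIndex_le hα hL1
  have hm2 : Real.log (a / b) ≤ gridValue α η (m + 1) := le_gridValue_gridIndex_succ hα
  have hgap : ∀ {i j : ℕ}, (i : ℝ) + 1 ≤ j ∨ (j : ℝ) + 1 ≤ i → lossGap α η ≤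
      Real.exp (-gridBound α η) / 8 * (gridValue α η j - gridValue α η i) ^ 2 := by
    intro i j hij
    have hsq : gridStep α ^ 2 ≤ (gridValue α η j - gridValue α η i) ^ 2 := by
      have : gridValue α η j - gridValue α η i = ((j : ℝ) - i) * gridStep α := by
        rw [gridValue_eq, gridValue_eq]; ring
      rw [this, mul_pow]
      have h3 : (1 : ℝ) ≤ ((j : ℝ) - i) ^ 2 := by
        rcases hij with h | h <;> nlinarith
      nlinarith [sq_nonneg (gridStep α)]
    have h4 := exp_neg_gridBound hα hη hη2
    calc lossGap α η = η / 2 / 8 * gridStep α ^ 2 := by unfold lossGap gridStep; ring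
      _ ≤ _ := by gcongr
  have hbd : ∀ {j}, j ≤ gridSize α η →
      -gridBound α η ≤ gridValue α η j ∧ gridValue α η j ≤ gridBound α η :=
    fun hj => abs_le.1 (abs_gridValue_le hα hj)
  have hmono : ∀ {i j : ℕ}, i ≤ j → gridValue α η i ≤ gridValue α η j := by
    intro i j hij
    rw [gridValue_eq, gridValue_eq]; gcongr
  have hleft : ∀ j < m, pairLoss a b (gridValue α η m) + (a + b) * lossGap α η
      ≤ pairLoss a b (gridValue α η j) := by
    intro j hj
    have := pairLoss_gap_left ha hb (hbd hm).2 (hmono hj.le) (hbd (hj.le.trans hm)).1 hm1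
    have h3 := hgap (i := m) (j := j) (Or.inr (by exact_mod_cast hj))
    nlinarith
  have hright : ∀ j ≤ gridSize α η, m + 1 < j →
      pairLoss a b (gridValue α η (m + 1)) + (a + b) * lossGap α η
        ≤ pairLoss a b (gridValue α η j) := by
    intro j hj hmj
    have := pairLoss_gap_right ha hb (hbd (hmj.le.trans hj)).1 (hmono hmj.le) (hbd hj).2 hm2
    have h3 := hgap (i := m + 1) (j := j) (Or.inl (by exact_mod_cast hmj))
    nlinarith
  have hcomb : ∃ c ≤ gridSize α η, pairLoss a b (gridValue α η c) ≤ pairLoss a b (gridValue α η m) ∧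
      (m + 1 ≤ gridSize α η →
        pairLoss a b (gridValue α η c) ≤ pairLoss a b (gridValue α η (m + 1))) := by
    by_cases hn : m + 1 ≤ gridSize α η
    · rcases le_total (pairLoss a b (gridValue α η m)) (pairLoss a b (gridValue α η (m + 1)))
        with h | h
      · exact ⟨m, hm, le_rfl, fun _ => h⟩
      · exact ⟨m + 1, hn, h, fun _ => le_rfl⟩
    · exact ⟨m, hm, le_rfl, fun h => absurd h hn⟩
  obtain ⟨c, hc, hc1, hc2⟩ := hcomb
  refine ⟨c, hc, fun j hj => ?_⟩
  split_ifs with hjm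
  · rw [mul_zero, add_zero]
    rcases hjm with rfl | rfl
    · exact hc1
    · exact hc2 hj
  · rcases lt_or_gt_of_ne (fun h => hjm (Or.inl h)) with h | h
    · linarith [hleft j h]
    · have hlt : m + 1 < j := by omega
      linarith [hright j hj hlt, hc2 (hlt.le.trans hj)]

/-- The softplus function is `1`-Lipschitz. -/
theorem abs_softplus_sub_le (u v : ℝ) :
    |Real.log (1 + Real.exp u) - Real.log (1 + Real.exp v)| ≤ |u - v| := by
  have key : ∀ x y : ℝ, x ≤ y → Real.log (1 + Real.exp y) - Real.log (1 + Real.exp x) ≤ y - x := by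
    intro x y hxy
    have h1 : Real.log (1 + Real.exp y) ≤ Real.log (Real.exp (y - x) * (1 + Real.exp x)) := by
      refine Real.log_le_log (by positivity) ?_
      rw [mul_add, ← Real.exp_add, sub_add_cancel]
      linarith [Real.one_le_exp (sub_nonneg.2 hxy)]
    rw [Real.log_mul (by positivity) (by positivity), Real.log_exp] at h1
    linarith
  have mono : ∀ x y : ℝ, x ≤ y → Real.log (1 + Real.exp x) ≤ Real.log (1 + Real.exp y) :=
    fun x y hxy => Real.log_le_log (by positivity) (by gcongr)
  rcases le_total u v with h | h
  · rw [abs_of_nonpos (by linarith [mono u v h]), abs_of_nonpos (by linarith)]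
    linarith [key u v h]
  · rw [abs_of_nonneg (by linarith [mono v u h]), abs_of_nonneg (by linarith)]
    linarith [key v u h]

end Grid

/-! ### Means over slightly contaminated sets -/

section Contamination

variable {I : Type*} [DecidableEq I] {C J B : Finset I} {w : I → ℝ}

theorem card_le_add_card (h : ∀ i ∉ B, i ∈ C → i ∈ J) : (C.card : ℝ) ≤ J.card + B.card := by
  have h1 : C ⊆ J ∪ B := fun i hi => by
    by_cases hB : i ∈ B
    · exact Finset.mem_union_right _ hB
    · exact Finset.mem_union_left _ (h i hB hi)
  exact_mod_cast (Finset.card_le_card h1).trans (Finset.card_union_le J B)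

theorem sum_le_add_card (h : ∀ i ∉ B, i ∈ J → i ∈ C) (h0 : ∀ i, 0 ≤ w i) (h1 : ∀ i, w i ≤ 1) :
    ∑ i ∈ J, w i ≤ ∑ i ∈ C, w i + B.card := by
  have hs : J ⊆ C ∪ B := fun i hi => by
    by_cases hB : i ∈ B
    · exact Finset.mem_union_right _ hB
    · exact Finset.mem_union_left _ (h i hB hi)
  calc ∑ i ∈ J, w i ≤ ∑ i ∈ C ∪ B, w i :=
        Finset.sum_le_sum_of_subset_of_nonneg hs fun i _ _ => h0 i
    _ ≤ ∑ i ∈ C, w i + ∑ i ∈ B, w i := by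
        rw [← Finset.sum_union_inter]
        exact le_add_of_nonneg_right (Finset.sum_nonneg fun i _ => h0 i)
    _ ≤ ∑ i ∈ C, w i + B.card := by
        gcongr
        calc ∑ i ∈ B, w i ≤ ∑ _i ∈ B, (1 : ℝ) := Finset.sum_le_sum fun i _ => h1 i
          _ = B.card := by simp

/-- If `C` and `J` agree outside a set `B` of at most `1/64` of the size of `J`, then a lower bound for
the mean of a `[0, 1]`-valued function over `J` nearly holds over `C`. -/
theorem mean_ge_of_contaminated (h : ∀ i ∉ B, (i ∈ C ↔ i ∈ J)) (hJ : 0 < (J.card : ℝ))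
    (hB : 64 * (B.card : ℝ) ≤ J.card) (h0 : ∀ i, 0 ≤ w i) (h1 : ∀ i, w i ≤ 1) {a : ℝ}
    (ha : a * J.card ≤ ∑ i ∈ J, w i) :
    64 / 65 * (a - 1 / 64) ≤ (1 / (C.card : ℝ)) * ∑ i ∈ C, w i := by
  have hC1 := card_le_add_card (C := C) (J := J) (B := B) fun i hi => (h i hi).1
  have hC2 := card_le_add_card (C := J) (J := C) (B := B) fun i hi => (h i hi).2
  have hS := sum_le_add_card (w := w) (J := J) (C := C) (B := B) (fun i hi => (h i hi).2) h0 h1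
  have hS0 : 0 ≤ ∑ i ∈ C, w i := Finset.sum_nonneg fun i _ => h0 i
  have hCpos : (0 : ℝ) < C.card := by linarith
  rw [one_div_mul_eq_div, le_div_iff₀ hCpos]
  rcases le_total a (1 / 64) with h2 | h2
  · nlinarith
  · nlinarith

/-- The mean over `C` of a function that is nonpositive on `J` outside `B` is nearly nonpositive. -/
theorem mean_le_of_contaminated (h : ∀ i ∉ B, (i ∈ C ↔ i ∈ J)) (hJ : 0 < (J.card : ℝ))
    (hB : 64 * (B.card : ℝ) ≤ J.card) (h1 : ∀ i, w i ≤ 1) (hw : ∀ i ∉ B, i ∈ J → w i ≤ 0) :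
    (1 / (C.card : ℝ)) * ∑ i ∈ C, w i ≤ 1 / 63 := by
  have hC2 := card_le_add_card (C := J) (J := C) (B := B) fun i hi => (h i hi).2
  have hCpos : (0 : ℝ) < C.card := by linarith
  have hS : ∑ i ∈ C, w i ≤ B.card := by
    calc ∑ i ∈ C, w i ≤ ∑ i ∈ C, if i ∈ B then (1 : ℝ) else 0 := by
          refine Finset.sum_le_sum fun i hi => ?_
          split_ifs with hb
          · exact h1 i
          · exact hw i hb ((h i hb).1 hi)
      _ = ((C.filter (· ∈ B)).card : ℝ) := by
          rw [← Finset.sum_filter, Finset.sum_const, nsmul_eq_mul, mul_one]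
      _ ≤ B.card := by
          exact_mod_cast Finset.card_le_card fun i hi => (Finset.mem_filter.1 hi).2
  rw [one_div_mul_eq_div, div_le_iff₀ hCpos]
  linarith

end Contamination

/-! ### One time step of the algorithm -/

section Step

section Index

variable {N : ℕ} {X : Fin (N + 1) → Type*} {nA nB : ℕ}

/-- The grid index that the predictor `f` assigns to the observations of the episode `i`. -/
def episodeIndex {Ns n : ℕ} (τ : Fin nA ⊕ Fin nB → ∀ h, X h) (h : Fin N)
    (f : Predictor Ns n (X h.castSucc) (X h.succ)) (i : Fin nA ⊕ Fin nB) : ℕ :=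
  f.index (τ i h.castSucc) (τ i h.succ)

theorem episodeIndex_le {Ns n : ℕ} (τ : Fin nA ⊕ Fin nB → ∀ h, X h) (h : Fin N)
    (f : Predictor Ns n (X h.castSucc) (X h.succ)) (i : Fin nA ⊕ Fin nB) :
    episodeIndex τ h f i ≤ n :=
  Nat.lt_succ_iff.1 (f.table _ _).2

end Index

variable {N : ℕ} {A : Type*} {S E X : Fin (N + 1) → Type*}
  [∀ h, MeasurableSpace (E h)] [∀ h, MeasurableSpace (X h)] {nA nB : ℕ}

open Classical in
/-- The episodes of both agents with latent pair `(s, s')` at times `(h, h + 1)`. -/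
noncomputable def pairEpisodes (M : ExBMDP N A S E X) (τ : Fin nA ⊕ Fin nB → ∀ h, X h) (h : Fin N)
    (s : S h.castSucc) (s' : S h.succ) : Finset (Fin nA ⊕ Fin nB) :=
  Finset.univ.filter fun i => M.enc h.castSucc (τ i h.castSucc) = s ∧
    M.enc h.succ (τ i h.succ) = s'

open Classical in
/-- The episodes of both agents with latent state `s` at time `h`. -/
noncomputable def stateEpisodes (M : ExBMDP N A S E X) (τ : Fin nA ⊕ Fin nB → ∀ h, X h)
    (h : Fin (N + 1)) (s : S h) : Finset (Fin nA ⊕ Fin nB) :=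
  Finset.univ.filter fun i => M.enc h (τ i h) = s

theorem card_pairEpisodes (M : ExBMDP N A S E X) (τ : Fin nA ⊕ Fin nB → ∀ h, X h) (h : Fin N)
    (s : S h.castSucc) (s' : S h.succ) : (pairEpisodes M τ h s s').card = countPair M τ h s s' := by
  rw [pairEpisodes, countPair, countA, countB, Finset.card_filter, Finset.card_filter,
    Finset.card_filter, Fintype.sum_sum_type]

/-- The lower one of the two grid indices next to the log-odds of agent `A` against agent `B` on the
episodes with the latent pair `(s, s')`. -/
noncomputable def transIndex (α η : ℝ) (M : ExBMDP N A S E X) (τ : Fin nA ⊕ Fin nB → ∀ h, X h)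
    (h : Fin N) (s : S h.castSucc) (s' : S h.succ) : ℕ :=
  gridIndex α η (countA M τ h s s') (countB M τ h s s')

open Classical in
/-- The episodes on which the value of the predictor `f` is not next to the log-odds of their latent
pair. -/
noncomputable def deviants (α η : ℝ) (M : ExBMDP N A S E X) {Ns n : ℕ}
    (τ : Fin nA ⊕ Fin nB → ∀ h, X h) (h : Fin N)
    (f : Predictor Ns n (X h.castSucc) (X h.succ)) : Finset (Fin nA ⊕ Fin nB) :=
  Finset.univ.filter fun i =>
    ¬ (episodeIndex τ h f i = transIndex α η M τ h (M.enc h.castSucc (τ i h.castSucc))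
        (M.enc h.succ (τ i h.succ)) ∨
      episodeIndex τ h f i = transIndex α η M τ h (M.enc h.castSucc (τ i h.castSucc))
        (M.enc h.succ (τ i h.succ)) + 1)

/-- The dynamics are respected by the latent states of all episodes. -/
def AllFeasible (M : ExBMDP N A S E X) (τ : Fin nA ⊕ Fin nB → ∀ h, X h) : Prop :=
  ∀ i (h : Fin N), M.CanTransition h (M.enc h.castSucc (τ i h.castSucc)) (M.enc h.succ (τ i h.succ))

variable {M : ExBMDP N A S E X} {τ : Fin nA ⊕ Fin nB → ∀ h, X h} {α η ν : ℝ}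

theorem countA_pos (hν : 0 < ν) (hη : 0 < η) (hn : 0 < (nA : ℝ) + nB) (hcov : PairCoverage M τ ν)
    (hshare : AgentShare M τ η) {h : Fin N} {s : S h.castSucc} {t : S h.succ}
    (ht : M.CanTransition h s t) :
    0 < (countA M τ h s t : ℝ) ∧ 0 < (countB M τ h s t : ℝ) := by
  have h1 := hcov h s t ht
  rw [le_div_iff₀ hn] at h1
  have hp : 0 < (countPair M τ h s t : ℝ) := lt_of_lt_of_le (by positivity) h1
  obtain ⟨h2, h3⟩ := hshare h s t ht
  rw [le_div_iff₀ hp] at h2 h3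
  exact ⟨lt_of_lt_of_le (by positivity) h2, lt_of_lt_of_le (by positivity) h3⟩

theorem countPair_cast (h : Fin N) (s : S h.castSucc) (t : S h.succ) :
    (countPair M τ h s t : ℝ) = countA M τ h s t + countB M τ h s t := by
  simp [countPair]

theorem transIndex_bounds (hν : 0 < ν) (hη : 0 < η) (hα : 0 < α) (hn : 0 < (nA : ℝ) + nB)
    (hcov : PairCoverage M τ ν) (hshare : AgentShare M τ η) {h : Fin N} {s : S h.castSucc}
    {t : S h.succ} (ht : M.CanTransition h s t) :
    |Real.log ((countA M τ h s t : ℝ) / countB M τ h s t)| ≤ gridBound α η := by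
  obtain ⟨hA, hB⟩ := countA_pos hν hη hn hcov hshare ht
  obtain ⟨h2, h3⟩ := hshare h s t ht
  rw [countPair_cast] at h2 h3
  exact (abs_log_odds_le hη hA hB h2 h3).trans (log_le_gridBound hα)

variable [∀ h, Fintype (S h)]

/-- Policy separation moves the positions of distinct successors at least four grid steps apart. -/
theorem transIndex_separated (hν : 0 < ν) (hη : 0 < η) (hα : 0 < α) (hn : 0 < (nA : ℝ) + nB)
    (hcov : PairCoverage M τ ν) (hsep : PolicySeparation M τ α) (hshare : AgentShare M τ η)
    {h : Fin N} {s : S h.castSucc} {t t' : S h.succ} (ht : M.CanTransition h s t)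
    (ht' : M.CanTransition h s t') (hne : t ≠ t') :
    transIndex α η M τ h s t + 4 ≤ transIndex α η M τ h s t' ∨
      transIndex α η M τ h s t' + 4 ≤ transIndex α η M τ h s t := by
  obtain ⟨a1, b1⟩ := countA_pos hν hη hn hcov hshare ht
  obtain ⟨a2, b2⟩ := countA_pos hν hη hn hcov hshare ht'
  have hratio : ∀ c : S h.succ → ℝ, 0 < c t → 0 < c t' → (∀ u, 0 ≤ c u) →
      (c t' / ∑ u, c u) / (c t / ∑ u, c u) = c t' / c t := by
    intro c h1 _ h3
    have : 0 < ∑ u, c u :=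
      lt_of_lt_of_le h1 (Finset.single_le_sum (fun u _ => h3 u) (Finset.mem_univ t))
    field_simp
  have hA := hratio (fun u => (countA M τ h s u : ℝ)) a1 a2 fun u => Nat.cast_nonneg _
  have hB := hratio (fun u => (countB M τ h s u : ℝ)) b1 b2 fun u => Nat.cast_nonneg _
  have hs := hsep h s t t' ht ht' hne
  simp only [empA, empB] at hs
  rw [hA, hB] at hs
  have hlog : ∀ x y x' y' : ℝ, 0 < x → 0 < y → 0 < x' → 0 < y' →
      Real.exp α * (y' / y) ≤ x' / x → α + Real.log (x / y) ≤ Real.log (x' / y') := by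
    intro x y x' y' hx hy hx' hy' hle
    have := Real.log_le_log (by positivity) hle
    rw [Real.log_mul (by positivity) (by positivity), Real.log_exp,
      Real.log_div hy'.ne' hy.ne', Real.log_div hx'.ne' hx.ne'] at this
    rw [Real.log_div hx.ne' hy.ne', Real.log_div hx'.ne' hy'.ne']
    linarith
  rcases hs with hs | hs
  · exact Or.inl (gridIndex_add_four_le hα
      (abs_le.1 (transIndex_bounds hν hη hα hn hcov hshare ht)).1 (hlog _ _ _ _ a1 b1 a2 b2 hs))
  · refine Or.inr (gridIndex_add_four_le hα
      (abs_le.1 (transIndex_bounds hν hη hα hn hcov hshare ht')).1 ?_)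
    have := hlog _ _ _ _ b1 a1 b2 a2 hs
    rw [Real.log_div b1.ne' a1.ne', Real.log_div b2.ne' a2.ne'] at this
    rw [Real.log_div a1.ne' b1.ne', Real.log_div a2.ne' b2.ne']
    linarith

/-- Outside a small set `B` of exceptional episodes, the clusters of an inferred state are the sets of
episodes with a common successor, one for each possible successor. The threshold `q` exceeds the
fraction of exceptional episodes, so that they alone do not make an index big; and the episodes of
one latent pair, spread over two indices, make at least one of these big. -/
theorem exists_clusters_eq_map {Ns : ℕ} (hν : 0 < ν) (hη : 0 < η) (hα : 0 < α)
    (hn : 0 < (nA : ℝ) + nB) (hcov : PairCoverage M τ ν) (hsep : PolicySeparation M τ α)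
    (hshare : AgentShare M τ η) (hfeas : AllFeasible M τ) {h : Fin N} {s : S h.castSucc}
    {f : Predictor Ns (gridSize α η) (X h.castSucc) (X h.succ)}
    {D B : Finset (Fin nA ⊕ Fin nB)} {q : ℝ} (hdev : deviants α η M τ h f ⊆ B)
    (hD : ∀ i ∉ B, (i ∈ D ↔ M.enc h.castSucc (τ i h.castSucc) = s))
    (hB : (B.card : ℝ) < q * ((nA : ℝ) + nB))
    (hB' : 2 * (q * ((nA : ℝ) + nB)) + B.card ≤ ν * ((nA : ℝ) + nB)) :
    ∃ (ts : List (S h.succ)) (C : S h.succ → Finset (Fin nA ⊕ Fin nB)), ts.Nodup ∧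
      (∀ t, t ∈ ts ↔ M.CanTransition h s t) ∧ clusters q τ h f D = ts.map C ∧
      (∀ t, M.CanTransition h s t → ∀ i ∉ B, (i ∈ C t ↔ i ∈ pairEpisodes M τ h s t)) ∧
      (∀ t, C t ⊆ D) ∧ ∀ t t' i, i ∈ C t → i ∈ C t' → t = t' := by
  classical
  let T := {t : S h.succ // M.CanTransition h s t}
  let m : T → ℕ := fun t => transIndex α η M τ h s t.1
  have hmn : ∀ t, m t ≤ gridSize α η := fun t =>
    gridIndex_le hα (abs_le.1 (transIndex_bounds hν hη hα hn hcov hshare t.2)).2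
  have hidx : ∀ i ∉ B, ∀ t, i ∈ pairEpisodes M τ h s t →
      episodeIndex τ h f i = transIndex α η M τ h s t ∨
        episodeIndex τ h f i = transIndex α η M τ h s t + 1 := by
    intro i hi t hit
    by_contra hcon
    refine hi (hdev ?_)
    simp only [deviants, pairEpisodes, Finset.mem_filter, Finset.mem_univ, true_and] at hit ⊢
    rwa [hit.1, hit.2]
  let big : ℕ → Prop := fun j => q * ((nA : ℝ) + nB) ≤
    ((D.filter fun i => f.index (τ i h.castSucc) (τ i h.succ) = j).card : ℝ)
  have hsmall : ∀ k, k ≤ gridSize α η → big k → ∃ t, k = m t ∨ k = m t + 1 := by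
    intro k _ hk
    have hlt : B.card < (D.filter fun i => f.index (τ i h.castSucc) (τ i h.succ) = k).card := by
      exact_mod_cast hB.trans_le hk
    obtain ⟨i, hi, hiB⟩ := Finset.exists_mem_notMem_of_card_lt_card hlt
    rw [Finset.mem_filter] at hi
    have hs := (hD i hiB).1 hi.1
    have hf := hfeas i h
    rw [hs] at hf
    refine ⟨⟨_, hf⟩, ?_⟩
    have := hidx i hiB (M.enc h.succ (τ i h.succ)) (by simp [pairEpisodes, hs])
    rwa [show episodeIndex τ h f i = k from hi.2] at this
  have hbig : ∀ t, big (m t) ∨ m t + 1 ≤ gridSize α η ∧ big (m t + 1) := by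
    intro t
    by_contra hcon
    push Not at hcon
    obtain ⟨h1, h2⟩ := hcon
    have h1' : ((D.filter fun i => f.index (τ i h.castSucc) (τ i h.succ) = m t).card : ℝ)
      < q * ((nA : ℝ) + nB) := not_le.1 h1
    have h2' : ((D.filter fun i => f.index (τ i h.castSucc) (τ i h.succ) = m t + 1).card : ℝ)
      < q * ((nA : ℝ) + nB) := by
      by_cases hle : m t + 1 ≤ gridSize α η
      · exact not_le.1 (h2 hle)
      · rw [Finset.filter_eq_empty_iff.2]
        · simpa using (Nat.cast_nonneg (B.card)).trans_lt hB
        · intro i _ hi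
          exact hle (hi ▸ episodeIndex_le τ h f i)
    have hsub : pairEpisodes M τ h s t.1 ⊆
        ((D.filter fun i => f.index (τ i h.castSucc) (τ i h.succ) = m t) ∪
          D.filter fun i => f.index (τ i h.castSucc) (τ i h.succ) = m t + 1) ∪ B := by
      intro i hi
      by_cases hiB : i ∈ B
      · exact Finset.mem_union_right _ hiB
      · have hiD : i ∈ D := (hD i hiB).2 (by
          simp only [pairEpisodes, Finset.mem_filter] at hi; exact hi.2.1)
        rcases hidx i hiB t.1 hi with h3 | h3
        · exact Finset.mem_union_left _ (Finset.mem_union_left _ (Finset.mem_filter.2 ⟨hiD, h3⟩))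
        · exact Finset.mem_union_left _ (Finset.mem_union_right _ (Finset.mem_filter.2 ⟨hiD, h3⟩))
    have hc := (Finset.card_le_card hsub).trans ((Finset.card_union_le _ _).trans
      (Nat.add_le_add_right (Finset.card_union_le _ _) _))
    have hc' := (Nat.cast_le (α := ℝ)).2 hc
    push_cast at hc'
    have hcv := hcov h s t.1 t.2
    rw [le_div_iff₀ hn, ← card_pairEpisodes] at hcv
    linarith
  obtain ⟨ts, blk, hnd, hall, hscan, hblk, hdisj⟩ := exists_scan_eq_map hmn
    (fun t t' hne => transIndex_separated hν hη hα hn hcov hsep hshare t.2 t'.2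
      fun h => hne (Subtype.ext h)) hsmall hbig
  let C : S h.succ → Finset (Fin nA ⊕ Fin nB) := fun t =>
    if ht : M.CanTransition h s t then
      D.filter fun i => (blk ⟨t, ht⟩).1 - 1 ≤ f.index (τ i h.castSucc) (τ i h.succ) ∧
        f.index (τ i h.castSucc) (τ i h.succ) ≤ (blk ⟨t, ht⟩).2
    else ∅
  have hC : ∀ t (ht : M.CanTransition h s t) i, i ∈ C t ↔ i ∈ D ∧
      (blk ⟨t, ht⟩).1 - 1 ≤ episodeIndex τ h f i ∧ episodeIndex τ h f i ≤ (blk ⟨t, ht⟩).2 := by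
    intro t ht i
    simp only [C, dif_pos ht, Finset.mem_filter]
    exact Iff.rfl
  have hCt : ∀ t i, i ∈ C t → M.CanTransition h s t := by
    intro t i hi
    by_contra hcon
    simp [C, hcon] at hi
  refine ⟨ts.map Subtype.val, C, hnd.map Subtype.val_injective, fun t => ?_, ?_, ?_, ?_, ?_⟩
  · simp only [List.mem_map, Subtype.exists, exists_and_right, exists_eq_right]
    exact ⟨fun ⟨ht, _⟩ => ht, fun ht => ⟨ht, hall _⟩⟩
  · unfold clusters
    rw [hscan, List.map_map, List.map_map]
    refine List.map_congr_left fun t _ => ?_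
    simp only [Function.comp, C, dif_pos t.2]
    ext i
    simp only [Finset.mem_filter]
    exact Iff.rfl
  · intro t ht i hiB
    rw [hC t ht]
    constructor
    · rintro ⟨hiD, h1, h2⟩
      have hs := (hD i hiB).1 hiD
      have hf := hfeas i h
      rw [hs] at hf
      have hp : i ∈ pairEpisodes M τ h s (M.enc h.succ (τ i h.succ)) := by simp [pairEpisodes, hs]
      by_cases heq : M.enc h.succ (τ i h.succ) = t
      · rwa [heq] at hp
      · exfalso
        have h3 := hidx i hiB _ hp
        have h4 := hblk ⟨_, hf⟩
        have h5 := hdisj ⟨_, hf⟩ ⟨t, ht⟩ fun h => heq (congrArg Subtype.val h)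
        have h6 := episodeIndex_le τ h f i
        simp only [m] at h4
        omega
    · intro hp
      have h3 := hidx i hiB t hp
      have h4 := hblk ⟨t, ht⟩
      have h6 := episodeIndex_le τ h f i
      simp only [m] at h4
      refine ⟨(hD i hiB).2 (by simp only [pairEpisodes, Finset.mem_filter] at hp; exact hp.2.1), ?_⟩
      omega
  · intro t i hi
    exact ((hC t (hCt t i hi) i).1 hi).1
  · intro t t' i hi hi'
    by_contra hne
    have h1 := (hC t (hCt t i hi) i).1 hi
    have h2 := (hC t' (hCt t' i hi') i).1 hi'
    have h5 := hdisj ⟨t, hCt t i hi⟩ ⟨t', hCt t' i hi'⟩ fun h => hne (congrArg Subtype.val h)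
    omega

end Step

/-! ### The classifier test and the inductive step -/

section Merging

variable {N : ℕ} {A : Type*} {S E X : Fin (N + 1) → Type*}
  [∀ h, MeasurableSpace (E h)] [∀ h, MeasurableSpace (X h)] {nA nB : ℕ}

/-- The empirical frequencies of every classifier on the sets of episodes with a common latent pair
`(s, s')` are within `1/16` of a number that does not depend on `s`. -/
def ClassifierMeans (M : ExBMDP N A S E X) (G : ∀ h, Finset (X h → Bool))
    (τ : Fin nA ⊕ Fin nB → ∀ h, X h) : Prop :=
  ∀ (h : Fin N) (s' : S h.succ), ∀ g ∈ G h.succ, ∃ p : ℝ, ∀ s, M.CanTransition h s s' →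
    |∑ i ∈ pairEpisodes M τ h s s', (if g (τ i h.succ) then (1 : ℝ) else 0) -
      p * (pairEpisodes M τ h s s').card| ≤ (pairEpisodes M τ h s s').card / 16

/-- The classifiers separate the latent states on the data. -/
def SeparatedData (M : ExBMDP N A S E X) (G : ∀ h, Finset (X h → Bool))
    (τ : Fin nA ⊕ Fin nB → ∀ h, X h) : Prop :=
  ∀ (h : Fin (N + 1)) (s s' : S h), s ≠ s' → ∃ g ∈ G h, ∀ i,
    (M.enc h (τ i h) = s → g (τ i h) = true) ∧ (M.enc h (τ i h) = s' → g (τ i h) = false)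

variable {M : ExBMDP N A S E X} {τ : Fin nA ⊕ Fin nB → ∀ h, X h}
  {G : ∀ h, Finset (X h → Bool)}

open Classical in
/-- The episodes with latent state `s'` at time `h + 1` and a latent state in `P` at time `h`. -/
noncomputable def predEpisodes (M : ExBMDP N A S E X) (τ : Fin nA ⊕ Fin nB → ∀ h, X h) (h : Fin N)
    (P : List (S h.castSucc)) (s' : S h.succ) : Finset (Fin nA ⊕ Fin nB) :=
  Finset.univ.filter fun i => M.enc h.castSucc (τ i h.castSucc) ∈ P ∧
    M.enc h.succ (τ i h.succ) = s'

theorem pairEpisodes_subset_predEpisodes {h : Fin N} {P : List (S h.castSucc)} {s : S h.castSucc}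
    (hs : s ∈ P) (s' : S h.succ) : pairEpisodes M τ h s s' ⊆ predEpisodes M τ h P s' := by
  intro i hi
  simp only [pairEpisodes, predEpisodes, Finset.mem_filter, Finset.mem_univ, true_and] at hi ⊢
  rw [hi.1]
  exact ⟨hs, hi.2⟩

variable [∀ h, Fintype (S h)]

/-- A bound for the frequency of a classifier that holds on all pairs `(s, s')` carries over to all
episodes with latent state `s'` whose predecessor lies in a given set. -/
theorem abs_sum_predEpisodes_le (hfeas : AllFeasible M τ) {h : Fin N} {s' : S h.succ}
    {w : Fin nA ⊕ Fin nB → ℝ} {p : ℝ}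
    (hp : ∀ s, M.CanTransition h s s' → |∑ i ∈ pairEpisodes M τ h s s', w i -
      p * (pairEpisodes M τ h s s').card| ≤ (pairEpisodes M τ h s s').card / 16)
    (P : List (S h.castSucc)) :
    |∑ i ∈ predEpisodes M τ h P s', w i - p * (predEpisodes M τ h P s').card| ≤
      (predEpisodes M τ h P s').card / 16 := by
  classical
  set J := predEpisodes M τ h P s'
  have h1 : ∀ v : Fin nA ⊕ Fin nB → ℝ, ∑ i ∈ J, v i =
      ∑ s, ∑ i ∈ J.filter (fun i => M.enc h.castSucc (τ i h.castSucc) = s), v i :=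
    fun v => (Finset.sum_fiberwise J _ v).symm
  have h2 : (J.card : ℝ) = ∑ s, ((J.filter fun i =>
      M.enc h.castSucc (τ i h.castSucc) = s).card : ℝ) := by
    have := h1 fun _ => 1
    simpa using this
  rw [h1, h2, Finset.mul_sum, ← Finset.sum_sub_distrib, Finset.sum_div]
  refine (Finset.abs_sum_le_sum_abs _ _).trans (Finset.sum_le_sum fun s _ => ?_)
  by_cases hc : s ∈ P ∧ M.CanTransition h s s'
  · have : J.filter (fun i => M.enc h.castSucc (τ i h.castSucc) = s) = pairEpisodes M τ h s s' := by
      ext i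
      simp only [J, predEpisodes, pairEpisodes, Finset.mem_filter, Finset.mem_univ, true_and]
      constructor
      · rintro ⟨⟨_, h4⟩, h5⟩; exact ⟨h5, h4⟩
      · rintro ⟨h4, h5⟩; exact ⟨⟨h4 ▸ hc.1, h5⟩, h4⟩
    rw [this]
    exact hp s hc.2
  · have : J.filter (fun i => M.enc h.castSucc (τ i h.castSucc) = s) = ∅ := by
      rw [Finset.filter_eq_empty_iff]
      intro i hi his
      simp only [J, predEpisodes, Finset.mem_filter, Finset.mem_univ, true_and] at hi
      have hf := hfeas i h
      rw [his] at hi hf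
      rw [hi.2] at hf
      exact hc ⟨hi.1, hf⟩
    simp [this]

/-- The indistinguishability test compares the latent states correctly, as long as the two sets of
episodes are contaminated only slightly. -/
theorem indistinguishable_iff (hfeas : AllFeasible M τ) (hmeans : ClassifierMeans M G τ)
    (hsepd : SeparatedData M G τ) {h : Fin N} {B C K : Finset (Fin nA ⊕ Fin nB)}
    {s s₀ : S h.castSucc} {P : List (S h.castSucc)} {t l : S h.succ}
    (ht : M.CanTransition h s t) (hs₀ : s₀ ∈ P)
    (hC : ∀ i ∉ B, (i ∈ C ↔ i ∈ pairEpisodes M τ h s t))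
    (hK : ∀ i ∉ B, (i ∈ K ↔ i ∈ predEpisodes M τ h P l))
    (hpos : ∀ s t, M.CanTransition h s t → 0 < ((pairEpisodes M τ h s t).card : ℝ) ∧
      64 * (B.card : ℝ) ≤ (pairEpisodes M τ h s t).card)
    (hl : M.CanTransition h s₀ l) :
    Indistinguishable τ h.succ (G h.succ) C K ↔ l = t := by
  classical
  have hJ := hpos s t ht
  have hJK : 0 < ((predEpisodes M τ h P l).card : ℝ) ∧
      64 * (B.card : ℝ) ≤ (predEpisodes M τ h P l).card := by
    have h1 := hpos s₀ l hl
    have h2 : ((pairEpisodes M τ h s₀ l).card : ℝ) ≤ (predEpisodes M τ h P l).card := by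
      exact_mod_cast Finset.card_le_card (pairEpisodes_subset_predEpisodes hs₀ l)
    exact ⟨h1.1.trans_le h2, h1.2.trans h2⟩
  constructor
  · intro hind
    by_contra hne
    obtain ⟨g, hg, hgs⟩ := hsepd h.succ t l (Ne.symm hne)
    have h1 := mean_le_of_contaminated (w := fun i => if g (τ i h.succ) then (0 : ℝ) else 1)
      hC hJ.1 hJ.2 (fun i => by split_ifs <;> norm_num) (fun i _ hi => by
        simp only [pairEpisodes, Finset.mem_filter] at hi
        simp [(hgs i).1 hi.2.2])
    have h2 := mean_le_of_contaminated (w := fun i => if g (τ i h.succ) then (1 : ℝ) else 0)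
      hK hJK.1 hJK.2 (fun i => by split_ifs <;> norm_num) (fun i _ hi => by
        simp only [predEpisodes, Finset.mem_filter] at hi
        simp [(hgs i).2 hi.2.2])
    have h3 := hind g hg
    unfold classifierLoss at h3
    linarith
  · rintro rfl g hg
    obtain ⟨p, hp⟩ := hmeans h l g hg
    have hpC := abs_le.1 (hp s ht)
    have hpK := abs_le.1 (abs_sum_predEpisodes_le hfeas hp P)
    have hneg : ∑ i ∈ pairEpisodes M τ h s l, (if g (τ i h.succ) then (0 : ℝ) else 1) =
        (pairEpisodes M τ h s l).card -
          ∑ i ∈ pairEpisodes M τ h s l, (if g (τ i h.succ) then (1 : ℝ) else 0) := by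
      rw [eq_sub_iff_add_eq, ← Finset.sum_add_distrib]
      rw [Finset.sum_congr rfl fun i _ => show _ = (1 : ℝ) by split_ifs <;> norm_num]
      simp
    have h1 := mean_ge_of_contaminated (w := fun i => if g (τ i h.succ) then (0 : ℝ) else 1)
      (a := 15 / 16 - p) hC hJ.1 hJ.2 (fun i => by split_ifs <;> norm_num)
      (fun i => by split_ifs <;> norm_num) (by rw [hneg]; linarith [hpC.2])
    have h2 := mean_ge_of_contaminated (w := fun i => if g (τ i h.succ) then (1 : ℝ) else 0)
      (a := p - 1 / 16) hK hJK.1 hJK.2 (fun i => by split_ifs <;> norm_num)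
      (fun i => by split_ifs <;> norm_num) (by linarith [hpK.1])
    unfold classifierLoss
    linarith

/-- The inferred states `St` at time `h` are labelled bijectively by the latent states, and every
episode outside the exceptional set `B` is assigned to exactly the inferred state whose label is its
latent state. -/
structure Tracks (M : ExBMDP N A S E X) (τ : Fin nA ⊕ Fin nB → ∀ h, X h) (h : Fin (N + 1))
    (B : Finset (Fin nA ⊕ Fin nB)) (St : List (Finset (Fin nA ⊕ Fin nB))) (ls : List (S h))
    (K : S h → Finset (Fin nA ⊕ Fin nB)) : Prop where
  nodup : ls.Nodup
  complete : ∀ s, s ∈ ls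
  eq_map : St = ls.map K
  mem_iff : ∀ i ∉ B, ∀ s, i ∈ K s ↔ M.enc h (τ i h) = s
  disjoint : ∀ i s s', i ∈ K s → i ∈ K s' → s = s'

variable {α η ν : ℝ}

/-- One time step of the algorithm: only the episodes on which the predictor deviates become
exceptional. In the course of the step, after the inferred states with labels in `P` have been
treated, the new states are labelled by the possible successors of `P`, and outside `B'` the state
with label `l` consists of the episodes that reach `l` from `P`. -/
theorem Tracks.next {Ns : ℕ} (hν : 0 < ν) (hη : 0 < η) (hα : 0 < α)
    (hn : 0 < (nA : ℝ) + nB) (hcov : PairCoverage M τ ν) (hsep : PolicySeparation M τ α)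
    (hshare : AgentShare M τ η) (hfeas : AllFeasible M τ) (hmeans : ClassifierMeans M G τ)
    (hsepd : SeparatedData M G τ) {h : Fin N} (hreach : ∀ t : S h.succ, ∃ s, M.CanTransition h s t)
    {f : Predictor Ns (gridSize α η) (X h.castSucc) (X h.succ)}
    {B B' : Finset (Fin nA ⊕ Fin nB)} (hBB : B ⊆ B') (hdev : deviants α η M τ h f ⊆ B')
    (hB : (B'.card : ℝ) < ((h : ℝ) + 1) * ν / (8 * ((N : ℝ) + 1)) * ((nA : ℝ) + nB))
    (hB64 : 64 * (B'.card : ℝ) ≤ ν * ((nA : ℝ) + nB))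
    {St : List (Finset (Fin nA ⊕ Fin nB))} {ls : List (S h.castSucc)}
    {K : S h.castSucc → Finset (Fin nA ⊕ Fin nB)} (hSt : Tracks M τ h.castSucc B St ls K) :
    ∃ ls' K', Tracks M τ h.succ B' (nextStates ν G τ h f St) ls' K' := by
  classical
  have hpos : ∀ s t, M.CanTransition h s t → 0 < ((pairEpisodes M τ h s t).card : ℝ) ∧
      64 * (B'.card : ℝ) ≤ (pairEpisodes M τ h s t).card := by
    intro s t hst
    have h1 := hcov h s t hst
    rw [le_div_iff₀ hn, ← card_pairEpisodes] at h1
    exact ⟨lt_of_lt_of_le (by positivity) h1, hB64.trans h1⟩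
  have hB2 : 2 * (((h : ℝ) + 1) * ν / (8 * ((N : ℝ) + 1)) * ((nA : ℝ) + nB)) + B'.card ≤
      ν * ((nA : ℝ) + nB) := by
    have h1 : ((h : ℝ) + 1) * ν / (8 * ((N : ℝ) + 1)) ≤ ν / 8 := by
      rw [div_le_div_iff₀ (by positivity) (by norm_num)]
      have : ((h : ℕ) : ℝ) ≤ N := by exact_mod_cast h.2.le
      nlinarith
    have := mul_le_mul_of_nonneg_right h1 hn.le
    linarith
  have key : ∀ P : List (S h.castSucc), P <+: ls →
      ∃ (ls' : List (S h.succ)) (K' : S h.succ → Finset (Fin nA ⊕ Fin nB)), ls'.Nodup ∧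
        (∀ l, l ∈ ls' ↔ ∃ s ∈ P, M.CanTransition h s l) ∧
        (P.map K).foldl (fun Snext D => placeAll (Indistinguishable τ h.succ (G h.succ)) Snext
          (clusters (((h : ℝ) + 1) * ν / (8 * ((N : ℝ) + 1))) τ h f D)) [] = ls'.map K' ∧
        (∀ l ∈ ls', ∀ i ∉ B', (i ∈ K' l ↔ i ∈ predEpisodes M τ h P l)) ∧
        (∀ l ∈ ls', ∀ i ∈ K' l, ∃ s ∈ P, i ∈ K s) ∧
        ∀ l ∈ ls', ∀ l' ∈ ls', ∀ i, i ∈ K' l → i ∈ K' l' → l = l' := by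
    intro P
    induction P using List.reverseRecOn with
    | nil => intro _; exact ⟨[], fun _ => ∅, by simp⟩
    | append_singleton P s ih =>
      intro hpre
      have hPnd : (P ++ [s]).Nodup := hSt.nodup.sublist hpre.sublist
      have hsP : s ∉ P := fun hs => (List.nodup_append.1 hPnd).2.2 s hs s (by simp) rfl
      obtain ⟨ls', K', hnd, hmem, heq, hK, hsub, hdis⟩ := ih ((List.prefix_append _ _).trans hpre)
      obtain ⟨ts, C, htnd, htmem, hceq, hC, hCsub, hCdis⟩ :=
        exists_clusters_eq_map hν hη hα hn hcov hsep hshare hfeas (s := s) (D := K s) hdev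
          (fun i hi => hSt.mem_iff i (fun hb => hi (hBB hb)) s) hB hB2
      have hsame : ∀ t ∈ ts, ∀ l ∈ ls',
          Indistinguishable τ h.succ (G h.succ) (C t) (K' l) ↔ l = t := by
        intro t ht l hl
        obtain ⟨s₀, hs₀, hsl⟩ := (hmem l).1 hl
        have ht' := (htmem t).1 ht
        exact indistinguishable_iff hfeas hmeans hsepd ht' hs₀ (hC t ht') (hK l hl) hpos hsl
      obtain ⟨K'', hpl, hK''⟩ := exists_placeAll_eq_map hnd htnd hsame
      refine ⟨ls' ++ ts.filter (· ∉ ls'), K'', ?_, ?_, ?_, ?_, ?_, ?_⟩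
      · refine List.nodup_append.2 ⟨hnd, htnd.filter _, ?_⟩
        rintro a ha b hb rfl
        simp [ha] at hb
      · intro l
        simp only [List.mem_append, List.mem_filter, hmem, htmem, List.mem_singleton]
        constructor
        · rintro (⟨s', h1, h2⟩ | ⟨h1, _⟩)
          · exact ⟨s', Or.inl h1, h2⟩
          · exact ⟨s, Or.inr rfl, h1⟩
        · rintro ⟨s', h1 | rfl, h2⟩
          · exact Or.inl ⟨s', h1, h2⟩
          · by_cases h3 : ∃ s ∈ P, M.CanTransition h s l
            · exact Or.inl h3
            · exact Or.inr ⟨h2, by simpa using h3⟩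
      · rw [List.map_append, List.foldl_append, heq]
        simp only [List.map_cons, List.map_nil, List.foldl_cons, List.foldl_nil]
        rw [hceq, hpl]
      · intro l hl i hi
        rw [hK'']
        have hsplit : i ∈ predEpisodes M τ h (P ++ [s]) l ↔
            i ∈ predEpisodes M τ h P l ∨ i ∈ pairEpisodes M τ h s l := by
          simp only [predEpisodes, pairEpisodes, Finset.mem_filter, Finset.mem_univ, true_and,
            List.mem_append, List.mem_singleton]
          tauto
        rw [hsplit]
        have hfe : ∀ s', M.enc h.castSucc (τ i h.castSucc) = s' → M.enc h.succ (τ i h.succ) = l →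
            M.CanTransition h s' l := by
          rintro s' rfl rfl; exact hfeas i h
        constructor
        · rintro (⟨h1, h2⟩ | ⟨h1, h2⟩)
          · exact Or.inl ((hK l h1 i hi).1 h2)
          · exact Or.inr ((hC l ((htmem l).1 h1) i hi).1 h2)
        · rintro (h1 | h1)
          · have h2 := h1
            simp only [predEpisodes, Finset.mem_filter, Finset.mem_univ, true_and] at h2
            have hl' : l ∈ ls' := (hmem l).2 ⟨_, h2.1, hfe _ rfl h2.2⟩
            exact Or.inl ⟨hl', (hK l hl' i hi).2 h1⟩
          · have h2 := h1
            simp only [pairEpisodes, Finset.mem_filter, Finset.mem_univ, true_and] at h2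
            have ht' := hfe _ h2.1 h2.2
            exact Or.inr ⟨(htmem l).2 ht', (hC l ht' i hi).2 h1⟩
      · intro l _ i hi
        rcases (hK'' l i).1 hi with ⟨h1, h2⟩ | ⟨h1, h2⟩
        · obtain ⟨s', hs', hi'⟩ := hsub l h1 i h2
          exact ⟨s', by simp [hs'], hi'⟩
        · exact ⟨s, by simp, hCsub l h2⟩
      · intro l _ l' _ i hi hi'
        have hcross : ∀ a b, a ∈ ls' → i ∈ K' a → i ∈ C b → False := by
          intro a b ha hia hib
          obtain ⟨s', hs', hi'⟩ := hsub a ha i hia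
          exact hsP (hSt.disjoint i s s' (hCsub b hib) hi' ▸ hs')
        rcases (hK'' l i).1 hi with ⟨h1, h2⟩ | ⟨h1, h2⟩ <;>
          rcases (hK'' l' i).1 hi' with ⟨h3, h4⟩ | ⟨h3, h4⟩
        · exact hdis l h1 l' h3 i h2 h4
        · exact (hcross l l' h1 h2 h4).elim
        · exact (hcross l' l h3 h4 h2).elim
        · exact hCdis l l' i h2 h4
  obtain ⟨ls', K', hnd, hmem, heq, hK, -, hdis⟩ := key ls (List.prefix_refl _)
  have hall : ∀ l, l ∈ ls' := fun l => by
    obtain ⟨s, hs⟩ := hreach l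
    exact (hmem l).2 ⟨s, hSt.complete s, hs⟩
  refine ⟨ls', K', hnd, hall, ?_, ?_, fun i s s' => hdis s (hall s) s' (hall s') i⟩
  · rw [nextStates, hSt.eq_map]
    exact heq
  · intro i hi s
    rw [hK s (hall s) i hi]
    simp [predEpisodes, hSt.complete]

end Merging

/-! ### Correctness of every run on typical data -/

section Run

variable {N : ℕ} {A : Type*} {S E X : Fin (N + 1) → Type*}
  [∀ h, MeasurableSpace (E h)] [∀ h, MeasurableSpace (X h)] {nA nB : ℕ}

/-- On every latent state after the first time step, the error rate of each encoder for each label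
exceeds its empirical counterpart by at most `ε / 2`. -/
def EncoderMeans (M : ExBMDP N A S E X) {Ns : ℕ} (Φ : ∀ h, Finset (X h → Fin Ns)) (ε : ℝ)
    (τ : Fin nA ⊕ Fin nB → ∀ h, X h) : Prop :=
  ∀ (h : Fin N), ∀ φ ∈ Φ h.succ, ∀ (s : S h.succ) (k : Fin Ns),
    (M.obsMarginal h.succ s).real {x | φ x ≠ k} * (stateEpisodes M τ h.succ s).card ≤
      ∑ i ∈ stateEpisodes M τ h.succ s, (if φ (τ i h.succ) = k then (0 : ℝ) else 1) +
        ε / 2 * (stateEpisodes M τ h.succ s).card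

variable {M : ExBMDP N A S E X} {τ : Fin nA ⊕ Fin nB → ∀ h, X h}
  {G : ∀ h, Finset (X h → Bool)} {Ns : ℕ} {Φ : ∀ h, Finset (X h → Fin Ns)}

theorem Tracks.exists_equiv {h : Fin (N + 1)} {B : Finset (Fin nA ⊕ Fin nB)}
    {St : List (Finset (Fin nA ⊕ Fin nB))} {ls : List (S h)}
    {K : S h → Finset (Fin nA ⊕ Fin nB)} (hT : Tracks M τ h B St ls K) :
    ∃ σ : Fin St.length ≃ S h, ∀ k, St.get k = K (σ k) := by
  classical
  obtain rfl := hT.eq_map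
  refine ⟨(finCongr (by simp)).trans (hT.nodup.getEquivOfForallMemList ls hT.complete), fun k => ?_⟩
  simp

theorem pos_of_minStateCoverage_pos (h : 0 < minStateCoverage M τ) : 0 < (nA : ℝ) + nB := by
  by_contra hn
  have h0 : (nA : ℝ) + nB = 0 := le_antisymm (not_lt.1 hn) (by positivity)
  have : Nonempty (Σ h, S h) := ⟨⟨0, M.init⟩⟩
  simp [minStateCoverage, h0] at h

variable [∀ h, Fintype (S h)]

/-- If the inferred states contain few exceptional episodes, then the empirically best encoder is
accurate on the data, because the true encoder has a small loss; and hence it is accurate. -/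
theorem Tracks.accurate (hR : Realizable M Ns Φ G) {ε : ℝ} (hε : 0 < ε) (hE : EncoderMeans M Φ ε τ)
    {h : Fin N} {B : Finset (Fin nA ⊕ Fin nB)} {St : List (Finset (Fin nA ⊕ Fin nB))}
    {ls : List (S h.succ)} {K : S h.succ → Finset (Fin nA ⊕ Fin nB)}
    (hT : Tracks M τ h.succ B St ls K)
    (hpos : ∀ s, 0 < ((stateEpisodes M τ h.succ s).card : ℝ))
    (hB : ∀ s, 64 * (B.card : ℝ) ≤ (stateEpisodes M τ h.succ s).card)
    (hBε : ∀ s, 64 * (B.card : ℝ) ≤ ε * (stateEpisodes M τ h.succ s).card)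
    {φ : X h.succ → Fin Ns} (hφ : φ ∈ Φ h.succ)
    (hmin : ∀ ψ ∈ Φ h.succ, encoderLoss τ h.succ St φ ≤ encoderLoss τ h.succ St ψ) :
    Accurate M ε h.succ St.length fun x => (φ x : ℕ) := by
  classical
  obtain ⟨σ, hσ⟩ := hT.exists_equiv
  have hcard : St.length = Fintype.card (S h.succ) := by
    simpa using Fintype.card_congr σ
  have hlt : ∀ s, ((σ.symm s : ℕ)) < Ns := fun s =>
    (σ.symm s).2.trans_le (hcard ▸ hR.card_le h.succ)
  have hloss : ∀ ψ : X h.succ → Fin Ns, encoderLoss τ h.succ St ψ = ∑ s, (1 / ((K s).card : ℝ)) *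
      ∑ i ∈ K s, (if (ψ (τ i h.succ) : ℕ) = σ.symm s then (0 : ℝ) else 1) := by
    intro ψ
    unfold encoderLoss
    rw [← σ.sum_comp]
    refine Finset.sum_congr rfl fun k _ => ?_
    rw [hσ k, σ.symm_apply_apply]
  have hagree : ∀ s, ∀ i ∉ B, (i ∈ K s ↔ i ∈ stateEpisodes M τ h.succ s) := by
    intro s i hi
    rw [hT.mem_iff i hi s]
    simp [stateEpisodes]
  have hK1 : ∀ s, ((K s).card : ℝ) ≤ (stateEpisodes M τ h.succ s).card + B.card := fun s =>
    card_le_add_card fun i hi => (hagree s i hi).1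
  have hK2 : ∀ s, ((stateEpisodes M τ h.succ s).card : ℝ) ≤ (K s).card + B.card := fun s =>
    card_le_add_card fun i hi => (hagree s i hi).2
  have hKpos : ∀ s, (0 : ℝ) < (K s).card := fun s => by
    linarith [hK2 s, hpos s, hB s]
  let lab : S h.succ → Fin Ns := fun s => ⟨σ.symm s, hlt s⟩
  have hlab : (fun x => lab (M.enc h.succ x)) ∈ Φ h.succ := by
    refine hR.enc_mem h.succ lab (fun s s' hss => ?_) fun s => ?_
    · have : (σ.symm s : ℕ) = σ.symm s' := congrArg (fun k : Fin Ns => (k : ℕ)) hss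
      exact σ.symm.injective (Fin.ext this)
    · exact hcard ▸ (σ.symm s).2
  -- the true encoder errs only on exceptional episodes, each of which lies in one inferred state
  have htrue : encoderLoss τ h.succ St (fun x => lab (M.enc h.succ x)) ≤ ε / 63 := by
    have hterm : ∀ s, ∑ i ∈ K s, (if ((lab (M.enc h.succ (τ i h.succ)) : Fin Ns) : ℕ) = σ.symm s
        then (0 : ℝ) else 1) ≤ ((B.filter (· ∈ K s)).card : ℝ) := by
      intro s
      calc _ ≤ ∑ i ∈ K s, (if i ∈ B then (1 : ℝ) else 0) := by
            refine Finset.sum_le_sum fun i hi => ?_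
            by_cases hb : i ∈ B
            · rw [if_pos hb]; split_ifs <;> norm_num
            · have := (hT.mem_iff i hb s).1 hi
              simp [lab, this, hb]
        _ = _ := by
            rw [← Finset.sum_filter, Finset.sum_const, nsmul_eq_mul, mul_one]
            congr 2
            ext i; simp [and_comm]
    have hsum : ∑ s, ((B.filter (· ∈ K s)).card : ℝ) ≤ B.card := by
      have hd : ∀ s ∈ (Finset.univ : Finset (S h.succ)), ∀ s' ∈ (Finset.univ : Finset (S h.succ)),
          s ≠ s' → Disjoint (B.filter (· ∈ K s)) (B.filter (· ∈ K s')) := by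
        intro s _ s' _ hne
        rw [Finset.disjoint_left]
        intro i hi hi'
        exact hne (hT.disjoint i s s' (Finset.mem_filter.1 hi).2 (Finset.mem_filter.1 hi').2)
      rw [← Nat.cast_sum, ← Finset.card_biUnion hd]
      exact_mod_cast Finset.card_le_card (Finset.biUnion_subset.2 fun s _ => Finset.filter_subset _ _)
    rw [hloss]
    rcases B.eq_empty_or_nonempty with rfl | hne
    · refine le_trans (Finset.sum_nonpos fun s _ => ?_) (by positivity : 0 ≤ ε / 63)
      refine mul_nonpos_of_nonneg_of_nonpos (by positivity) ((hterm s).trans ?_)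
      simp
    · have hb : (0 : ℝ) < B.card := by exact_mod_cast hne.card_pos
      have hs : ∀ s, (1 / ((K s).card : ℝ)) * ∑ i ∈ K s,
          (if ((lab (M.enc h.succ (τ i h.succ)) : Fin Ns) : ℕ) = σ.symm s then (0 : ℝ) else 1) ≤
          ε / (63 * B.card) * ((B.filter (· ∈ K s)).card : ℝ) := by
        intro s
        refine mul_le_mul ?_ (hterm s)
          (Finset.sum_nonneg fun i _ => by split_ifs <;> norm_num) (by positivity)
        rw [div_le_div_iff₀ (hKpos s) (by positivity)]
        have h1 := hBε s
        have h4 : 63 * ((stateEpisodes M τ h.succ s).card : ℝ) ≤ 64 * (K s).card := by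
          linarith [hK2 s, hB s]
        have h5 := mul_le_mul_of_nonneg_left h4 hε.le
        nlinarith
      refine (Finset.sum_le_sum fun s _ => hs s).trans ?_
      rw [← Finset.mul_sum]
      calc ε / (63 * B.card) * ∑ s, ((B.filter (· ∈ K s)).card : ℝ)
          ≤ ε / (63 * B.card) * B.card := by gcongr
        _ = ε / 63 := by field_simp
  have hφloss := (hmin _ hlab).trans htrue
  rw [hloss] at hφloss
  refine ⟨σ, fun s => ?_⟩
  have hterm : (1 / ((K s).card : ℝ)) *
      ∑ i ∈ K s, (if (φ (τ i h.succ) : ℕ) = σ.symm s then (0 : ℝ) else 1) ≤ ε / 63 :=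
    (Finset.single_le_sum (f := fun s => (1 / ((K s).card : ℝ)) *
      ∑ i ∈ K s, (if (φ (τ i h.succ) : ℕ) = σ.symm s then (0 : ℝ) else 1))
      (fun s _ => mul_nonneg (by positivity)
        (Finset.sum_nonneg fun i _ => by split_ifs <;> norm_num)) (Finset.mem_univ s)).trans hφloss
  rw [one_div_mul_eq_div, div_le_iff₀ (hKpos s)] at hterm
  have hiff : ∀ x, φ x = lab s ↔ (φ x : ℕ) = σ.symm s := fun x => Fin.ext_iff
  have hemp := sum_le_add_card (J := stateEpisodes M τ h.succ s) (C := K s) (B := B)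
    (w := fun i => if φ (τ i h.succ) = lab s then (0 : ℝ) else 1)
    (fun i hi => (hagree s i hi).2) (fun i => by positivity) (fun i => by split_ifs <;> norm_num)
  simp only [hiff] at hemp
  have hmean := hE h φ hφ s (lab s)
  simp only [hiff] at hmean
  have hpop : (M.obsMarginal h.succ s).real {x | φ x ≠ lab s} ≤ ε := by
    have hp := hpos s
    refine le_of_mul_le_mul_right ?_ hp
    have h1 := mul_le_mul_of_nonneg_left (hK1 s) hε.le
    have h2 := mul_le_mul_of_nonneg_left (hB s) hε.le
    simp only [ne_eq] at hmean ⊢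
    nlinarith [hBε s]
  have hae : {x | (φ x : ℕ) = (σ.symm (M.enc h.succ x) : ℕ)} =ᵐ[M.obsMarginal h.succ s]
      ({x | φ x ≠ lab s}ᶜ : Set (X h.succ)) := by
    filter_upwards [M.ae_obsMarginal_enc h.succ s] with x hx
    have : ((φ x : ℕ) = (σ.symm (M.enc h.succ x) : ℕ)) ↔ ¬ (φ x ≠ lab s) := by
      rw [hx, ← hiff, not_not]
    exact propext this
  have hmeas : MeasurableSet {x | φ x ≠ lab s} := by
    have := hR.measurable_enc h.succ φ hφ (MeasurableSet.of_discrete (s := {lab s}ᶜ))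
    exact this
  rw [measureReal_congr hae, probReal_compl_eq_one_sub hmeas]
  linarith

variable {α η ν ε : ℝ}

theorem minStateCoverage_le (h : Fin (N + 1)) (s : S h) :
    minStateCoverage M τ ≤ (stateEpisodes M τ h s).card / ((nA : ℝ) + nB) :=
  ciInf_le (f := fun p : (Σ h, S h) => (countState M τ p.1 p.2 : ℝ) / ((nA : ℝ) + nB))
    (Set.finite_range _).bddBelow ⟨h, s⟩

theorem minStateCoverage_le_one : minStateCoverage M τ ≤ 1 := by
  refine (minStateCoverage_le 0 M.init).trans (div_le_one_of_le₀ ?_ (by positivity))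
  have := Finset.card_le_univ (stateEpisodes M τ 0 M.init)
  simp only [Fintype.card_sum, Fintype.card_fin] at this
  exact_mod_cast this

/-- The fraction of exceptional episodes that each time step of the algorithm may add. Over all time
steps these are few in comparison with every latent pair, by the bound `ν`, and with an `ε`-fraction
of every latent state, by the bound through the state coverage. -/
noncomputable def devBudget (M : ExBMDP N A S E X) (τ : Fin nA ⊕ Fin nB → ∀ h, X h) (ν ε : ℝ) : ℝ :=
  min ν (ε * minStateCoverage M τ) / (64 * ((N : ℝ) + 1))

/-- The properties of a dataset that make every run of the algorithm succeed. -/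
structure TypicalData (M : ExBMDP N A S E X) (Φ : ∀ h, Finset (X h → Fin Ns))
    (G : ∀ h, Finset (X h → Bool)) (α η ν ε : ℝ) (τ : Fin nA ⊕ Fin nB → ∀ h, X h) : Prop where
  coverage : PairCoverage M τ ν
  separation : PolicySeparation M τ α
  share : AgentShare M τ η
  coverage_pos : 0 < minStateCoverage M τ
  feasible : AllFeasible M τ
  separated : SeparatedData M G τ
  classifierMeans : ClassifierMeans M G τ
  encoderMeans : EncoderMeans M Φ ε τ
  card_deviants : ∀ (h : Fin N) f, IsBestPredictor α η Φ τ h f →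
    ((deviants α η M τ h f).card : ℝ) ≤ devBudget M τ ν ε * ((nA : ℝ) + nB)

theorem exists_canTransition (hpos : 0 < minStateCoverage M τ) (hfeas : AllFeasible M τ) {h : Fin N}
    (t : S h.succ) : ∃ s, M.CanTransition h s t := by
  have hn := pos_of_minStateCoverage_pos hpos
  have h1 := hpos.trans_le (minStateCoverage_le h.succ t)
  have h2 : 0 < (stateEpisodes M τ h.succ t).card := by
    by_contra h0
    simp [Nat.eq_zero_of_not_pos h0] at h1
  obtain ⟨i, hi⟩ := Finset.card_pos.1 h2
  simp only [stateEpisodes, Finset.mem_filter, Finset.mem_univ, true_and] at hi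
  exact ⟨_, hi ▸ hfeas i h⟩

/-- On typical data, every run of the algorithm is accurate: by induction, the inferred states track
the latent states outside the exceptional episodes, whose number grows by at most the budget in each
time step. -/
theorem accurate_of_isRun (hR : Realizable M Ns Φ G) (hν : 0 < ν) (hη : 0 < η) (hα : 0 < α)
    (hε : 0 < ε) (hτ : TypicalData M Φ G α η ν ε τ)
    {St : Fin (N + 1) → List (Finset (Fin nA ⊕ Fin nB))} {φ' : ∀ h, X h → ℕ}
    (hrun : IsRun α η ν Φ G τ St φ') (h : Fin (N + 1)) : Accurate M ε h (St h).length (φ' h) := by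
  classical
  obtain ⟨hSt0, hφ0, hstep⟩ := hrun
  have hcp := hτ.coverage_pos
  have hn := pos_of_minStateCoverage_pos hcp
  set n := (nA : ℝ) + nB
  set θ := devBudget M τ ν ε with hθ
  have hN : (0 : ℝ) < 64 * ((N : ℝ) + 1) := by positivity
  have hθpos : 0 < θ := by rw [hθ, devBudget]; positivity
  have hθν : 64 * ((N + 1) * θ) ≤ ν := by
    rw [hθ, devBudget, ← mul_assoc, mul_div_cancel₀ _ hN.ne']; exact min_le_left _ _
  have hθε : 64 * ((N + 1) * θ) ≤ ε * minStateCoverage M τ := by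
    rw [hθ, devBudget, ← mul_assoc, mul_div_cancel₀ _ hN.ne']; exact min_le_right _ _
  have hbound : ∀ (j : ℕ) (b : ℝ), j ≤ N + 1 → b ≤ j * (θ * n) →
      64 * b ≤ ν * n ∧ 64 * b ≤ ε * minStateCoverage M τ * n := by
    intro j b hj hb
    have h1 : (j : ℝ) * (θ * n) ≤ (N + 1) * (θ * n) := by
      gcongr; exact_mod_cast hj
    have h2 := mul_le_mul_of_nonneg_right hθν hn.le
    have h3 := mul_le_mul_of_nonneg_right hθε hn.le
    constructor <;> nlinarith
  have htrack : ∀ h : Fin (N + 1), ∃ B ls K, Tracks M τ h B (St h) ls K ∧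
      (B.card : ℝ) ≤ (h : ℕ) * (θ * n) := by
    intro h
    induction h using Fin.induction with
    | zero =>
      refine ⟨∅, [M.init], fun _ => Finset.univ, ⟨by simp, fun s => by simp [M.init_unique s],
        by simp [hSt0], fun i _ s => ?_, fun i s s' _ _ => ?_⟩, by simp⟩
      · simp [M.init_unique s, M.init_unique (M.enc 0 (τ i 0))]
      · rw [M.init_unique s, M.init_unique s']
    | succ h ih =>
      obtain ⟨B, ls, K, hT, hB⟩ := ih
      obtain ⟨⟨f, hf, hSt⟩, -⟩ := hstep h
      set B' := B ∪ deviants α η M τ h f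
      have hB' : (B'.card : ℝ) ≤ ((h.succ : Fin (N + 1)) : ℕ) * (θ * n) := by
        have h1 : (B'.card : ℝ) ≤ B.card + (deviants α η M τ h f).card := by
          exact_mod_cast Finset.card_union_le _ _
        have h2 := hτ.card_deviants h f hf
        simp only [Fin.val_castSucc] at hB
        rw [Fin.val_succ]; push_cast
        linarith
      have h64 := hbound _ _ h.succ.2.le hB'
      have hlt : (B'.card : ℝ) < ((h : ℝ) + 1) * ν / (8 * ((N : ℝ) + 1)) * n := by
        rw [Fin.val_succ] at hB'; push_cast at hB'
        refine hB'.trans_lt ?_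
        rw [div_mul_eq_mul_div, lt_div_iff₀ (by positivity)]
        have h1 : 8 * ((N + 1) * θ) < ν := by
          have : 0 < (N + 1) * θ := by positivity
          linarith
        have h2 : (0 : ℝ) < ((h : ℝ) + 1) * n := by positivity
        nlinarith [mul_lt_mul_of_pos_left h1 h2]
      obtain ⟨ls', K', hT'⟩ := hT.next hν hη hα hn hτ.coverage hτ.separation hτ.share hτ.feasible
        hτ.classifierMeans hτ.separated (exists_canTransition hcp hτ.feasible) (f := f)
        (B' := B') Finset.subset_union_left Finset.subset_union_right hlt h64.1
      exact ⟨B', ls', K', hSt ▸ hT', hB'⟩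
  refine Fin.cases ?_ (fun h => ?_) h
  · rw [hSt0, hφ0]
    have hu : Unique (S 0) := ⟨⟨M.init⟩, M.init_unique⟩
    refine ⟨Equiv.ofUnique (Fin 1) (S 0), fun s => ?_⟩
    have : {x : X 0 | 0 = (((Equiv.ofUnique (Fin 1) (S 0)).symm (M.enc 0 x) : Fin 1) : ℕ)} =
        Set.univ := by
      ext x; simp
    change 1 - ε ≤ (M.obsMarginal 0 s).real
      {x : X 0 | 0 = (((Equiv.ofUnique (Fin 1) (S 0)).symm (M.enc 0 x) : Fin 1) : ℕ)}
    rw [this]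
    simp [hε.le]
  · obtain ⟨B, ls, K, hT, hB⟩ := htrack h.succ
    obtain ⟨-, φ, hφ, hmin, hφ'⟩ := hstep h
    rw [hφ']
    obtain ⟨h1, h2⟩ := hbound _ _ h.succ.2.le hB
    have hst : ∀ s, ν * n ≤ (stateEpisodes M τ h.succ s).card := by
      intro s
      obtain ⟨s₀, hs₀⟩ := exists_canTransition hcp hτ.feasible s
      have hc := hτ.coverage h s₀ s hs₀
      rw [le_div_iff₀ hn, ← card_pairEpisodes] at hc
      refine hc.trans ?_
      exact_mod_cast Finset.card_le_card fun i hi => by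
        simp only [pairEpisodes, stateEpisodes, Finset.mem_filter, Finset.mem_univ,
          true_and] at hi ⊢
        exact hi.2
    refine hT.accurate hR hε hτ.encoderMeans (fun s => lt_of_lt_of_le (by positivity) (hst s))
      (fun s => h1.trans (hst s)) (fun s => h2.trans ?_) hφ hmin
    have := minStateCoverage_le (M := M) (τ := τ) h.succ s
    rw [le_div_iff₀ hn] at this
    rw [mul_assoc]
    gcongr

theorem Realizable.nonempty (hR : Realizable M Ns Φ G) (h : Fin (N + 1)) : (Φ h).Nonempty := by
  let lab : S h → Fin Ns := fun s => Fin.castLE (hR.card_le h) (Fintype.equivFin (S h) s)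
  refine ⟨_, hR.enc_mem h lab (fun s s' hss => ?_) fun s => ?_⟩
  · exact (Fintype.equivFin (S h)).injective (Fin.castLE_injective _ hss)
  · exact (Fintype.equivFin (S h) s).2

theorem exists_isRun (hR : Realizable M Ns Φ G) : ∃ St φ', IsRun α η ν Φ G τ St φ' := by
  classical
  have hne := hR.nonempty
  have hbest : ∀ h : Fin N, ∃ f, IsBestPredictor α η Φ τ h f := by
    intro h
    let toPred : (X h.castSucc → Fin Ns) × (X h.succ → Fin Ns) ×
        (Fin Ns → Fin Ns → Fin (gridSize α η + 1)) →
        Predictor Ns (gridSize α η) (X h.castSucc) (X h.succ) := fun p => ⟨p.1, p.2.1, p.2.2⟩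
    obtain ⟨p, hp, hmin⟩ := Finset.exists_min_image
      ((Φ h.castSucc) ×ˢ (Φ h.succ) ×ˢ (Finset.univ : Finset
        (Fin Ns → Fin Ns → Fin (gridSize α η + 1)))) (fun p => oddsLoss α η τ h (toPred p))
      ((hne _).product ((hne _).product ⟨fun _ _ => 0, Finset.mem_univ _⟩))
    simp only [Finset.mem_product] at hp hmin
    exact ⟨toPred p, hp.1, hp.2.1, fun f' h1 h2 =>
      hmin ⟨f'.left, f'.right, f'.table⟩ ⟨h1, h2, Finset.mem_univ _⟩⟩
  choose f hf using hbest
  let St : Fin (N + 1) → List (Finset (Fin nA ⊕ Fin nB)) :=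
    Fin.induction (motive := fun _ => List (Finset (Fin nA ⊕ Fin nB))) [Finset.univ]
      fun h L => nextStates ν G τ h (f h) L
  have henc : ∀ h : Fin N, ∃ φ ∈ Φ h.succ, ∀ ψ ∈ Φ h.succ,
      encoderLoss τ h.succ (St h.succ) φ ≤ encoderLoss τ h.succ (St h.succ) ψ := fun h =>
    Finset.exists_min_image _ _ (hne h.succ)
  choose φ hφ hφmin using henc
  refine ⟨St, Fin.cases (fun _ => 0) fun h x => (φ h x : ℕ), rfl, rfl, fun h =>
    ⟨⟨f h, hf h, rfl⟩, φ h, hφ h, hφmin h, rfl⟩⟩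

end Run

/-! ### Random data with fixed latent trajectories are typical -/

section Tails

variable {N : ℕ} {X : Fin (N + 1) → Type*} {nA nB : ℕ}

/-- The logistic loss of the log-odds value `v` on the episode `i`. -/
noncomputable def agentLoss : Fin nA ⊕ Fin nB → ℝ → ℝ :=
  Sum.elim (fun _ v => Real.log (1 + Real.exp (-v))) (fun _ v => Real.log (1 + Real.exp v))

theorem abs_agentLoss_sub_le (i : Fin nA ⊕ Fin nB) (u v : ℝ) :
    |agentLoss i u - agentLoss i v| ≤ |u - v| := by
  cases i with
  | inl i =>
    have := abs_softplus_sub_le (-u) (-v)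
    rwa [show -u - -v = -(u - v) by ring, abs_neg] at this
  | inr i => exact abs_softplus_sub_le u v

theorem oddsLoss_eq_sum {α η : ℝ} {Ns : ℕ} (τ : Fin nA ⊕ Fin nB → ∀ h, X h) (h : Fin N)
    (f : Predictor Ns (gridSize α η) (X h.castSucc) (X h.succ)) :
    oddsLoss α η τ h f = ∑ i, agentLoss i (gridValue α η (episodeIndex τ h f i)) := by
  rw [Fintype.sum_sum_type]
  rfl

variable {A : Type*} {S E : Fin (N + 1) → Type*}
  [∀ h, MeasurableSpace (E h)] [∀ h, MeasurableSpace (X h)]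

theorem sum_agentLoss_pairEpisodes (M : ExBMDP N A S E X) (τ : Fin nA ⊕ Fin nB → ∀ h, X h)
    (h : Fin N) (s : S h.castSucc) (s' : S h.succ) (v : ℝ) :
    ∑ i ∈ pairEpisodes M τ h s s', agentLoss i v =
      pairLoss (countA M τ h s s') (countB M τ h s s') v := by
  rw [pairEpisodes, Finset.sum_filter, Fintype.sum_sum_type]
  simp only [agentLoss, Sum.elim_inl, Sum.elim_inr]
  rw [← Finset.sum_filter, ← Finset.sum_filter, Finset.sum_const, Finset.sum_const, nsmul_eq_mul,
    nsmul_eq_mul]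
  rfl

/-- Two datasets with the same latent states. -/
def SameLatents (M : ExBMDP N A S E X) (τ τ₀ : Fin nA ⊕ Fin nB → ∀ h, X h) : Prop :=
  ∀ i h, M.enc h (τ i h) = M.enc h (τ₀ i h)

/-- The law of a dataset whose latent trajectories are those of `τ₀`. -/
noncomputable def condLaw (M : ExBMDP N A S E X) (τ₀ : Fin nA ⊕ Fin nB → ∀ h, X h) :
    Measure (Fin nA ⊕ Fin nB → ∀ h, X h) :=
  Measure.pi fun i => M.obsLaw fun h => M.enc h (τ₀ i h)

instance (M : ExBMDP N A S E X) (τ₀ : Fin nA ⊕ Fin nB → ∀ h, X h) :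
    IsProbabilityMeasure (condLaw M τ₀) := by
  unfold condLaw; infer_instance

variable {M : ExBMDP N A S E X} {τ τ₀ : Fin nA ⊕ Fin nB → ∀ h, X h}

theorem ae_sameLatents (M : ExBMDP N A S E X) (τ₀ : Fin nA ⊕ Fin nB → ∀ h, X h) :
    ∀ᵐ τ ∂(condLaw M τ₀), SameLatents M τ τ₀ :=
  M.ae_pi_obsLaw_enc fun i h => M.enc h (τ₀ i h)

namespace SameLatents

theorem countA_eq (hs : SameLatents M τ τ₀) : countA M τ = countA M τ₀ := by
  funext h s s'
  unfold countA
  congr 1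
  ext i
  simp only [Finset.mem_filter, hs _ _]

theorem countB_eq (hs : SameLatents M τ τ₀) : countB M τ = countB M τ₀ := by
  funext h s s'
  unfold countB
  congr 1
  ext i
  simp only [Finset.mem_filter, hs _ _]

theorem countPair_eq (hs : SameLatents M τ τ₀) : countPair M τ = countPair M τ₀ := by
  funext h s s'; simp only [countPair, hs.countA_eq, hs.countB_eq]

theorem pairEpisodes_eq (hs : SameLatents M τ τ₀) : pairEpisodes M τ = pairEpisodes M τ₀ := by
  funext h s s'
  ext i
  simp only [pairEpisodes, Finset.mem_filter, hs _ _]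

theorem stateEpisodes_eq (hs : SameLatents M τ τ₀) : stateEpisodes M τ = stateEpisodes M τ₀ := by
  funext h s
  ext i
  simp only [stateEpisodes, Finset.mem_filter, hs _ _]

theorem transIndex_eq (hs : SameLatents M τ τ₀) (α η : ℝ) :
    transIndex α η M τ = transIndex α η M τ₀ := by
  funext h s s'; simp only [transIndex, hs.countA_eq, hs.countB_eq]

theorem minStateCoverage_eq (hs : SameLatents M τ τ₀) :
    minStateCoverage M τ = minStateCoverage M τ₀ := by
  have h1 : ∀ p : (Σ h, S h), countState M τ p.1 p.2 = countState M τ₀ p.1 p.2 := fun p =>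
    congrArg Finset.card (congrFun (congrFun hs.stateEpisodes_eq p.1) p.2)
  simp only [minStateCoverage, h1]

theorem allFeasible_iff (hs : SameLatents M τ τ₀) : AllFeasible M τ ↔ AllFeasible M τ₀ := by
  unfold SameLatents at hs
  simp only [AllFeasible, hs]

theorem pairCoverage_iff (hs : SameLatents M τ τ₀) (ν : ℝ) :
    PairCoverage M τ ν ↔ PairCoverage M τ₀ ν := by
  simp only [PairCoverage, hs.countPair_eq]

theorem agentShare_iff (hs : SameLatents M τ τ₀) (η : ℝ) :
    AgentShare M τ η ↔ AgentShare M τ₀ η := by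
  simp only [AgentShare, hs.countPair_eq, hs.countA_eq, hs.countB_eq]

theorem policySeparation_iff [∀ h, Fintype (S h)] (hs : SameLatents M τ τ₀) (α : ℝ) :
    PolicySeparation M τ α ↔ PolicySeparation M τ₀ α := by
  simp only [PolicySeparation, empA, empB, hs.countA_eq, hs.countB_eq]

end SameLatents

/-- The empirical frequency of a measurable set of observations over episodes with the same latent
state rarely falls short of its probability. -/
theorem frequency_tail {h : Fin (N + 1)} {s : S h} {T : Set (X h)} (hT : MeasurableSet T)
    {I : Finset (Fin nA ⊕ Fin nB)} (hI : ∀ i ∈ I, M.enc h (τ₀ i h) = s) {r : ℝ} (hr : 0 ≤ r) :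
    (condLaw M τ₀).real {τ | ∑ i ∈ I, T.indicator (fun _ => (1 : ℝ)) (τ i h) ≤
      (M.obsMarginal h s).real T * I.card - r * I.card} ≤ Real.exp (-(2 * r ^ 2 * I.card)) := by
  set p := (M.obsMarginal h s).real T
  have hmeas : Measurable (T.indicator fun _ => (1 : ℝ)) := measurable_const.indicator hT
  have hY : Measurable fun x : (∀ h, X h) => T.indicator (fun _ => (1 : ℝ)) (x h) - p :=
    (hmeas.comp (measurable_pi_apply h)).sub_const p
  have hmean : ∀ i ∈ I, ∫ x, T.indicator (fun _ => (1 : ℝ)) (x h) - p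
      ∂(M.obsLaw fun h => M.enc h (τ₀ i h)) = 0 := by
    intro i hi
    have h1 : ∫ x, T.indicator (fun _ => (1 : ℝ)) (x h) - p
        ∂(M.obsLaw fun h => M.enc h (τ₀ i h)) =
        ∫ y, T.indicator (fun _ => (1 : ℝ)) y - p ∂(M.obsMarginal h s) := by
      rw [← hI i hi, ← M.obsLaw_map_eval (fun h => M.enc h (τ₀ i h)) h,
        integral_map (measurable_pi_apply h).aemeasurable
          (hmeas.sub_const p).aestronglyMeasurable]
    rw [h1, integral_sub ((integrable_const (1 : ℝ)).indicator hT) (integrable_const p),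
      integral_indicator_const _ hT]
    simp [p]
  have := hoeffding_pi (μ := fun i => M.obsLaw fun h => M.enc h (τ₀ i h))
    (Y := fun _ x => T.indicator (fun _ => (1 : ℝ)) (x h) - p) (a := -p) (b := 1 - p)
    (fun _ => hY) (by linarith) I
    (fun i => .of_forall fun x => by
      by_cases hx : x h ∈ T <;> simp [hx])
    (Finset.sum_nonneg fun i hi => (hmean i hi).ge) (t := r * I.card) (by positivity)
  refine le_trans (le_of_eq ?_) (this.trans (Real.exp_le_exp.2 (le_of_eq ?_)))
  · unfold condLaw
    congr 1
    ext τ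
    simp only [Set.mem_ofPred_eq, Finset.sum_sub_distrib, Finset.sum_const, nsmul_eq_mul]
    constructor <;> intro h <;> linarith
  · rw [sub_neg_eq_add, sub_add_cancel, one_pow, mul_one, neg_inj]
    by_cases h0 : (I.card : ℝ) = 0
    · simp [h0]
    · field_simp

variable [∀ h, Fintype (S h)] {α η ν ε : ℝ} {G : ∀ h, Finset (X h → Bool)} {Ns : ℕ}
  {Φ : ∀ h, Finset (X h → Fin Ns)}

theorem measurable_comp_index {n : ℕ} {h : Fin N} {f : Predictor Ns n (X h.castSucc) (X h.succ)}
    (hl : Measurable f.left) (hr : Measurable f.right) (e : ℕ → ℝ) :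
    Measurable fun p : X h.castSucc × X h.succ => e (f.index p.1 p.2) := by
  have h1 : Measurable fun p : X h.castSucc × X h.succ => (f.left p.1, f.right p.2) :=
    (hl.comp measurable_fst).prodMk (hr.comp measurable_snd)
  exact (measurable_of_finite fun q : Fin Ns × Fin Ns => e (f.table q.1 q.2)).comp h1

/-- The comparison of a predictor `f` with the predictor that takes the true latent states to their
best grid values: the best predictor cannot be far from the log-odds on many episodes, except with
small probability. For the episodes of one latent pair, the expected excess loss of `f` is at least
`lossGap` times the probability of a deviation, because both agents observe the pair under the same
law, so that the excess losses of the two agents can be added pointwise. -/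
theorem card_deviants_tail (hR : Realizable M Ns Φ G) (hν : 0 < ν) (hη : 0 < η) (hα : 0 < α)
    (hn : 0 < (nA : ℝ) + nB) (hcov : PairCoverage M τ₀ ν) (hshare : AgentShare M τ₀ η)
    (hfeas : AllFeasible M τ₀) {h : Fin N}
    {f : Predictor Ns (gridSize α η) (X h.castSucc) (X h.succ)} (hl : Measurable f.left)
    (hr : Measurable f.right) {t : ℝ} (ht : 0 ≤ t) :
    (condLaw M τ₀).real {τ | SameLatents M τ τ₀ ∧ IsBestPredictor α η Φ τ h f ∧
      t < (deviants α η M τ h f).card} ≤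
      Real.exp (-(2 * (lossGap α η * t) ^ 2 /
        (((nA : ℝ) + nB) * (4 * gridBound α η + lossGap α η) ^ 2))) := by
  classical
  have hgap : 0 < lossGap α η := by unfold lossGap; positivity
  have hB := gridBound_nonneg (η := η) hα
  have hc : ∀ s s', ∃ c ≤ gridSize α η, M.CanTransition h s s' → ∀ j ≤ gridSize α η,
      pairLoss (countA M τ₀ h s s') (countB M τ₀ h s s') (gridValue α η c) +
        ((countA M τ₀ h s s' : ℝ) + countB M τ₀ h s s') *
        (if j = transIndex α η M τ₀ h s s' ∨ j = transIndex α η M τ₀ h s s' + 1 then 0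
          else lossGap α η)
        ≤ pairLoss (countA M τ₀ h s s') (countB M τ₀ h s s') (gridValue α η j) := by
    intro s s'
    by_cases hss : M.CanTransition h s s'
    · obtain ⟨a, b⟩ := countA_pos hν hη hn hcov hshare hss
      obtain ⟨h2, h3⟩ := hshare h s s' hss
      rw [countPair_cast] at h2 h3
      obtain ⟨c, hc, hc'⟩ := exists_best_gridIndex hα hη a b h2 h3
      exact ⟨c, hc, fun _ => hc'⟩
    · exact ⟨0, Nat.zero_le _, fun h => absurd h hss⟩
  choose c hcle hcbest using hc
  let z : Fin nA ⊕ Fin nB → S h.castSucc := fun i => M.enc h.castSucc (τ₀ i h.castSucc)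
  let z' : Fin nA ⊕ Fin nB → S h.succ := fun i => M.enc h.succ (τ₀ i h.succ)
  let e : Fin nA ⊕ Fin nB → ℕ → ℝ := fun i j => agentLoss i (gridValue α η j) -
    agentLoss i (gridValue α η (c (z i) (z' i))) -
      if j = transIndex α η M τ₀ h (z i) (z' i) ∨ j = transIndex α η M τ₀ h (z i) (z' i) + 1 then 0
        else lossGap α η
  let F : Fin nA ⊕ Fin nB → X h.castSucc × X h.succ → ℝ := fun i p => e i (f.index p.1 p.2)
  have hFm : ∀ i, Measurable (F i) := fun i => measurable_comp_index hl hr (e i)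
  let Z : (∀ h, X h) → X h.castSucc × X h.succ := fun x => (x h.castSucc, x h.succ)
  have hZ : Measurable Z := (measurable_pi_apply _).prodMk (measurable_pi_apply _)
  have hidx : ∀ p : X h.castSucc × X h.succ, f.index p.1 p.2 ≤ gridSize α η := fun p =>
    Nat.lt_succ_iff.1 (f.table _ _).2
  have hbd : ∀ i p, F i p ∈ Set.Icc (-(2 * gridBound α η) - lossGap α η) (2 * gridBound α η) := by
    intro i p
    have h1 := abs_agentLoss_sub_le i (gridValue α η (f.index p.1 p.2))
      (gridValue α η (c (z i) (z' i)))
    have h2 := abs_gridValue_le hα (hidx p)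
    have h3 := abs_gridValue_le (η := η) hα (hcle (z i) (z' i))
    have h4 := abs_sub (gridValue α η (f.index p.1 p.2)) (gridValue α η (c (z i) (z' i)))
    obtain ⟨h5, h6⟩ := abs_le.1 (h1.trans h4)
    simp only [F, e]
    split_ifs <;> constructor <;> linarith
  have hFint : ∀ i (μ : Measure (X h.castSucc × X h.succ)) [IsProbabilityMeasure μ],
      Integrable (F i) μ := fun i μ _ =>
    Integrable.of_mem_Icc _ _ (hFm i).aemeasurable (.of_forall (hbd i))
  let μ : Fin nA ⊕ Fin nB → Measure (X h.castSucc × X h.succ) := fun i =>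
    (M.obsLaw fun h => M.enc h (τ₀ i h)).map Z
  have hμ : ∀ i, IsProbabilityMeasure (μ i) := fun i =>
    Measure.isProbabilityMeasure_map hZ.aemeasurable
  have hmean : 0 ≤ ∑ i, ∫ x, F i (Z x) ∂(M.obsLaw fun h => M.enc h (τ₀ i h)) := by
    have h1 : ∀ i, ∫ x, F i (Z x) ∂(M.obsLaw fun h => M.enc h (τ₀ i h)) = ∫ p, F i p ∂(μ i) :=
      fun i => (integral_map hZ.aemeasurable (hFm i).aestronglyMeasurable).symm
    simp_rw [h1]
    rw [← Finset.sum_fiberwise Finset.univ fun i => (z i, z' i)]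
    refine Finset.sum_nonneg fun q _ => ?_
    have hfil : (Finset.univ.filter fun i => (z i, z' i) = q) = pairEpisodes M τ₀ h q.1 q.2 := by
      ext i
      simp only [pairEpisodes, Finset.mem_filter, Finset.mem_univ, true_and, z, z', Prod.ext_iff]
    rw [hfil]
    rcases (pairEpisodes M τ₀ h q.1 q.2).eq_empty_or_nonempty with he | ⟨i₀, hi₀⟩
    · rw [he]; simp
    have hz : ∀ i ∈ pairEpisodes M τ₀ h q.1 q.2, z i = q.1 ∧ z' i = q.2 := by
      intro i hi
      simpa only [pairEpisodes, Finset.mem_filter, Finset.mem_univ, true_and] using hi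
    have hμi : ∀ i ∈ pairEpisodes M τ₀ h q.1 q.2, ∫ p, F i p ∂(μ i) = ∫ p, F i p ∂(μ i₀) := by
      intro i hi
      have : μ i = μ i₀ := M.obsLaw_map_pair ((hz i hi).1.trans (hz i₀ hi₀).1.symm)
        ((hz i hi).2.trans (hz i₀ hi₀).2.symm)
      rw [this]
    rw [Finset.sum_congr rfl hμi, ← integral_finsetSum _ fun i _ => hFint i (μ i₀)]
    refine integral_nonneg fun p => ?_
    have hct : M.CanTransition h q.1 q.2 := by
      have : M.CanTransition h (z i₀) (z' i₀) := hfeas i₀ h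
      rwa [(hz i₀ hi₀).1, (hz i₀ hi₀).2] at this
    have hsum : ∑ i ∈ pairEpisodes M τ₀ h q.1 q.2, F i p =
        pairLoss (countA M τ₀ h q.1 q.2) (countB M τ₀ h q.1 q.2)
          (gridValue α η (f.index p.1 p.2)) -
        pairLoss (countA M τ₀ h q.1 q.2) (countB M τ₀ h q.1 q.2) (gridValue α η (c q.1 q.2)) -
        ((countA M τ₀ h q.1 q.2 : ℝ) + countB M τ₀ h q.1 q.2) *
          (if f.index p.1 p.2 = transIndex α η M τ₀ h q.1 q.2 ∨
            f.index p.1 p.2 = transIndex α η M τ₀ h q.1 q.2 + 1 then 0 else lossGap α η) := by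
      rw [← sum_agentLoss_pairEpisodes, ← sum_agentLoss_pairEpisodes, ← countPair_cast,
        ← card_pairEpisodes, ← nsmul_eq_mul, ← Finset.sum_const, ← Finset.sum_sub_distrib,
        ← Finset.sum_sub_distrib]
      refine Finset.sum_congr rfl fun i hi => ?_
      simp only [F, e, (hz i hi).1, (hz i hi).2]
    simp only [Pi.zero_apply]
    rw [hsum]
    linarith [hcbest q.1 q.2 hct _ (hidx p)]
  have hoeff := hoeffding_pi (μ := fun i => M.obsLaw fun h => M.enc h (τ₀ i h))
    (Y := fun i x => F i (Z x)) (a := -(2 * gridBound α η) - lossGap α η)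
    (b := 2 * gridBound α η) (fun i => (hFm i).comp hZ) (by linarith) Finset.univ
    (fun i => .of_forall fun x => hbd i (Z x)) hmean (t := lossGap α η * t) (by positivity)
  refine (measureReal_mono ?_).trans (hoeff.trans (Real.exp_le_exp.2 (le_of_eq ?_)))
  · rintro τ ⟨hsame, hbest, hdev⟩
    let lab : S h.castSucc → Fin Ns := fun s =>
      Fin.castLE (hR.card_le _) (Fintype.equivFin (S h.castSucc) s)
    let lab' : S h.succ → Fin Ns := fun s =>
      Fin.castLE (hR.card_le _) (Fintype.equivFin (S h.succ) s)
    have hlab : Function.Injective lab := fun s s' hss =>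
      (Fintype.equivFin _).injective (Fin.castLE_injective _ hss)
    have hlab' : Function.Injective lab' := fun s s' hss =>
      (Fintype.equivFin _).injective (Fin.castLE_injective _ hss)
    let f₀ : Predictor Ns (gridSize α η) (X h.castSucc) (X h.succ) :=
      { left := fun x => lab (M.enc h.castSucc x)
        right := fun x => lab' (M.enc h.succ x)
        table := Function.extend lab (fun s => Function.extend lab'
          (fun s' => ⟨c s s', Nat.lt_succ_iff.2 (hcle s s')⟩) fun _ => 0) fun _ _ => 0 }
    have hf₀ : ∀ i, episodeIndex τ h f₀ i = c (z i) (z' i) := by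
      intro i
      simp only [episodeIndex, Predictor.index, f₀, hlab.extend_apply, hlab'.extend_apply, z, z']
      rw [hsame, hsame]
    have hle := hbest.2.2 f₀ (hR.enc_mem _ lab hlab fun s => (Fintype.equivFin _ s).2)
      (hR.enc_mem _ lab' hlab' fun s => (Fintype.equivFin _ s).2)
    rw [oddsLoss_eq_sum, oddsLoss_eq_sum] at hle
    simp only [hf₀] at hle
    have hcard : ∑ i, (if episodeIndex τ h f i = transIndex α η M τ₀ h (z i) (z' i) ∨
        episodeIndex τ h f i = transIndex α η M τ₀ h (z i) (z' i) + 1 then 0 else lossGap α η) =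
        (deviants α η M τ h f).card * lossGap α η := by
      rw [deviants, ← nsmul_eq_mul, ← Finset.sum_const, Finset.sum_filter]
      refine Finset.sum_congr rfl fun i _ => ?_
      rw [hsame.transIndex_eq, hsame, hsame, ite_not]
    change ∑ i, e i (episodeIndex τ h f i) ≤ -(lossGap α η * t)
    simp only [e, Finset.sum_sub_distrib]
    rw [hcard]
    have := mul_lt_mul_of_pos_right hdev hgap
    linarith
  · simp only [Finset.card_univ, Fintype.card_sum, Fintype.card_fin]
    push_cast
    ring_nf

end Tails

/-! ### The union bound -/

section UnionBound

theorem measureReal_biUnion_le_card_mul {Ω ι : Type*} [MeasurableSpace Ω] {μ : Measure Ω}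
    [IsFiniteMeasure μ] (J : Finset ι) (B : ι → Set Ω) {e : ℝ} (h : ∀ j ∈ J, μ.real (B j) ≤ e) :
    μ.real (⋃ j ∈ J, B j) ≤ J.card * e :=
  (measureReal_biUnion_finset_le J B).trans
    ((Finset.sum_le_sum h).trans (by rw [Finset.sum_const, nsmul_eq_mul]))

variable {N : ℕ} {A : Type*} {S E X : Fin (N + 1) → Type*}
  [∀ h, MeasurableSpace (E h)] [∀ h, MeasurableSpace (X h)] {nA nB : ℕ}
  {M : ExBMDP N A S E X} {τ₀ : Fin nA ⊕ Fin nB → ∀ h, X h}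
  [∀ h, Fintype (S h)] {α η ν ε : ℝ} {G : ∀ h, Finset (X h → Bool)} {Ns : ℕ}
  {Φ : ∀ h, Finset (X h → Fin Ns)}

theorem ae_separatedData (hR : Realizable M Ns Φ G) :
    ∀ᵐ τ ∂(condLaw M τ₀), SeparatedData M G τ := by
  refine ae_all_iff.2 fun h => ?_
  have hcount : ∀ p : S h × S h, p.1 ≠ p.2 → ∃ g ∈ G h, ∀ᵐ τ ∂(condLaw M τ₀), ∀ i,
      (M.enc h (τ i h) = p.1 → g (τ i h) = true) ∧ (M.enc h (τ i h) = p.2 → g (τ i h) = false) := by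
    intro p hp
    obtain ⟨g, hg, hge⟩ := hR.separates h p.1 p.2 hp
    have hgm := hR.measurable_classifier h g hg
    refine ⟨g, hg, ae_all_iff.2 fun i => ?_⟩
    have key : ∀ (s : S h) (b : Bool), (∀ e, ∀ᵐ x ∂(M.emit h s e), g x = b) →
        ∀ᵐ τ ∂(condLaw M τ₀), M.enc h (τ i h) = s → g (τ i h) = b := by
      intro s b hb
      by_cases hs : M.enc h (τ₀ i h) = s
      · have h1 := M.ae_obsMarginal_of_emit h s (p := fun x => g x = b)
          (hgm (MeasurableSet.singleton b)) hb
        refine (M.ae_pi_obsLaw (fun i h => M.enc h (τ₀ i h)) i h (p := fun x => g x = b)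
          (hs ▸ h1)).mono fun τ hτ _ => hτ
      · filter_upwards [ae_sameLatents M τ₀] with τ hτ hs'
        exact absurd ((hτ i h).symm.trans hs') hs
    filter_upwards [key p.1 true fun e => (hge e).1, key p.2 false fun e => (hge e).2] with τ h1 h2
    exact ⟨h1, h2⟩
  have hall : ∀ᵐ τ ∂(condLaw M τ₀), ∀ p : S h × S h, p.1 ≠ p.2 → ∃ g ∈ G h, ∀ i,
      (M.enc h (τ i h) = p.1 → g (τ i h) = true) ∧ (M.enc h (τ i h) = p.2 → g (τ i h) = false) := by
    refine ae_all_iff.2 fun p => ?_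
    by_cases hp : p.1 = p.2
    · exact .of_forall fun τ h => absurd hp h
    · obtain ⟨g, hg, hae⟩ := hcount p hp
      exact hae.mono fun τ hτ _ => ⟨g, hg, hτ⟩
  exact hall.mono fun τ hτ s s' hss => hτ (s, s') hss

/-- The union bound over time steps, encoders, classifiers, tables and latent states, given the latent
trajectories of a dataset `τ₀` that satisfies the assumptions. -/
theorem not_typicalData_le (hR : Realizable M Ns Φ G) (hν : 0 < ν) (hη : 0 < η) (hα : 0 < α)
    (hε : 0 < ε) (hcov : PairCoverage M τ₀ ν) (hsep : PolicySeparation M τ₀ α)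
    (hshare : AgentShare M τ₀ η) (hcp : 0 < minStateCoverage M τ₀) (hfeas : AllFeasible M τ₀)
    {cΦ : ℕ} (hcΦ : ∀ h, (Φ h).card ≤ cΦ) {R : ℝ}
    (hR1 : ∀ _ : Fin N, R ≤ 2 * (lossGap α η * (devBudget M τ₀ ν ε * ((nA : ℝ) + nB))) ^ 2 /
      (((nA : ℝ) + nB) * (4 * gridBound α η + lossGap α η) ^ 2))
    (hR2 : ∀ (h : Fin N) s s', M.CanTransition h s s' →
      R ≤ 2 * (1 / 16) ^ 2 * (countPair M τ₀ h s s' : ℝ))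
    (hR3 : ∀ (h : Fin N) s s', M.CanTransition h s s' →
      R ≤ 2 * (ε / 2) ^ 2 * (countPair M τ₀ h s s' : ℝ)) :
    (condLaw M τ₀).real {τ | ¬ TypicalData M Φ G α η ν ε τ} ≤
      N * ((cΦ : ℝ) ^ 2 * (gridSize α η + 1 : ℝ) ^ Ns ^ 2 + 3 * (Ns : ℝ) ^ 2 * cΦ) *
        Real.exp (-R) := by
  classical
  have hn := pos_of_minStateCoverage_pos hcp
  set P := condLaw M τ₀
  set t := devBudget M τ₀ ν ε * ((nA : ℝ) + nB) with ht
  have htpos : 0 ≤ t := by rw [ht, devBudget]; positivity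
  have hS : ∀ h, Fintype.card (S h) ≤ Ns := hR.card_le
  let pred : ∀ h : Fin N, (X h.castSucc → Fin Ns) × (X h.succ → Fin Ns) ×
      (Fin Ns → Fin Ns → Fin (gridSize α η + 1)) →
      Predictor Ns (gridSize α η) (X h.castSucc) (X h.succ) := fun h p => ⟨p.1, p.2.1, p.2.2⟩
  let JD : ∀ h : Fin N, Finset ((X h.castSucc → Fin Ns) × (X h.succ → Fin Ns) ×
      (Fin Ns → Fin Ns → Fin (gridSize α η + 1))) := fun h => Φ h.castSucc ×ˢ Φ h.succ ×ˢ Finset.univ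
  let BD : ∀ h : Fin N, Set (Fin nA ⊕ Fin nB → ∀ h, X h) := fun h => ⋃ p ∈ JD h,
    {τ | SameLatents M τ τ₀ ∧ IsBestPredictor α η Φ τ h (pred h p) ∧
      t < (deviants α η M τ h (pred h p)).card}
  have hBD : ∀ h : Fin N, P.real (BD h) ≤
      ((cΦ : ℝ) ^ 2 * (gridSize α η + 1 : ℝ) ^ Ns ^ 2) * Real.exp (-R) := by
    intro h
    refine (measureReal_biUnion_le_card_mul (JD h) _ (e := Real.exp (-R)) fun p hp => ?_).trans ?_
    · simp only [JD, Finset.mem_product] at hp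
      refine (card_deviants_tail hR hν hη hα hn hcov hshare hfeas
        (hR.measurable_enc _ _ hp.1) (hR.measurable_enc _ _ hp.2.1) htpos).trans ?_
      exact Real.exp_le_exp.2 (neg_le_neg (hR1 h))
    · refine mul_le_mul_of_nonneg_right ?_ (Real.exp_pos _).le
      have hcard : (JD h).card = (Φ h.castSucc).card * ((Φ h.succ).card *
          (gridSize α η + 1) ^ Ns ^ 2) := by
        simp only [JD, Finset.card_product, Finset.card_univ, Fintype.card_pi, Finset.prod_const,
          Fintype.card_fin]
        rw [← pow_mul, sq]
      have : (JD h).card ≤ cΦ ^ 2 * (gridSize α η + 1) ^ Ns ^ 2 := by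
        rw [hcard, ← mul_assoc, sq cΦ]
        gcongr
        · exact hcΦ _
        · exact hcΦ _
      exact_mod_cast this
  let JC : ∀ h : Fin N, Finset ((S h.castSucc × S h.succ) × (X h.succ → Bool)) := fun h =>
    (Finset.univ.filter fun p => M.CanTransition h p.1 p.2) ×ˢ G h.succ
  let BC : ∀ h : Fin N, Bool → Set (Fin nA ⊕ Fin nB → ∀ h, X h) := fun h b => ⋃ p ∈ JC h,
    {τ | ∑ i ∈ pairEpisodes M τ₀ h p.1.1 p.1.2,
      {x | p.2 x = b}.indicator (fun _ => (1 : ℝ)) (τ i h.succ) ≤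
      (M.obsMarginal h.succ p.1.2).real {x | p.2 x = b} * (pairEpisodes M τ₀ h p.1.1 p.1.2).card -
        1 / 16 * (pairEpisodes M τ₀ h p.1.1 p.1.2).card}
  have hBC : ∀ h b, P.real (BC h b) ≤ ((Ns : ℝ) ^ 2 * cΦ) * Real.exp (-R) := by
    intro h b
    refine (measureReal_biUnion_le_card_mul (JC h) _ (e := Real.exp (-R)) fun p hp => ?_).trans ?_
    · simp only [JC, Finset.mem_product, Finset.mem_filter, Finset.mem_univ, true_and] at hp
      refine (frequency_tail (h := h.succ) (s := p.1.2)
        (hR.measurable_classifier _ _ hp.2 (MeasurableSet.singleton b)) (fun i hi => ?_)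
        (by norm_num)).trans ?_
      · simp only [pairEpisodes, Finset.mem_filter] at hi; exact hi.2.2
      · refine Real.exp_le_exp.2 (neg_le_neg ?_)
        rw [card_pairEpisodes]
        exact hR2 h _ _ hp.1
    · refine mul_le_mul_of_nonneg_right ?_ (Real.exp_pos _).le
      have : (JC h).card ≤ Ns ^ 2 * cΦ := by
        rw [Finset.card_product, sq]
        refine Nat.mul_le_mul ((Finset.card_filter_le _ _).trans ?_)
          ((hR.card_G_le _).trans (hcΦ _))
        rw [Finset.card_univ, Fintype.card_prod]
        exact Nat.mul_le_mul (hS _) (hS _)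
      exact_mod_cast this
  let JE : ∀ h : Fin N, Finset ((S h.succ × Fin Ns) × (X h.succ → Fin Ns)) := fun h =>
    Finset.univ ×ˢ Φ h.succ
  let BE : ∀ h : Fin N, Set (Fin nA ⊕ Fin nB → ∀ h, X h) := fun h => ⋃ p ∈ JE h,
    {τ | ∑ i ∈ stateEpisodes M τ₀ h.succ p.1.1,
      {x | p.2 x ≠ p.1.2}.indicator (fun _ => (1 : ℝ)) (τ i h.succ) ≤
      (M.obsMarginal h.succ p.1.1).real {x | p.2 x ≠ p.1.2} *
        (stateEpisodes M τ₀ h.succ p.1.1).card - ε / 2 * (stateEpisodes M τ₀ h.succ p.1.1).card}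
  have hBE : ∀ h, P.real (BE h) ≤ ((Ns : ℝ) ^ 2 * cΦ) * Real.exp (-R) := by
    intro h
    refine (measureReal_biUnion_le_card_mul (JE h) _ (e := Real.exp (-R)) fun p hp => ?_).trans ?_
    · simp only [JE, Finset.mem_product, Finset.mem_univ, true_and] at hp
      refine (frequency_tail (h := h.succ) (s := p.1.1) (T := {x | p.2 x ≠ p.1.2})
        (hR.measurable_enc _ _ hp (MeasurableSet.of_discrete (s := {p.1.2}ᶜ))) (fun i hi => ?_)
        (by positivity)).trans ?_
      · simp only [stateEpisodes, Finset.mem_filter] at hi; exact hi.2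
      · refine Real.exp_le_exp.2 (neg_le_neg ?_)
        obtain ⟨s, hs⟩ := exists_canTransition hcp hfeas p.1.1
        refine (hR3 h s _ hs).trans (mul_le_mul_of_nonneg_left ?_ (by positivity))
        rw [← card_pairEpisodes]
        exact_mod_cast Finset.card_le_card fun i hi => by
          simp only [pairEpisodes, stateEpisodes, Finset.mem_filter, Finset.mem_univ,
            true_and] at hi ⊢
          exact hi.2
    · refine mul_le_mul_of_nonneg_right ?_ (Real.exp_pos _).le
      have : (JE h).card ≤ Ns ^ 2 * cΦ := by
        rw [Finset.card_product, sq]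
        refine Nat.mul_le_mul ?_ (hcΦ _)
        rw [Finset.card_univ, Fintype.card_prod, Fintype.card_fin]
        exact Nat.mul_le_mul (hS _) le_rfl
      exact_mod_cast this
  let Bnull : Set (Fin nA ⊕ Fin nB → ∀ h, X h) :=
    {τ | ¬ (SameLatents M τ τ₀ ∧ SeparatedData M G τ)}
  have hnull : P.real Bnull = 0 := by
    have : ∀ᵐ τ ∂P, SameLatents M τ τ₀ ∧ SeparatedData M G τ :=
      (ae_sameLatents M τ₀).and (ae_separatedData hR)
    rw [measureReal_def, show P Bnull = 0 from ae_iff.1 this, ENNReal.toReal_zero]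
  let Bh : Fin N → Set (Fin nA ⊕ Fin nB → ∀ h, X h) := fun h =>
    BD h ∪ (BC h true ∪ BC h false) ∪ BE h
  have hBh : ∀ h, P.real (Bh h) ≤ ((cΦ : ℝ) ^ 2 * (gridSize α η + 1 : ℝ) ^ Ns ^ 2 +
      3 * (Ns : ℝ) ^ 2 * cΦ) * Real.exp (-R) := by
    intro h
    have h1 := measureReal_union_le (μ := P) (BD h ∪ (BC h true ∪ BC h false)) (BE h)
    have h2 := measureReal_union_le (μ := P) (BD h) (BC h true ∪ BC h false)
    have h3 := measureReal_union_le (μ := P) (BC h true) (BC h false)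
    have h4 := hBD h
    have h5 := hBC h true
    have h6 := hBC h false
    have h7 := hBE h
    change P.real (BD h ∪ (BC h true ∪ BC h false) ∪ BE h) ≤ _
    linarith
  have hsub : {τ | ¬ TypicalData M Φ G α η ν ε τ} ⊆
      Bnull ∪ ⋃ h ∈ (Finset.univ : Finset (Fin N)), Bh h := by
    intro τ hτ
    by_contra hcon
    simp only [Set.mem_union, Set.mem_iUnion, Finset.mem_univ, exists_true_left, not_or,
      not_exists] at hcon
    obtain ⟨hnn, hh⟩ := hcon
    obtain ⟨hsame, hsepd⟩ := not_not.1 hnn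
    refine hτ ⟨(hsame.pairCoverage_iff ν).2 hcov, (hsame.policySeparation_iff α).2 hsep,
      (hsame.agentShare_iff η).2 hshare, hsame.minStateCoverage_eq ▸ hcp,
      hsame.allFeasible_iff.2 hfeas, hsepd, fun h s' g hg => ?_, fun h φ hφ s k => ?_,
      fun h f hf => ?_⟩
    · refine ⟨(M.obsMarginal h.succ s').real {x | g x = true}, fun s hs => ?_⟩
      rw [hsame.pairEpisodes_eq]
      have hnot : ∀ b, τ ∉ BC h b := by
        intro b
        have := hh h
        simp only [Bh, Set.mem_union, not_or] at this
        cases b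
        · exact this.1.2.2
        · exact this.1.2.1
      have hmem : ((s, s'), g) ∈ JC h := by simp [JC, hs, hg]
      have hlow : ∀ b, (M.obsMarginal h.succ s').real {x | g x = b} *
          (pairEpisodes M τ₀ h s s').card - 1 / 16 * (pairEpisodes M τ₀ h s s').card <
          ∑ i ∈ pairEpisodes M τ₀ h s s',
            {x | g x = b}.indicator (fun _ => (1 : ℝ)) (τ i h.succ) := by
        intro b
        by_contra hle
        exact hnot b (Set.mem_biUnion hmem (not_lt.1 hle))
      have hcompl : (M.obsMarginal h.succ s').real {x | g x = false} =
          1 - (M.obsMarginal h.succ s').real {x | g x = true} := by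
        have hm : MeasurableSet {x | g x = true} :=
          hR.measurable_classifier _ _ hg (MeasurableSet.singleton true)
        rw [← probReal_compl_eq_one_sub hm]
        congr 1
        ext x; simp
      have hone : ∑ i ∈ pairEpisodes M τ₀ h s s',
          {x | g x = true}.indicator (fun _ => (1 : ℝ)) (τ i h.succ) +
          ∑ i ∈ pairEpisodes M τ₀ h s s',
          {x | g x = false}.indicator (fun _ => (1 : ℝ)) (τ i h.succ) =
          (pairEpisodes M τ₀ h s s').card := by
        rw [← Finset.sum_add_distrib]
        rw [Finset.sum_congr rfl fun i _ => show _ = (1 : ℝ) by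
          cases hgi : g (τ i h.succ) <;> simp [hgi]]
        simp
      have hif : ∑ i ∈ pairEpisodes M τ₀ h s s', (if g (τ i h.succ) then (1 : ℝ) else 0) =
          ∑ i ∈ pairEpisodes M τ₀ h s s',
          {x | g x = true}.indicator (fun _ => (1 : ℝ)) (τ i h.succ) :=
        Finset.sum_congr rfl fun i _ => by simp [Set.indicator_apply]
      have h1 := hlow true
      have h2 := hlow false
      rw [hcompl] at h2
      rw [hif, abs_le]
      constructor <;> linarith
    · rw [hsame.stateEpisodes_eq]
      have hnot : τ ∉ BE h := by
        have := hh h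
        simp only [Bh, Set.mem_union, not_or] at this
        exact this.2
      have hmem : ((s, k), φ) ∈ JE h := by simp [JE, hφ]
      by_contra hle
      refine hnot (Set.mem_biUnion hmem ?_)
      simp only [Set.mem_ofPred_eq]
      have hif : ∑ i ∈ stateEpisodes M τ₀ h.succ s, (if φ (τ i h.succ) = k then (0 : ℝ) else 1) =
          ∑ i ∈ stateEpisodes M τ₀ h.succ s,
          {x | φ x ≠ k}.indicator (fun _ => (1 : ℝ)) (τ i h.succ) :=
        Finset.sum_congr rfl fun i _ => by
          by_cases hk : φ (τ i h.succ) = k <;> simp [hk]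
      rw [hif] at hle
      linarith [not_le.1 hle]
    · have hnot : τ ∉ BD h := by
        have := hh h
        simp only [Bh, Set.mem_union, not_or] at this
        exact this.1.1
      have hmem : (f.left, f.right, f.table) ∈ JD h := by simp [JD, hf.1, hf.2.1]
      by_contra hlt
      refine hnot (Set.mem_biUnion hmem ⟨hsame, hf, ?_⟩)
      have hbud : devBudget M τ ν ε = devBudget M τ₀ ν ε := by
        rw [devBudget, devBudget, hsame.minStateCoverage_eq]
      rw [hbud] at hlt
      exact not_le.1 hlt
  refine (measureReal_mono hsub).trans ((measureReal_union_le _ _).trans ?_)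
  rw [hnull, zero_add]
  refine (measureReal_biUnion_le_card_mul Finset.univ Bh fun h _ => hBh h).trans (le_of_eq ?_)
  rw [Finset.card_univ, Fintype.card_fin]
  exact (mul_assoc _ _ _).symm

end UnionBound

/-! ### The sample complexity -/

section SampleComplexity

variable {H cΦ Ns : ℕ} {δ ε ν ν' η α : ℝ}

/-- The factor of the rate that pays for the union bound: up to logarithmic factors, it bounds the
logarithm of the number of predictors divided by `δ`. -/
noncomputable def logWeight (cΦ Ns : ℕ) (δ : ℝ) : ℝ := Real.log (cΦ / δ) + (Ns : ℝ) ^ 2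

/-- A number of episodes per latent transition that suffices for the algorithm. -/
noncomputable def sampleBound (H cΦ Ns : ℕ) (δ ε ν ν' η α : ℝ) : ℝ :=
  2 ^ 35 * rate H cΦ Ns δ ε ν ν' η (min 1 α) *
    Real.log (rate H cΦ Ns δ ε ν ν' η (min 1 α)) ^ 3

theorem log_card_div_nonneg (hc : 1 ≤ cΦ) (hδ : 0 < δ) (hδ1 : δ ≤ 1) :
    0 ≤ Real.log ((cΦ : ℝ) / δ) := by
  refine Real.log_nonneg ?_
  rw [one_le_div₀ hδ]
  exact hδ1.trans (by exact_mod_cast hc)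

theorem sq_le_logWeight (hc : 1 ≤ cΦ) (hδ : 0 < δ) (hδ1 : δ ≤ 1) :
    (Ns : ℝ) ^ 2 ≤ logWeight cΦ Ns δ :=
  le_add_of_nonneg_left (log_card_div_nonneg hc hδ hδ1)

theorem one_le_logWeight (hc : 1 ≤ cΦ) (hN : 1 ≤ Ns) (hδ : 0 < δ) (hδ1 : δ ≤ 1) :
    1 ≤ logWeight cΦ Ns δ :=
  (one_le_pow₀ (by exact_mod_cast hN)).trans (sq_le_logWeight hc hδ hδ1)

/-- A lower bound for the rate without the factor `ν⁻¹` and with only part of the maximum. -/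
theorem le_rate_of_le_max (hW : 0 ≤ logWeight cΦ Ns δ) (hν : 0 < ν) (hν1 : ν ≤ 1) (hη : 0 < η)
    (hα : 0 < α) {K : ℝ} (hK : 0 ≤ K) (hKmax : K ≤ max (1 / ν ^ 2) (1 / (ε ^ 2 * ν' ^ 2))) :
    (H : ℝ) ^ 2 * logWeight cΦ Ns δ / (η * α ^ 2) ^ 2 * K ≤ rate H cΦ Ns δ ε ν ν' η α := by
  unfold rate
  refine mul_le_mul ?_ hKmax hK ?_
  · change (H : ℝ) ^ 2 * logWeight cΦ Ns δ / (η * α ^ 2) ^ 2 ≤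
      (H : ℝ) ^ 2 * logWeight cΦ Ns δ / (ν * η ^ 2 * α ^ 4)
    refine div_le_div_of_nonneg_left (by positivity) (by positivity) ?_
    rw [show (η * α ^ 2) ^ 2 = 1 * (η ^ 2 * α ^ 4) by ring, mul_assoc]
    exact mul_le_mul_of_nonneg_right hν1 (by positivity)
  · change 0 ≤ (H : ℝ) ^ 2 * logWeight cΦ Ns δ / (ν * η ^ 2 * α ^ 4)
    positivity

theorem le_rate (hW : 0 ≤ logWeight cΦ Ns δ) (hν : 0 < ν) (hν1 : ν ≤ 1) (hη : 0 < η)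
    (hα : 0 < α) :
    (H : ℝ) ^ 2 * logWeight cΦ Ns δ / (η * α ^ 2) ^ 2 ≤ rate H cΦ Ns δ ε ν ν' η α := by
  have := le_rate_of_le_max (H := H) (ε := ε) (ν' := ν') hW hν hν1 hη hα zero_le_one
    (((one_le_div₀ (by positivity)).2 (pow_le_one₀ hν.le hν1)).trans (le_max_left _ _))
  rwa [mul_one] at this

theorem logWeight_le_rate_mul_sq (hH : 1 ≤ H) (hW : 0 ≤ logWeight cΦ Ns δ) (hν : 0 < ν)
    (hν1 : ν ≤ 1) (hν' : 0 < ν') (hν'1 : ν' ≤ 1) (hη : 0 < η) (hη2 : η ≤ 1 / 2) (hα : 0 < α)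
    (hα1 : α ≤ 1) (hε : 0 < ε) :
    logWeight cΦ Ns δ ≤ rate H cΦ Ns δ ε ν ν' η α * ε ^ 2 := by
  have h1 := le_rate_of_le_max (H := H) (ε := ε) (ν' := ν') (K := 1 / ε ^ 2) hW hν hν1 hη hα
    (by positivity) (le_trans (one_div_le_one_div_of_le (by positivity)
      (mul_le_of_le_one_right (by positivity) (pow_le_one₀ hν'.le hν'1))) (le_max_right _ _))
  have h2 := mul_le_mul_of_nonneg_right h1 (sq_nonneg ε)
  rw [mul_assoc, one_div_mul_cancel (by positivity), mul_one] at h2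
  refine le_trans ?_ h2
  have h3 : (η * α ^ 2) ^ 2 ≤ 1 := by
    refine pow_le_one₀ (by positivity) (mul_le_one₀ (by linarith) (by positivity) ?_)
    exact pow_le_one₀ hα.le hα1
  rw [le_div_iff₀ (by positivity)]
  have hH2 : (1 : ℝ) ≤ (H : ℝ) ^ 2 := one_le_pow₀ (by exact_mod_cast hH)
  nlinarith

theorem logWeight_le_rate_mul_min (hW : 0 ≤ logWeight cΦ Ns δ) (hν : 0 < ν) (hν1 : ν ≤ 1)
    (hν' : 0 < ν') (hη : 0 < η) (hα : 0 < α) (hε : 0 < ε) :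
    (H : ℝ) ^ 2 * logWeight cΦ Ns δ ≤
      rate H cΦ Ns δ ε ν ν' η α * (η * α ^ 2 * min ν (ε * ν')) ^ 2 := by
  have hm : 0 < min ν (ε * ν') := lt_min hν (by positivity)
  have h1 := le_rate_of_le_max (H := H) (ε := ε) (ν' := ν') (K := 1 / min ν (ε * ν') ^ 2) hW hν
    hν1 hη hα (by positivity) (by
      rcases le_total ν (ε * ν') with h | h
      · rw [min_eq_left h]; exact le_max_left _ _
      · rw [min_eq_right h, mul_pow]; exact le_max_right _ _)
  have h2 := mul_le_mul_of_nonneg_right h1 (sq_nonneg (η * α ^ 2 * min ν (ε * ν')))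
  refine le_trans (le_of_eq ?_) h2
  field_simp

end SampleComplexity

/-- Bounds for the quantities in the union bound in terms of the logarithm of the rate. -/
theorem log_rate_bounds {H cΦ Ns : ℕ} {δ ε ν ν' η α : ℝ} (hH : 1 ≤ H) (hc : 1 ≤ cΦ)
    (hN : 1 ≤ Ns) (hδ : 0 < δ) (hδ1 : δ ≤ 1) (hν : 0 < ν) (hν1 : ν ≤ 1)
    (hη : 0 < η) (hη2 : η ≤ 1 / 2) (hα : 0 < α) {r : ℝ}
    (hr : r = rate H cΦ Ns δ ε ν ν' η (min 1 α)) :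
    4 ≤ r ∧ 1 ≤ Real.log r ∧ (H : ℝ) ≤ r ∧ logWeight cΦ Ns δ ≤ r ∧
      4 * gridBound α η + lossGap α η ≤ 4 * Real.log r ∧
      (gridSize α η + 1 : ℝ) ≤ Real.exp (3 * Real.log r) := by
  have hW := one_le_logWeight hc hN hδ hδ1
  set a := min 1 α with ha
  have ha0 : 0 < a := lt_min one_pos hα
  have ha1 : a ≤ 1 := min_le_left _ _
  have h0 := le_rate (H := H) (ε := ε) (ν' := ν') (zero_le_one.trans hW) hν hν1 hη ha0
  rw [← hr] at h0
  have hHr : (1 : ℝ) ≤ H := by exact_mod_cast hH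
  have hηa : (η * a ^ 2) ^ 2 ≤ η ^ 2 := by
    rw [mul_pow]
    exact mul_le_of_le_one_right (by positivity) (pow_le_one₀ (by positivity) (pow_le_one₀ ha0.le ha1))
  have hHW : (H : ℝ) ^ 2 ≤ (H : ℝ) ^ 2 * logWeight cΦ Ns δ :=
    le_mul_of_one_le_right (by positivity) hW
  have h1 : (H : ℝ) ^ 2 / (η * a ^ 2) ^ 2 ≤ r := by
    refine le_trans ?_ h0
    gcongr
  have hinv : 2 ≤ 1 / η := by rw [le_div_iff₀ hη]; linarith
  have hrη : (H : ℝ) ^ 2 * (1 / η) ^ 2 ≤ r := by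
    refine le_trans ?_ h1
    rw [one_div, inv_pow, ← div_eq_mul_inv]
    gcongr
  have hH2 : (1 : ℝ) ≤ (H : ℝ) ^ 2 := one_le_pow₀ hHr
  have hrη' : (1 / η) ^ 2 ≤ r := le_trans (le_mul_of_one_le_left (by positivity) hH2) hrη
  have h4 : 4 ≤ r := by nlinarith
  have hr0 : 0 < r := by linarith
  have hlog4 : 1 ≤ Real.log r := by
    rw [Real.le_log_iff_exp_le hr0]
    linarith [Real.exp_one_lt_d9]
  have hlogη : 2 * Real.log (1 / η) ≤ Real.log r := by
    have := Real.log_le_log (by positivity) hrη'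
    rwa [Real.log_pow, Nat.cast_ofNat] at this
  refine ⟨h4, hlog4, ?_, ?_, ?_, ?_⟩
  · have h5 : (1 : ℝ) ≤ (1 / η) ^ 2 := one_le_pow₀ (by linarith)
    nlinarith [mul_le_mul hH2 h5 zero_le_one (by positivity)]
  · refine le_trans ?_ h0
    rw [le_div_iff₀ (by positivity)]
    have h5 : (η * a ^ 2) ^ 2 ≤ (H : ℝ) ^ 2 := by nlinarith
    rw [mul_comm]
    exact mul_le_mul_of_nonneg_right h5 (by linarith)
  · have hb := gridBound_le hα hη hη2
    have hl : Real.log (η⁻¹ - 1) ≤ Real.log (1 / η) := by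
      rw [one_div] at hinv ⊢
      exact Real.log_le_log (by linarith) (by linarith)
    have hg : lossGap α η ≤ 1 / 2 := by
      have : η * a ^ 2 ≤ 1 := mul_le_one₀ (by linarith) (by positivity) (pow_le_one₀ ha0.le ha1)
      unfold lossGap
      rw [← ha]; linarith
    linarith
  · have hceil : (gridSize α η : ℝ) < 8 * Real.log (η⁻¹ - 1) / a + 1 :=
      Nat.ceil_lt_add_one (div_nonneg (by linarith [log_odds_nonneg hη hη2]) ha0.le)
    have hl : Real.log (η⁻¹ - 1) ≤ 1 / η := by
      rw [one_div] at hinv ⊢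
      exact (Real.log_le_sub_one_of_pos (by linarith)).trans (by linarith)
    have hia : 1 ≤ 1 / a := by rw [le_div_iff₀ ha0]; linarith
    have hsq : (1 / η * (1 / a)) ^ 2 ≤ r := by
      refine le_trans ?_ h1
      rw [one_div_mul_one_div, div_pow, one_pow]
      refine div_le_div₀ (by positivity) hH2 (by positivity) (pow_le_pow_left₀ (by positivity) ?_ 2)
      exact mul_le_mul_of_nonneg_left (pow_le_of_le_one ha0.le ha1 two_ne_zero) hη.le
    have hy : 2 ≤ 1 / η * (1 / a) := by nlinarith
    have hG : (gridSize α η + 1 : ℝ) ≤ 9 * (1 / η * (1 / a)) := by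
      have : 8 * Real.log (η⁻¹ - 1) / a ≤ 8 * (1 / η * (1 / a)) := by
        rw [mul_one_div, mul_div_assoc']
        gcongr
      linarith
    rw [show (3 : ℝ) * Real.log r = Real.log (r ^ 3) by rw [Real.log_pow]; norm_num,
      Real.exp_log (by positivity)]
    nlinarith [mul_le_mul h4 h4 (by norm_num) hr0.le]

/-- The bound of `not_typicalData_le`, with `g` grid points, is at most `δ` if its exponent is
`10 * Λ * logWeight cΦ Ns δ`, where `Λ` is to be the logarithm of the rate. -/
theorem union_bound_le {N cΦ Ns : ℕ} {δ g Λ : ℝ} (hc : 1 ≤ cΦ) (hN : 1 ≤ Ns) (hδ : 0 < δ)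
    (hδ1 : δ ≤ 1) (hΛ : 1 ≤ Λ) (h4 : 4 ≤ Real.exp Λ) (hH : (N : ℝ) ≤ Real.exp Λ)
    (hg1 : 1 ≤ g) (hg : g ≤ Real.exp (3 * Λ)) :
    N * ((cΦ : ℝ) ^ 2 * g ^ Ns ^ 2 + 3 * (Ns : ℝ) ^ 2 * cΦ) *
      Real.exp (-(10 * Λ * logWeight cΦ Ns δ)) ≤ δ := by
  set L := Real.log ((cΦ : ℝ) / δ) with hL
  have hc' : (1 : ℝ) ≤ cΦ := by exact_mod_cast hc
  have hN' : (1 : ℝ) ≤ (Ns : ℝ) ^ 2 := one_le_pow₀ (by exact_mod_cast hN)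
  have hL0 : 0 ≤ L := log_card_div_nonneg hc hδ hδ1
  have hexpL : Real.exp L = cΦ / δ := Real.exp_log (by positivity)
  have hcδ : (cΦ : ℝ) = δ * Real.exp L := by rw [hexpL]; field_simp
  have hpow : g ^ Ns ^ 2 ≤ Real.exp (3 * Λ * (Ns : ℝ) ^ 2) := by
    refine (pow_le_pow_left₀ (by linarith) hg _).trans (le_of_eq ?_)
    rw [← Real.exp_nat_mul]
    push_cast
    ring_nf
  have hpow1 : 1 ≤ g ^ Ns ^ 2 := one_le_pow₀ hg1
  have hNexp : (Ns : ℝ) ^ 2 ≤ Real.exp ((Ns : ℝ) ^ 2) := by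
    linarith [Real.add_one_le_exp ((Ns : ℝ) ^ 2)]
  have h1 : (cΦ : ℝ) ^ 2 * g ^ Ns ^ 2 + 3 * (Ns : ℝ) ^ 2 * cΦ ≤
      4 * ((Ns : ℝ) ^ 2 * (cΦ ^ 2 * g ^ Ns ^ 2)) := by
    have h2 : (cΦ : ℝ) ≤ cΦ ^ 2 * g ^ Ns ^ 2 := by
      rw [sq, mul_assoc]
      exact le_mul_of_one_le_right (by positivity) (one_le_mul_of_one_le_of_one_le hc' hpow1)
    have h3 : (cΦ : ℝ) ^ 2 * g ^ Ns ^ 2 ≤ (Ns : ℝ) ^ 2 * (cΦ ^ 2 * g ^ Ns ^ 2) :=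
      le_mul_of_one_le_left (by positivity) hN'
    have h4' := mul_le_mul_of_nonneg_left h2 (sq_nonneg (Ns : ℝ))
    linarith
  have h2 : 4 * ((Ns : ℝ) ^ 2 * (cΦ ^ 2 * g ^ Ns ^ 2)) ≤ Real.exp Λ *
      (Real.exp ((Ns : ℝ) ^ 2) * (δ * Real.exp L ^ 2 * Real.exp (3 * Λ * (Ns : ℝ) ^ 2))) := by
    have h3 : (cΦ : ℝ) ^ 2 ≤ δ * Real.exp L ^ 2 := by
      rw [hcδ, mul_pow]
      exact mul_le_mul_of_nonneg_right (pow_le_of_le_one hδ.le hδ1 two_ne_zero) (by positivity)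
    gcongr
  calc N * ((cΦ : ℝ) ^ 2 * g ^ Ns ^ 2 + 3 * (Ns : ℝ) ^ 2 * cΦ) *
        Real.exp (-(10 * Λ * logWeight cΦ Ns δ))
      ≤ Real.exp Λ * (Real.exp Λ *
      (Real.exp ((Ns : ℝ) ^ 2) * (δ * Real.exp L ^ 2 * Real.exp (3 * Λ * (Ns : ℝ) ^ 2)))) *
        Real.exp (-(10 * Λ * logWeight cΦ Ns δ)) := by
        gcongr
        exact h1.trans h2
    _ = δ * Real.exp (Λ + Λ + (Ns : ℝ) ^ 2 + 2 * L + 3 * Λ * (Ns : ℝ) ^ 2 -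
        10 * Λ * logWeight cΦ Ns δ) := by
        rw [sub_eq_add_neg]
        simp only [Real.exp_add]
        rw [show (2 : ℝ) * L = L + L by ring, Real.exp_add]
        ring
    _ ≤ δ * 1 := by
        refine mul_le_mul_of_nonneg_left (Real.exp_le_one_iff.2 ?_) hδ.le
        have h3 : Λ ≤ Λ * (Ns : ℝ) ^ 2 := le_mul_of_one_le_right (by linarith) hN'
        have h5 : (Ns : ℝ) ^ 2 ≤ Λ * (Ns : ℝ) ^ 2 := le_mul_of_one_le_left (by positivity) hΛ
        have h6 : L ≤ Λ * L := le_mul_of_one_le_left hL0 hΛ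
        have h7 : logWeight cΦ Ns δ = L + (Ns : ℝ) ^ 2 := rfl
        rw [h7]
        nlinarith
    _ = δ := mul_one δ

/-- The exponent in the tail bound for deviating episodes is large if there are enough episodes. -/
theorem le_deviants_exponent {H W r Λ p m c n : ℝ} (hH : 0 < H) (hp : 0 < p) (hm : 0 < m) (hr : 0 < r)
    (hΛ : 0 < Λ) (hW : H ^ 2 * W ≤ r * (p * m) ^ 2) (hc : 0 < c) (hcΛ : c ≤ 4 * Λ)
    (hn : 2 ^ 35 * r * Λ ^ 3 ≤ n) :
    10 * Λ * W ≤ 2 * (p / 256 * (m / (64 * H) * n)) ^ 2 / (n * c ^ 2) := by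
  have hn0 : 0 < n := lt_of_lt_of_le (by positivity) hn
  -- Here `2 ^ 28 = (256 * 64) ^ 2` and `160 = 10 * 16`, from `c ^ 2 ≤ 16 * Λ ^ 2`.
  have key : 160 * Λ ^ 3 * (H ^ 2 * W) * 2 ^ 28 ≤ 2 * (p * m) ^ 2 * n := by
    have h1 := mul_le_mul_of_nonneg_left hW (show 0 ≤ 160 * Λ ^ 3 * 2 ^ 28 by positivity)
    have h2 := mul_le_mul_of_nonneg_left hn (show 0 ≤ 2 * (p * m) ^ 2 by positivity)
    have h3 : 0 ≤ r * (p * m) ^ 2 * Λ ^ 3 := by positivity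
    nlinarith
  rcases le_total W 0 with hW0 | hW0
  · exact (mul_nonpos_of_nonneg_of_nonpos (by positivity) hW0).trans (by positivity)
  have hc2 : c ^ 2 ≤ 16 * Λ ^ 2 := by
    have := pow_le_pow_left₀ hc.le hcΛ 2
    rwa [mul_pow, show (4 : ℝ) ^ 2 = 16 by norm_num] at this
  rw [le_div_iff₀ (by positivity), show 2 * (p / 256 * (m / (64 * H) * n)) ^ 2 =
    2 * (p * m) ^ 2 * n * n / (2 ^ 28 * H ^ 2) by field_simp; norm_num, le_div_iff₀ (by positivity)]
  calc 10 * Λ * W * (n * c ^ 2) * (2 ^ 28 * H ^ 2)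
      ≤ 10 * Λ * W * (n * (16 * Λ ^ 2)) * (2 ^ 28 * H ^ 2) := by gcongr
    _ = 160 * Λ ^ 3 * (H ^ 2 * W) * 2 ^ 28 * n := by ring
    _ ≤ _ := mul_le_mul_of_nonneg_right key hn0.le

section Confidence

variable {N : ℕ} {A : Type*} {S E X : Fin (N + 1) → Type*}
  [∀ h, MeasurableSpace (E h)] [∀ h, MeasurableSpace (X h)] {nA nB : ℕ}
  {M : ExBMDP N A S E X} {τ₀ : Fin nA ⊕ Fin nB → ∀ h, X h}
  {α η ν ε δ : ℝ}

theorem countPair_le (M : ExBMDP N A S E X) (τ : Fin nA ⊕ Fin nB → ∀ h, X h) (h : Fin N)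
    (s : S h.castSucc) (s' : S h.succ) : (countPair M τ h s s' : ℝ) ≤ (nA : ℝ) + nB := by
  have := Finset.card_le_univ (pairEpisodes M τ h s s')
  rw [card_pairEpisodes, Fintype.card_sum, Fintype.card_fin, Fintype.card_fin] at this
  exact_mod_cast this

theorem PairCoverage.le_one (hcov : PairCoverage M τ₀ ν) {h : Fin N} {s s'}
    (hs : M.CanTransition h s s') : ν ≤ 1 :=
  (hcov h s s' hs).trans (div_le_one_of_le₀ (countPair_le M τ₀ h s s') (by positivity))

theorem AgentShare.le_half (hshare : AgentShare M τ₀ η) {h : Fin N} {s s'}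
    (hs : M.CanTransition h s s') : η ≤ 1 / 2 := by
  obtain ⟨h1, h2⟩ := hshare h s s' hs
  have h3 : (countA M τ₀ h s s' : ℝ) / countPair M τ₀ h s s' +
      (countB M τ₀ h s s' : ℝ) / countPair M τ₀ h s s' ≤ 1 := by
    rw [← add_div, ← Nat.cast_add]
    exact div_self_le_one _
  linarith

variable [∀ h, Fintype (S h)] {G : ∀ h, Finset (X h → Bool)} {Ns : ℕ}
  {Φ : ∀ h, Finset (X h → Fin Ns)}

/-- With sufficiently many episodes of every latent transition, the data are typical with
probability at least `1 - δ`, whatever the latent trajectories. -/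
theorem not_typicalData_le_of_sampleBound_le (hR : Realizable M Ns Φ G) (hν : 0 < ν) (hη : 0 < η)
    (hα : 0 < α) (hε : 0 < ε) (hδ : 0 < δ) (hδ1 : δ ≤ 1) (hcov : PairCoverage M τ₀ ν)
    (hsep : PolicySeparation M τ₀ α) (hshare : AgentShare M τ₀ η)
    (hcp : 0 < minStateCoverage M τ₀) (hfeas : AllFeasible M τ₀)
    (hcount : ∀ (h : Fin N) (s : S h.castSucc) (s' : S h.succ), M.CanTransition h s s' →
      sampleBound (N + 1) (Finset.univ.sup fun h => (Φ h).card) Ns δ ε ν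
        (minStateCoverage M τ₀) η α ≤ countPair M τ₀ h s s') :
    (condLaw M τ₀).real {τ | ¬ TypicalData M Φ G α η ν ε τ} ≤ δ := by
  set cΦ := Finset.univ.sup fun h => (Φ h).card
  have hcΦ : ∀ h, (Φ h).card ≤ cΦ := fun h =>
    Finset.le_sup (f := fun h => (Φ h).card) (Finset.mem_univ h)
  have hc1 : 1 ≤ cΦ := (Finset.card_pos.2 (hR.nonempty 0)).trans_le (hcΦ 0)
  have hN1 : 1 ≤ Ns := (Fintype.card_pos_iff.2 ⟨M.init⟩).trans_le (hR.card_le 0)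
  have hn := pos_of_minStateCoverage_pos hcp
  set ν' := minStateCoverage M τ₀ with hν'
  rcases Nat.eq_zero_or_pos N with rfl | hN
  -- Without latent transitions, the union bound is empty.
  · refine (not_typicalData_le hR hν hη hα hε hcov hsep hshare hcp hfeas hcΦ (R := 0)
      (fun h => h.elim0) (fun h => h.elim0) fun h => h.elim0).trans ?_
    simpa using hδ.le
  obtain ⟨i⟩ : Nonempty (Fin nA ⊕ Fin nB) := by
    rw [← Fintype.card_pos_iff, Fintype.card_sum, Fintype.card_fin, Fintype.card_fin]
    exact_mod_cast hn
  -- The transition of any one episode shows that `ν` and `η` are in the range of the rate bounds.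
  have htrans := hfeas i ⟨0, hN⟩
  have hν1 := hcov.le_one htrans
  have hη2 := hshare.le_half htrans
  have hν'1 : ν' ≤ 1 := minStateCoverage_le_one
  have hn' := (hcount _ _ _ htrans).trans (countPair_le M τ₀ _ _ _)
  unfold sampleBound at hcount hn'
  set r := rate (N + 1) cΦ Ns δ ε ν ν' η (min 1 α) with hr
  have ha0 : 0 < min 1 α := lt_min one_pos hα
  have ha1 : min 1 α ≤ 1 := min_le_left _ _
  have hW1 := one_le_logWeight hc1 hN1 hδ hδ1
  have hW0 := zero_le_one.trans hW1
  obtain ⟨h4, hΛ, hHr, hrW, hgap, hgrid⟩ := log_rate_bounds (Nat.le_add_left 1 N) hc1 hN1 hδ hδ1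
    hν hν1 hη hη2 hα hr
  have hr0 : 0 < r := by linarith
  have hrε := logWeight_le_rate_mul_sq (H := N + 1) (Nat.le_add_left 1 N) hW0 hν hν1 hcp hν'1 hη
    hη2 ha0 ha1 hε
  have hrm := logWeight_le_rate_mul_min (H := N + 1) hW0 hν hν1 hcp hη ha0 hε
  rw [← hr] at hrε hrm
  set Λ := Real.log r
  set W := logWeight cΦ Ns δ
  have hΛW : 0 ≤ Λ * W := mul_nonneg (by linarith) hW0
  have hΛ3 : Λ ≤ Λ ^ 3 := le_self_pow₀ hΛ (by norm_num)
  refine (not_typicalData_le hR hν hη hα hε hcov hsep hshare hcp hfeas hcΦ (R := 10 * Λ * W)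
    (fun _ => ?_) (fun h s s' hs => ?_) fun h s s' hs => ?_).trans
    (union_bound_le hc1 hN1 hδ hδ1 hΛ ?_ ?_ ?_ hgrid)
  · have := gridBound_nonneg (η := η) hα
    have hl : 0 < lossGap α η := by unfold lossGap; positivity
    exact le_deviants_exponent (by positivity) (by positivity) (lt_min hν (by positivity)) hr0
      (by linarith) (by exact_mod_cast hrm) (by linarith) hgap hn'
  · have h1 := hcount h s s' hs
    have h2 : Λ * W ≤ r * Λ ^ 3 := by
      rw [mul_comm r]; exact mul_le_mul hΛ3 hrW hW0 (by positivity)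
    linarith
  · have h1 := mul_le_mul_of_nonneg_left (hcount h s s' hs) (sq_nonneg ε)
    have h2 : Λ * W ≤ Λ ^ 3 * (r * ε ^ 2) := mul_le_mul hΛ3 hrε hW0 (by positivity)
    linarith
  · rwa [Real.exp_log hr0]
  · rw [Real.exp_log hr0]
    refine le_trans ?_ hHr
    push_cast; linarith
  · linarith [Nat.cast_nonneg (α := ℝ) (gridSize α η)]

end Confidence

/-! ### The success probability under an arbitrary law of the latent trajectories -/

section Mixture

variable {N : ℕ} {A : Type*} {S E X : Fin (N + 1) → Type*}
  [∀ h, MeasurableSpace (E h)] [∀ h, MeasurableSpace (X h)] [∀ h, Fintype (S h)] {nA nB : ℕ}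
  {M : ExBMDP N A S E X} {Λ : PMF (Fin nA ⊕ Fin nB → ∀ h, S h)}

theorem ae_pi_of_ae_dataLaw {p : (Fin nA ⊕ Fin nB → ∀ h, X h) → Prop}
    (hp : ∀ᵐ τ ∂(M.dataLaw Λ), p τ) {z : Fin nA ⊕ Fin nB → ∀ h, S h} (hz : z ∈ Λ.support) :
    ∀ᵐ τ ∂(Measure.pi fun i => M.obsLaw (z i)), p τ := by
  rw [ae_iff, ExBMDP.dataLaw, Measure.finsetSum_apply, Finset.sum_eq_zero_iff] at hp
  have := hp z (Finset.mem_univ z)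
  rw [Measure.smul_apply, smul_eq_mul, mul_eq_zero] at this
  exact ae_iff.2 (this.resolve_left ((Λ.mem_support_iff z).1 hz))

/-- A bound on the probability of an event given the latent trajectories holds for the mixture. -/
theorem dataLaw_le_of_forall_pi_le {B : Set (Fin nA ⊕ Fin nB → ∀ h, X h)} {c : ENNReal}
    (h : ∀ z ∈ Λ.support, (Measure.pi fun i => M.obsLaw (z i)) B ≤ c) : M.dataLaw Λ B ≤ c := by
  rw [ExBMDP.dataLaw, Measure.finsetSum_apply]
  calc ∑ z, (Λ z • Measure.pi fun i => M.obsLaw (z i)) B ≤ ∑ z, Λ z * c := by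
        refine Finset.sum_le_sum fun z _ => ?_
        rw [Measure.smul_apply, smul_eq_mul]
        by_cases hz : z ∈ Λ.support
        · exact mul_le_mul_right (h z hz) _
        · rw [(Λ.apply_eq_zero_iff z).2 hz, zero_mul, zero_mul]
    _ = c := by
        rw [← Finset.sum_mul, ← tsum_fintype (L := .unconditional _), Λ.tsum_coe, one_mul]

instance : IsProbabilityMeasure (M.dataLaw Λ) := by
  refine ⟨?_⟩
  rw [ExBMDP.dataLaw, Measure.finsetSum_apply]
  simp only [Measure.smul_apply, measure_univ, smul_eq_mul, mul_one]
  rw [← tsum_fintype (L := .unconditional _), Λ.tsum_coe]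

end Mixture

end CRAFT

theorem theorem1 :
    ∃ f : ℕ → ℕ → ℕ → ℝ → ℝ → ℝ → ℝ → ℝ → ℝ → ℝ,
      (∃ (C : ℝ) (k : ℕ), ∀ (H cardΦ Ns : ℕ) (δ ε ν ν' η α : ℝ),
        1 ≤ H → 1 ≤ cardΦ → 1 ≤ Ns → 0 < δ → δ ≤ 1 → 0 < ε → 0 < ν → ν ≤ 1 →
        0 < ν' → ν' ≤ 1 → 0 < η → η ≤ 1 / 2 → 0 < α →
          f H cardΦ Ns (1 / δ) (1 / ε) (1 / ν) (1 / ν') (1 / η) (1 / α) ≤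
            C * CRAFT.rate H cardΦ Ns δ ε ν ν' η (min 1 α) *
              Real.log (CRAFT.rate H cardΦ Ns δ ε ν ν' η (min 1 α)) ^ k) ∧
      ∀ (N : ℕ) (A : Type*) (S E X : Fin (N + 1) → Type*)
        [∀ h, Fintype (S h)] [∀ h, MeasurableSpace (E h)] [∀ h, MeasurableSpace (X h)]
        (M : CRAFT.ExBMDP N A S E X)
        (Ns : ℕ) (Φ : ∀ h, Finset (X h → Fin Ns)) (G : ∀ h, Finset (X h → Bool))
        (_ : CRAFT.Realizable M Ns Φ G)
        (nA nB : ℕ) (Λ : PMF (Fin nA ⊕ Fin nB → ∀ h, S h))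
        (_ : ∀ z ∈ Λ.support, ∀ i, M.Feasible (z i))
        (ν η α δ ε : ℝ) (_ : 0 < ν) (_ : 0 < η) (_ : 0 < α) (_ : 0 < δ) (_ : 0 < ε)
        (_ : ∀ᵐ τ ∂(M.dataLaw Λ), CRAFT.PairCoverage M τ ν ∧ CRAFT.PolicySeparation M τ α ∧
          CRAFT.AgentShare M τ η ∧ 0 < CRAFT.minStateCoverage M τ ∧
          ∀ (h : Fin N) (s : S h.castSucc) (s' : S h.succ), M.CanTransition h s s' →
            f (N + 1) (Finset.univ.sup fun h => (Φ h).card) Ns (1 / δ) (1 / ε) (1 / ν)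
              (1 / CRAFT.minStateCoverage M τ) (1 / η) (1 / α) ≤ CRAFT.countPair M τ h s s'),
        ∃ good : Set (Fin nA ⊕ Fin nB → ∀ h, X h), MeasurableSet good ∧
          ENNReal.ofReal (1 - δ) ≤ M.dataLaw Λ good ∧
          ∀ τ ∈ good,
            (∃ St φ', CRAFT.IsRun α η ν Φ G τ St φ') ∧
            ∀ St φ', CRAFT.IsRun α η ν Φ G τ St φ' →
              ∀ h, CRAFT.Accurate M ε h (St h).length (φ' h) := by
  refine ⟨fun H cΦ Ns a b c d e g =>
    CRAFT.sampleBound H cΦ Ns (1 / a) (1 / b) (1 / c) (1 / d) (1 / e) (1 / g),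
    ⟨2 ^ 35, 3, fun H cΦ Ns δ ε ν ν' η α _ _ _ _ _ _ _ _ _ _ _ _ _ => ?_⟩, ?_⟩
  · simp only [one_div_one_div]
    exact le_rfl
  intro N A S E X _ _ _ M Ns Φ G hR nA nB Λ hfeas ν η α δ ε hν hη hα hδ hε hae
  simp only [one_div_one_div] at hae
  rcases lt_or_ge 1 δ with hδ1 | hδ1
  -- For `1 < δ` the probability bound is vacuous.
  · refine ⟨∅, MeasurableSet.empty, ?_, fun τ hτ => absurd hτ (Set.notMem_empty τ)⟩
    rw [ENNReal.ofReal_of_nonpos (by linarith)]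
    exact zero_le
  set bad : Set (Fin nA ⊕ Fin nB → ∀ h, X h) :=
    {τ | ¬ CRAFT.TypicalData M Φ G α η ν ε τ} with hbad
  have hle : M.dataLaw Λ bad ≤ ENNReal.ofReal δ := by
    refine CRAFT.dataLaw_le_of_forall_pi_le fun z hz => ?_
    -- The assumptions depend on the data through the latent trajectories only, so that they can be
    -- read off from any one dataset with the latent trajectories `z`.
    obtain ⟨τ₀, ⟨hcov, hsep, hshare, hcp, hcount⟩, henc⟩ :=
      ((CRAFT.ae_pi_of_ae_dataLaw hae hz).and (M.ae_pi_obsLaw_enc z)).exists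
    have hcond : (Measure.pi fun i => M.obsLaw (z i)) = CRAFT.condLaw M τ₀ := by
      unfold CRAFT.condLaw
      congr 1
      funext i
      congr 1
      funext h
      exact (henc i h).symm
    rw [hcond, ← ENNReal.ofReal_toReal (measure_ne_top (CRAFT.condLaw M τ₀) bad)]
    refine ENNReal.ofReal_le_ofReal (CRAFT.not_typicalData_le_of_sampleBound_le hR hν hη hα hε hδ
      hδ1 hcov hsep hshare hcp (fun i h => ?_) hcount)
    rw [henc, henc]
    exact (hfeas z hz i).2 h
  -- The set of typical datasets need not be measurable.
  refine ⟨(toMeasurable (M.dataLaw Λ) bad)ᶜ, (measurableSet_toMeasurable _ _).compl, ?_,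
    fun τ hτ => ⟨CRAFT.exists_isRun hR, fun St φ' hrun h => ?_⟩⟩
  · rw [prob_compl_eq_one_sub (measurableSet_toMeasurable _ _), measure_toMeasurable,
      ENNReal.ofReal_sub _ hδ.le, ENNReal.ofReal_one]
    exact tsub_le_tsub_left hle 1
  · have htyp : CRAFT.TypicalData M Φ G α η ν ε τ := by
      by_contra hcon
      exact hτ (subset_toMeasurable _ _ hcon)
    exact CRAFT.accurate_of_isRun hR hν hη hα hε htyp hrun h
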